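/- Let $N\ge 4$ and $m$ be integers with $2\le m\le N/2$ and $N-2m\neq 1$, let $p\in(2,4+\frac4N)$ and $\lambda>0$. Let $f:\mathbb{R}\to\mathbb{R}$ be the unique odd function with $f'(t)=\dfrac{1}{\sqrt{1+2f(t)^2}}$ for $t\ge 0$, and define on the real Hilbert space $H^1(\mathbb{R}^N)$ (with $\|v\|^2=\|v\|_2^2+\|\nabla v\|_2^2$) $$I(v)=\frac12\int_{\mathbb{R}^N}|\nabla v|^2\,dx-\frac1p\int_{\mathbb{R}^N}|f(v)|^p\,dx .$$ Write $x=(x_1,x_2,x_3)\in\mathbb{R}^N=\mathbb{R}^m\times\mathbb{R}^m\times\mathbb{R}^{N-2m}$, $\tau(x_1,x_2,x_3)=(x_2,x_1,x_3)$, $\mathbf{G}=O(m)\times O(m)\times O(N-2m)$ (acting block-diagonally), and let $$\mathbf{Y}_{\mathbf{G}}=\{v\in H^1(\mathbb{R}^N): v(gx)=v(x)\ \text{for all } g\in\mathbf{G},\ v(\tau x)=-v(x)\},\qquad \mathbb{Y}_\lambda=\Big\{v\in\mathbf{Y}_{\mathbf{G}}:\int_{\mathbb{R}^N}|f(v)|^2\,dx=\lambda\Big\},$$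 where the identities hold for almost every $x$. For $v\in\mathbb{Y}_\lambda$ let $T_v\mathbb{Y}_\lambda$ be the set of all $h=\dot\zeta(0)$, where $\zeta:(-\varepsilon,\varepsilon)\to H^1(\mathbb{R}^N)$ is $C^1$ for some $\varepsilon>0$, $\zeta(0)=0$ and $v+\zeta(t)\in\mathbb{Y}_\lambda$ for all $t$. Then $I$ is of class $C^1$ on $H^1(\mathbb{R}^N)$, and $I|_{\mathbb{Y}_\lambda}$ satisfies the Palais–Smale condition $(PS)_c$ for every $c<0$: if $(v_n)\subset\mathbb{Y}_\lambda$ satisfies $I(v_n)\to c$ and $$\|I|_{\mathbb{Y}_\lambda}'(v_n)\|:=\sup\{|I'(v_n)h| : h\in T_{v_n}\mathbb{Y}_\lambda,\ \|h\|\le 1\}\to 0,$$ then $(v_n)$ has a subsequence that converges in the norm of $H^1(\mathbb{R}^N)$ to an element of $\mathbb{Y}_\lambda$. -/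

import Mathlib

open MeasureTheory Filter Topology Set
open scoped ENNReal ContDiff Matrix

namespace QuasilinearDual

/-! ### The change of variable `f` -/

/-- `f` is odd and solves `f' = 1 / √(1 + 2 f²)` on `[0, ∞)`. -/
def IsDualChange (f : ℝ → ℝ) : Prop :=
  (∀ t, f (-t) = -f t) ∧ ∀ t, 0 ≤ t → HasDerivAt f (1 / √(1 + 2 * f t ^ 2)) t

theorem IsDualChange.hasDerivAt {f : ℝ → ℝ} (hf : IsDualChange f) (t : ℝ) :
    HasDerivAt f (1 / √(1 + 2 * f t ^ 2)) t := by
  rcases le_total 0 t with ht | ht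
  · exact hf.2 t ht
  · have h1 := hf.2 (-t) (by linarith)
    have h2 : HasDerivAt (fun s => -f (-s)) (1 / √(1 + 2 * f (-t) ^ 2)) t := by
      have h := (h1.scomp t (hasDerivAt_neg t)).neg
      rw [neg_smul, one_smul, neg_neg] at h
      exact h
    have h3 : (fun s => -f (-s)) = f := by
      funext s
      rw [hf.1 s, neg_neg]
    rw [h3, hf.1 t, neg_sq] at h2
    exact h2

theorem IsDualChange.map_zero {f : ℝ → ℝ} (hf : IsDualChange f) : f 0 = 0 := by
  have := hf.1 0
  rw [neg_zero] at this
  linarith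

/-- The inverse of `f`, as a primitive. -/
noncomputable def dualChangeInv (s : ℝ) : ℝ := ∫ t in (0 : ℝ)..s, √(1 + 2 * t ^ 2)

theorem hasDerivAt_dualChangeInv (s : ℝ) :
    HasDerivAt dualChangeInv (√(1 + 2 * s ^ 2)) s := by
  have hc : Continuous fun t : ℝ => √(1 + 2 * t ^ 2) := by fun_prop
  exact intervalIntegral.integral_hasDerivAt_right (hc.intervalIntegrable _ _)
    hc.aestronglyMeasurable.stronglyMeasurableAtFilter hc.continuousAt

theorem sqrt_pos_aux (s : ℝ) : 0 < √(1 + 2 * s ^ 2) := Real.sqrt_pos.2 (by positivity)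

theorem strictMono_dualChangeInv : StrictMono dualChangeInv := by
  apply strictMono_of_deriv_pos
  intro s
  rw [(hasDerivAt_dualChangeInv s).deriv]
  exact sqrt_pos_aux s

theorem dualChangeInv_neg (s : ℝ) : dualChangeInv (-s) = -dualChangeInv s := by
  unfold dualChangeInv
  have h := intervalIntegral.integral_comp_neg (a := 0) (b := s) fun t : ℝ => √(1 + 2 * t ^ 2)
  simp only [neg_sq, neg_zero] at h
  rw [h, intervalIntegral.integral_symm]

theorem le_dualChangeInv {s : ℝ} (hs : 0 ≤ s) : s ≤ dualChangeInv s := by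
  have hc : Continuous fun t : ℝ => √(1 + 2 * t ^ 2) := by fun_prop
  have h := intervalIntegral.integral_mono (μ := volume) hs
    (continuous_const (y := (1 : ℝ)).intervalIntegrable 0 s) (hc.intervalIntegrable 0 s)
    (fun t => by
      rw [Real.le_sqrt' one_pos]
      nlinarith [sq_nonneg t])
  simpa [dualChangeInv] using h

theorem continuous_dualChangeInv : Continuous dualChangeInv :=
  continuous_iff_continuousAt.2 fun s => (hasDerivAt_dualChangeInv s).continuousAt

theorem surjective_dualChangeInv : Function.Surjective dualChangeInv := by
  apply continuous_dualChangeInv.surjective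
  · exact tendsto_atTop_mono' atTop
      ((eventually_ge_atTop (0 : ℝ)).mono fun s hs => le_dualChangeInv hs) tendsto_id
  · refine tendsto_atBot_mono' atBot
      ((eventually_le_atBot (0 : ℝ)).mono fun s hs => ?_) tendsto_id
    have h := le_dualChangeInv (s := -s) (by linarith)
    rw [dualChangeInv_neg] at h
    show dualChangeInv s ≤ s
    linarith

theorem IsDualChange.leftInverse {f : ℝ → ℝ} (hf : IsDualChange f) (t : ℝ) :
    dualChangeInv (f t) = t := by
  have hd : ∀ s, HasDerivAt (fun s => dualChangeInv (f s) - s) 0 s := by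
    intro s
    have h := ((hasDerivAt_dualChangeInv (f s)).comp s (hf.hasDerivAt s)).sub (hasDerivAt_id s)
    rw [mul_one_div_cancel (sqrt_pos_aux (f s)).ne', sub_self] at h
    exact h
  have h := is_const_of_deriv_eq_zero (fun s => (hd s).differentiableAt)
    (fun s => (hd s).deriv) t 0
  simp only [hf.map_zero, sub_zero] at h
  have h0 : dualChangeInv 0 = 0 := by simp [dualChangeInv]
  linarith

theorem existsUnique_isDualChange : ∃! f : ℝ → ℝ, IsDualChange f := by
  let e : ℝ ≃o ℝ := StrictMono.orderIsoOfSurjective dualChangeInv strictMono_dualChangeInv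
    surjective_dualChangeInv
  have he : ∀ t, dualChangeInv (e.symm t) = t := fun t => e.apply_symm_apply t
  refine ⟨e.symm, ⟨fun t => ?_, fun t _ => ?_⟩, fun g hg => ?_⟩
  · apply strictMono_dualChangeInv.injective
    rw [he, dualChangeInv_neg, he]
  · rw [one_div]
    exact HasDerivAt.of_local_left_inverse e.symm.continuous.continuousAt
      (hasDerivAt_dualChangeInv _) (sqrt_pos_aux _).ne' (Eventually.of_forall he)
  · funext t
    apply strictMono_dualChangeInv.injective
    rw [he, hg.leftInverse]

/-- The dual function `f`: the unique odd function with `f' = 1 / √(1 + 2 f²)` on `[0, ∞)`. -/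
noncomputable def dualChange : ℝ → ℝ := existsUnique_isDualChange.choose

theorem isDualChange_dualChange : IsDualChange dualChange :=
  existsUnique_isDualChange.choose_spec.1

/-! ### The Sobolev space `H¹`, as a Hilbert space -/

section Sobolev

variable (E : Type*) [NormedAddCommGroup E] [InnerProductSpace ℝ E] [FiniteDimensional ℝ E]
  [MeasurableSpace E] [BorelSpace E]

variable {E} in
/-- `g` is the weak gradient of `u`, tested against all smooth compactly supported functions. -/
def IsWeakGradient (u : E → ℝ) (g : E → E) : Prop :=
  ∀ φ : E → ℝ, ContDiff ℝ ∞ φ → HasCompactSupport φ → ∀ y : E,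
    ∫ x, u x * fderiv ℝ φ x y = -∫ x, inner ℝ (g x) y * φ x

theorem integrable_mul_fderiv (u : Lp ℝ 2 (volume : Measure E)) {φ : E → ℝ}
    (hφ : ContDiff ℝ ∞ φ) (hc : HasCompactSupport φ) (y : E) :
    Integrable fun x => u x * fderiv ℝ φ x y := by
  have h1 : Continuous fun x => fderiv ℝ φ x y :=
    (hφ.continuous_fderiv (by simp)).clm_apply continuous_const
  have h2 : HasCompactSupport fun x => fderiv ℝ φ x y := hc.fderiv_apply ℝ y
  exact (Lp.memLp u).integrable_mul (q := 2) (h1.memLp_of_hasCompactSupport (p := 2) h2)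

theorem integrable_inner_mul (g : Lp E 2 (volume : Measure E)) {φ : E → ℝ}
    (hφ : ContDiff ℝ ∞ φ) (hc : HasCompactSupport φ) (y : E) :
    Integrable fun x => inner ℝ (g x) y * φ x :=
  ((Lp.memLp g).inner_const y).integrable_mul (q := 2)
    (hφ.continuous.memLp_of_hasCompactSupport hc)

/-- `H¹(E)`, realised as the pairs `(u, ∇u)` in `L²(E; ℝ) × L²(E; E)`. The Hilbert structure is the
inherited one, so that `‖v‖² = ‖u‖₂² + ‖∇u‖₂²`. -/
def H1 : Submodule ℝ
    (WithLp 2 (Lp ℝ 2 (volume : Measure E) × Lp E 2 (volume : Measure E))) where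
  carrier := {w | IsWeakGradient (w.fst : E → ℝ) (w.snd : E → E)}
  zero_mem' := by
    intro φ _ _ y
    have h1 : ∫ x, ((0 : Lp ℝ 2 (volume : Measure E)) : E → ℝ) x * fderiv ℝ φ x y = 0 := by
      apply integral_eq_zero_of_ae
      filter_upwards [Lp.coeFn_zero ℝ 2 (volume : Measure E)] with x hx
      rw [hx]
      simp
    have h2 : ∫ x, inner ℝ (((0 : Lp E 2 (volume : Measure E)) : E → E) x) y * φ x = 0 := by
      apply integral_eq_zero_of_ae
      filter_upwards [Lp.coeFn_zero E 2 (volume : Measure E)] with x hx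
      rw [hx]
      simp
    simp only [WithLp.zero_fst, WithLp.zero_snd]
    rw [h1, h2, neg_zero]
  add_mem' := by
    intro v w hv hw φ hφ hc y
    have h1 : ∫ x, ((v.fst + w.fst : Lp ℝ 2 (volume : Measure E)) : E → ℝ) x * fderiv ℝ φ x y
        = (∫ x, v.fst x * fderiv ℝ φ x y) + ∫ x, w.fst x * fderiv ℝ φ x y := by
      rw [← integral_add (integrable_mul_fderiv E _ hφ hc y) (integrable_mul_fderiv E _ hφ hc y)]
      apply integral_congr_ae
      filter_upwards [Lp.coeFn_add v.fst w.fst] with x hx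
      rw [hx, Pi.add_apply, add_mul]
    have h2 : ∫ x, inner ℝ (((v.snd + w.snd : Lp E 2 (volume : Measure E)) : E → E) x) y * φ x
        = (∫ x, inner ℝ (v.snd x) y * φ x) + ∫ x, inner ℝ (w.snd x) y * φ x := by
      rw [← integral_add (integrable_inner_mul E _ hφ hc y) (integrable_inner_mul E _ hφ hc y)]
      apply integral_congr_ae
      filter_upwards [Lp.coeFn_add v.snd w.snd] with x hx
      rw [hx, Pi.add_apply, inner_add_left, add_mul]
    simp only [WithLp.add_fst, WithLp.add_snd]
    rw [h1, h2, hv φ hφ hc y, hw φ hφ hc y, neg_add]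
  smul_mem' := by
    intro a v hv φ hφ hc y
    have h1 : ∫ x, ((a • v.fst : Lp ℝ 2 (volume : Measure E)) : E → ℝ) x * fderiv ℝ φ x y
        = a * ∫ x, v.fst x * fderiv ℝ φ x y := by
      rw [← integral_const_mul]
      apply integral_congr_ae
      filter_upwards [Lp.coeFn_smul a v.fst] with x hx
      rw [hx, Pi.smul_apply, smul_eq_mul, mul_assoc]
    have h2 : ∫ x, inner ℝ (((a • v.snd : Lp E 2 (volume : Measure E)) : E → E) x) y * φ x
        = a * ∫ x, inner ℝ (v.snd x) y * φ x := by
      rw [← integral_const_mul]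
      apply integral_congr_ae
      filter_upwards [Lp.coeFn_smul a v.snd] with x hx
      rw [hx, Pi.smul_apply, real_inner_smul_left, mul_assoc]
    simp only [WithLp.smul_fst, WithLp.smul_snd]
    rw [h1, h2, hv φ hφ hc y, mul_neg]

variable {E}

/-- A representative of an element of `H¹`. -/
noncomputable def fn (v : H1 E) : E → ℝ := (v : WithLp 2 (Lp ℝ 2 (volume : Measure E) ×
  Lp E 2 (volume : Measure E))).fst

/-- A representative of the weak gradient of an element of `H¹`. -/
noncomputable def grad (v : H1 E) : E → E := (v : WithLp 2 (Lp ℝ 2 (volume : Measure E) ×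
  Lp E 2 (volume : Measure E))).snd

/-- The dual functional `I(v) = ½ ∫ |∇v|² - (1/p) ∫ |f(v)|ᵖ`. -/
noncomputable def dualEnergy (p : ℝ) (v : H1 E) : ℝ :=
  (1 / 2) * (∫ x, ‖grad v x‖ ^ 2) - (1 / p) * (∫ x, |dualChange (fn v x)| ^ p)

/-- `Y_λ = {v ∈ H¹ : ∫ |f(v)|² = λ}`. -/
def massConstraint (lam : ℝ) : Set (H1 E) :=
  {v | (∫ x, |dualChange (fn v x)| ^ 2) = lam}

end Sobolev

/-! ### Symmetry -/

/-- `ℝᴺ = ℝᵐ × ℝᵐ × ℝᴺ⁻²ᵐ` with its Euclidean structure (for `2 m ≤ N`). -/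
abbrev Space (N m : ℕ) : Type := EuclideanSpace ℝ (Fin m ⊕ Fin m ⊕ Fin (N - 2 * m))

variable {N m : ℕ}

/-- The component `x₁` of a point `x = (x₁, x₂, x₃)`. -/
def Space.fst (x : Space N m) : Fin m → ℝ := fun i => x (Sum.inl i)

/-- The component `x₂`. -/
def Space.snd (x : Space N m) : Fin m → ℝ := fun i => x (Sum.inr (Sum.inl i))

/-- The component `x₃`. -/
def Space.thd (x : Space N m) : Fin (N - 2 * m) → ℝ := fun i => x (Sum.inr (Sum.inr i))

/-- The point with components `(x₁, x₂, x₃)`. -/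
def Space.mk (x₁ x₂ : Fin m → ℝ) (x₃ : Fin (N - 2 * m) → ℝ) : Space N m :=
  WithLp.toLp 2 (Sum.elim x₁ (Sum.elim x₂ x₃))

/-- `τ(x₁, x₂, x₃) = (x₂, x₁, x₃)`. -/
def swapBlocks (x : Space N m) : Space N m := Space.mk x.snd x.fst x.thd

/-- The action of `(A, B, C) ∈ O(m) × O(m) × O(N - 2m)`. -/
def blockAct (A B : Matrix.orthogonalGroup (Fin m) ℝ)
    (C : Matrix.orthogonalGroup (Fin (N - 2 * m)) ℝ) (x : Space N m) : Space N m :=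
  Space.mk ((A : Matrix (Fin m) (Fin m) ℝ) *ᵥ x.fst) ((B : Matrix (Fin m) (Fin m) ℝ) *ᵥ x.snd)
    ((C : Matrix (Fin (N - 2 * m)) (Fin (N - 2 * m)) ℝ) *ᵥ x.thd)

/-- `Y_G`: the `v ∈ H¹(ℝᴺ)` that are invariant under `O(m) × O(m) × O(N - 2m)` and satisfy
`v(τ x) = -v(x)`; identities between elements of `H¹` hold almost everywhere. -/
def symmetricSpace (N m : ℕ) : Set (H1 (Space N m)) :=
  {v | (∀ (A B : Matrix.orthogonalGroup (Fin m) ℝ)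
        (C : Matrix.orthogonalGroup (Fin (N - 2 * m)) ℝ),
          ∀ᵐ x : Space N m, fn v (blockAct A B C x) = fn v x) ∧
      ∀ᵐ x : Space N m, fn v (swapBlocks x) = -fn v x}

/-- `𝕐_λ = Y_G ∩ Y_λ`. -/
def symmetricConstraint (N m : ℕ) (lam : ℝ) : Set (H1 (Space N m)) :=
  symmetricSpace N m ∩ massConstraint lam

/-! ### The Palais–Smale condition on a constraint -/

section PalaisSmale

variable {X : Type*} [NormedAddCommGroup X] [NormedSpace ℝ X]

/-- The tangent space of `M` at `w₀`: the initial velocities of `C¹` curves `t ↦ w₀ + ζ(t)` in `M`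
with `ζ(0) = 0`. -/
def tangentVectors (M : Set X) (w₀ : X) : Set X :=
  {h | ∃ ε > 0, ∃ ζ : ℝ → X, ContDiffOn ℝ 1 ζ (Ioo (-ε) ε) ∧
    (∀ t ∈ Ioo (-ε) ε, w₀ + ζ t ∈ M) ∧ ζ 0 = 0 ∧ HasDerivAt ζ h 0}

/-- The norm of the differential of `F` restricted to the tangent space of `M` at `v`. -/
noncomputable def constrainedDerivNorm (F : X → ℝ) (M : Set X) (v : X) : ℝ≥0∞ :=
  ⨆ h ∈ {h ∈ tangentVectors M v | ‖h‖ ≤ 1}, ‖fderiv ℝ F v h‖ₑ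

/-- The Palais–Smale condition `(PS)_c` for the restriction to `M` of a differentiable functional
`F`: if `vₙ ∈ M`, `F(vₙ) → c` and `‖(F|_M)'(vₙ)‖ → 0`, then a subsequence of `vₙ` converges in `M`,
in the norm of `X`. -/
def PalaisSmaleOn (F : X → ℝ) (M : Set X) (c : ℝ) : Prop :=
  ∀ v : ℕ → X, (∀ n, v n ∈ M) → Tendsto (fun n => F (v n)) atTop (𝓝 c) →
    Tendsto (fun n => constrainedDerivNorm F M (v n)) atTop (𝓝 0) →
    ∃ w ∈ M, ∃ k : ℕ → ℕ, StrictMono k ∧ Tendsto (fun n => v (k n)) atTop (𝓝 w)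

end PalaisSmale

end QuasilinearDual

/-! Notation: `φ = f f'` (`dualMass`), `Ψ(v) = ∫ f(v)²` (`massFunctional`), `r = 2/N` (`growthExp`).
The analysis rests on one estimate, `integral_rpow_mul_sq_le`: Hölder with exponents `N/2` and
`N/(N-2)` and the Sobolev inequality give `∫ aʳ v² ≤ S (∫ a)ʳ ‖∇v‖²` for `a ≥ 0`.

Regularity and boundedness. Since `f` grows like a square root, the derivative of `|f|^p / p` has a
Lipschitz constant growing like `|t|ʳ` exactly when `p ≤ 4 + 2r = 4 + 4/N`. The estimate then makes
it a continuous operator from `H¹` to `L²`, whence `I` is `C¹`. With `a = f(v)²` and `f⁴ ≤ 2t²` it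
bounds `∫ |f(v)|^(4+4/N)` by a constant times `λʳ ‖∇v‖²`; for smaller `p` the power term is thus a
small multiple of `‖∇v‖²` plus a constant, and energy bounds on the constraint become `H¹` bounds
(`exists_norm_le_of_dualEnergy_le`).

Compactness. Because `m ≥ 2` and `N - 2m ≠ 1`, the orbit of a far point contains many well separated
points, so symmetric functions carry little mass near any far point. Hence weakly null symmetric
sequences tend to zero in `L^(2+4/N)` (`tendsto_integral_critExp`). This controls the power term,
which is `o(t)` at zero, but not the `L²` norm: `φ(t)` behaves like `t` at zero.

The sign of the multiplier. The inequality `Ψ'(v)v ≥ Ψ(v) = λ` keeps the constraint uniformly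
regular, so `I'(vₙ) ≈ νₙ Ψ'(vₙ)` with bounded `νₙ` (`exists_multiplier`). A weak limit `w` solves
the Lagrange equation with `μ = lim νₙ` against symmetric test functions, hence against all of them
(`symmetric_criticality`), and `pohozaev` reads `N μ ∫ f(w)² = N I(w) - ‖∇w‖²`. Lower semicontinuity
gives `I(w) ≤ c < 0`, so `μ < 0`; the sign of `c` serves only for this.

Conclusion. Testing with `vₙ - w` yields `‖∇(vₙ - w)‖² - 2νₙ ∫ (φ(vₙ) - φ(w))(vₙ - w) → 0`. As `φ`
is increasing and `νₙ` is eventually negative, both terms are nonnegative and vanish in the limit.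
The second gives convergence in `L²`: `φ' ≥ 1/9` on `[-1, 1]`, and the remaining values are handled
by the `L^(2+4/N)` convergence (`tendsto_fnL_of_dualMass`). -/

namespace QuasilinearDual

set_option linter.unusedSectionVars false

/-! ### Elementary properties of the change of variable -/

theorem dualChange_zero : dualChange 0 = 0 := isDualChange_dualChange.map_zero

theorem dualChange_neg (t : ℝ) : dualChange (-t) = -dualChange t := isDualChange_dualChange.1 t

theorem hasDerivAt_dualChange (t : ℝ) :
    HasDerivAt dualChange (1 / √(1 + 2 * dualChange t ^ 2)) t :=
  isDualChange_dualChange.hasDerivAt t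

theorem continuous_dualChange : Continuous dualChange :=
  continuous_iff_continuousAt.2 fun t => (hasDerivAt_dualChange t).continuousAt

theorem dualChangeInv_dualChange (t : ℝ) : dualChangeInv (dualChange t) = t :=
  isDualChange_dualChange.leftInverse t

theorem dualChange_strictMono : StrictMono dualChange := by
  apply strictMono_of_deriv_pos
  intro t
  rw [(hasDerivAt_dualChange t).deriv]
  exact one_div_pos.2 (sqrt_pos_aux _)

theorem dualChange_nonneg {t : ℝ} (ht : 0 ≤ t) : 0 ≤ dualChange t := by
  rw [← dualChange_zero]
  exact dualChange_strictMono.monotone ht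

theorem abs_dualChange (t : ℝ) : |dualChange t| = dualChange |t| := by
  rcases le_total 0 t with ht | ht
  · rw [abs_of_nonneg ht, abs_of_nonneg (dualChange_nonneg ht)]
  · have h := dualChange_nonneg (neg_nonneg.2 ht)
    rw [abs_of_nonpos ht, dualChange_neg, abs_of_nonpos]
    rw [dualChange_neg] at h
    linarith

theorem abs_dualChange_le (t : ℝ) : |dualChange t| ≤ |t| := by
  rw [abs_dualChange]
  have h := le_dualChangeInv (dualChange_nonneg (abs_nonneg t))
  rwa [dualChangeInv_dualChange] at h

theorem dualChangeInv_le {s : ℝ} (hs : 0 ≤ s) : dualChangeInv s ≤ s * √(1 + 2 * s ^ 2) := by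
  have hc : Continuous fun t : ℝ => √(1 + 2 * t ^ 2) := by fun_prop
  have h := intervalIntegral.integral_mono_on (μ := volume) hs (hc.intervalIntegrable 0 s)
    (continuous_const (y := √(1 + 2 * s ^ 2)).intervalIntegrable 0 s)
    (fun t ht => Real.sqrt_le_sqrt (by nlinarith [ht.1, ht.2]))
  simpa [dualChangeInv] using h

theorem hasDerivAt_sqrt_aux (s : ℝ) :
    HasDerivAt (fun s : ℝ => √(1 + 2 * s ^ 2)) (2 * s / √(1 + 2 * s ^ 2)) s := by
  have h : HasDerivAt (fun s : ℝ => 1 + 2 * s ^ 2) (4 * s) s := by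
    have := ((hasDerivAt_pow 2 s).const_mul 2).const_add 1
    refine this.congr_deriv ?_
    push_cast
    ring
  have h2 := h.sqrt (by positivity)
  refine h2.congr_deriv ?_
  have := sqrt_pos_aux s
  field_simp
  ring

/-- The difference of the two sides vanishes at zero and has derivative `1 / √(1 + 2 s²) > 0`. In
terms of `f` this says `f(t) ≤ 2 t f'(t)` for `t ≥ 0`. -/
theorem le_two_mul_dualChangeInv {s : ℝ} (hs : 0 ≤ s) :
    s * √(1 + 2 * s ^ 2) ≤ 2 * dualChangeInv s := by
  have hd : ∀ s, HasDerivAt (fun s => 2 * dualChangeInv s - s * √(1 + 2 * s ^ 2))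
      (1 / √(1 + 2 * s ^ 2)) s := by
    intro s
    have h := ((hasDerivAt_dualChangeInv s).const_mul 2).sub
      ((hasDerivAt_id s).mul (hasDerivAt_sqrt_aux s))
    refine h.congr_deriv ?_
    have h1 := sqrt_pos_aux s
    have h2 : √(1 + 2 * s ^ 2) ^ 2 = 1 + 2 * s ^ 2 := Real.sq_sqrt (by positivity)
    simp only [id]
    field_simp
    linarith
  have hm : Monotone fun s => 2 * dualChangeInv s - s * √(1 + 2 * s ^ 2) := by
    apply monotone_of_deriv_nonneg fun s => (hd s).differentiableAt
    intro s
    rw [(hd s).deriv]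
    positivity
  have h := hm hs
  have h0 : dualChangeInv 0 = 0 := by simp [dualChangeInv]
  simp only [h0] at h
  linarith

theorem dualChange_mul_sqrt_le {t : ℝ} (ht : 0 ≤ t) :
    dualChange t * √(1 + 2 * dualChange t ^ 2) ≤ 2 * t := by
  have h := le_two_mul_dualChangeInv (dualChange_nonneg ht)
  rwa [dualChangeInv_dualChange] at h

theorem le_dualChange_mul_sqrt {t : ℝ} (ht : 0 ≤ t) :
    t ≤ dualChange t * √(1 + 2 * dualChange t ^ 2) := by
  have h := dualChangeInv_le (dualChange_nonneg ht)
  rwa [dualChangeInv_dualChange] at h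

theorem sq_dualChange_abs (t : ℝ) : dualChange |t| ^ 2 = dualChange t ^ 2 := by
  rw [← abs_dualChange, sq_abs]

/-- Recovers the `L²` norm of `v` from integrals of powers of `f(v)`, the only quantities that the
constraint controls. -/
theorem sq_le_dualChange (t : ℝ) : t ^ 2 ≤ dualChange t ^ 2 + 2 * dualChange t ^ 4 := by
  have h := le_dualChange_mul_sqrt (abs_nonneg t)
  have h1 : √(1 + 2 * dualChange |t| ^ 2) ^ 2 = 1 + 2 * dualChange |t| ^ 2 :=
    Real.sq_sqrt (by positivity)
  have h2 := pow_le_pow_left₀ (abs_nonneg t) h 2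
  rw [mul_pow, h1, sq_abs, sq_dualChange_abs] at h2
  linarith

/-- Squaring `f √(1 + 2f²) ≤ 2t` gives `f² + 2f⁴ ≤ 4t²`. This square root growth is what doubles the
admissible exponents. -/
theorem dualChange_pow_four_le (t : ℝ) : dualChange t ^ 4 ≤ 2 * t ^ 2 := by
  have h := dualChange_mul_sqrt_le (abs_nonneg t)
  have h1 : √(1 + 2 * dualChange |t| ^ 2) ^ 2 = 1 + 2 * dualChange |t| ^ 2 :=
    Real.sq_sqrt (by positivity)
  have h0 := dualChange_nonneg (abs_nonneg t)
  have h2 := pow_le_pow_left₀ (by positivity) h 2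
  rw [mul_pow, h1, mul_pow, sq_abs, sq_dualChange_abs] at h2
  nlinarith [sq_nonneg (dualChange t)]

theorem sq_dualChange_le (t : ℝ) : dualChange t ^ 2 ≤ t ^ 2 :=
  sq_le_sq.2 (abs_dualChange_le t)

/-! ### The functions `f f'` and `|f|^(p-2) f f'` -/

/-- `f f'`, half of the derivative of `f²`. -/
noncomputable def dualMass (t : ℝ) : ℝ := dualChange t * (1 / √(1 + 2 * dualChange t ^ 2))

/-- `|f|^(p-2) f f'`, the derivative of `|f|^p / p`. -/
noncomputable def dualPower (p t : ℝ) : ℝ := |dualChange t| ^ (p - 2) * dualMass t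

theorem hasDerivAt_sq_dualChange (t : ℝ) :
    HasDerivAt (fun t => dualChange t ^ 2) (2 * dualMass t) t := by
  have h := (hasDerivAt_dualChange t).pow 2
  refine h.congr_deriv ?_
  unfold dualMass
  push_cast
  ring

theorem hasDerivAt_abs_dualChange_rpow {p : ℝ} (hp : 2 < p) (t : ℝ) :
    HasDerivAt (fun t => 1 / p * |dualChange t| ^ p) (dualPower p t) t := by
  have h := ((hasDerivAt_abs_rpow (dualChange t) (p := p) (by linarith)).comp t
    (hasDerivAt_dualChange t)).const_mul (1 / p)
  refine h.congr_deriv ?_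
  unfold dualPower dualMass
  have : p ≠ 0 := by linarith
  field_simp

/-- The derivative lies in `(0, 1]`, so `dualMass` is strictly increasing and 1-Lipschitz; it decays
at infinity, so lower bounds on it are only local. -/
theorem hasDerivAt_dualMass (t : ℝ) :
    HasDerivAt dualMass (1 / (1 + 2 * dualChange t ^ 2) ^ 2) t := by
  have h := (hasDerivAt_dualChange t).mul
    (((hasDerivAt_sqrt_aux (dualChange t)).comp t (hasDerivAt_dualChange t)).inv
      (sqrt_pos_aux _).ne')
  have e : dualMass = dualChange * ((fun s : ℝ => √(1 + 2 * s ^ 2)) ∘ dualChange)⁻¹ := by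
    funext t
    simp [dualMass]
  rw [e]
  refine h.congr_deriv ?_
  simp only [Function.comp, Pi.inv_apply]
  set s := √(1 + 2 * dualChange t ^ 2) with hs
  have h1 : 0 < s := sqrt_pos_aux _
  have h2 : 1 + 2 * dualChange t ^ 2 = s ^ 2 := (Real.sq_sqrt (by positivity)).symm
  rw [h2]
  field_simp
  linarith

theorem continuous_dualMass : Continuous dualMass :=
  continuous_iff_continuousAt.2 fun t => (hasDerivAt_dualMass t).continuousAt

theorem dualMass_zero : dualMass 0 = 0 := by simp [dualMass, dualChange_zero]

theorem dualMass_neg (t : ℝ) : dualMass (-t) = -dualMass t := by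
  simp [dualMass, dualChange_neg]

theorem dualMass_strictMono : StrictMono dualMass := by
  apply strictMono_of_deriv_pos
  intro t
  rw [(hasDerivAt_dualMass t).deriv]
  positivity

theorem abs_dualMass_sub_le (a b : ℝ) : |dualMass a - dualMass b| ≤ |a - b| := by
  have h := convex_univ.norm_image_sub_le_of_norm_hasDerivWithin_le (C := 1) (f := dualMass)
    (fun t _ => (hasDerivAt_dualMass t).hasDerivWithinAt) (fun t _ => ?_) (mem_univ b) (mem_univ a)
  · simpa using h
  · rw [Real.norm_of_nonneg (by positivity), div_le_one (by positivity)]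
    nlinarith [sq_nonneg (dualChange t), sq_nonneg (dualChange t ^ 2)]

theorem dualMass_mono_mul_nonneg (a b : ℝ) : 0 ≤ (dualMass a - dualMass b) * (a - b) := by
  rcases le_total a b with h | h
  · have := dualMass_strictMono.monotone h
    nlinarith
  · have := dualMass_strictMono.monotone h
    nlinarith

/-- On `[-1, 1]` one has `f² ≤ 1`, hence `φ' ≥ 1 / (1 + 2)² = 1/9`. -/
theorem sq_sub_le_dualMass {a b : ℝ} (ha : |a| ≤ 1) (hb : |b| ≤ 1) :
    (a - b) ^ 2 ≤ 9 * ((dualMass a - dualMass b) * (a - b)) := by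
  have key : ∀ a b : ℝ, |a| ≤ 1 → |b| ≤ 1 → a ≤ b → (b - a) ≤ 9 * (dualMass b - dualMass a) := by
    intro a b ha hb hab
    have := (convex_Icc (-1 : ℝ) 1).mul_sub_le_image_sub_of_le_deriv
      continuous_dualMass.continuousOn
      (fun x _ => (hasDerivAt_dualMass x).differentiableAt.differentiableWithinAt)
      (C := 1 / 9) (fun x hx => ?_) a (abs_le.1 ha) b (abs_le.1 hb) hab
    · linarith
    · rw [interior_Icc] at hx
      rw [(hasDerivAt_dualMass x).deriv]
      apply one_div_le_one_div_of_le (by positivity)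
      have h1 : dualChange x ^ 2 ≤ 1 :=
        (sq_dualChange_le x).trans ((sq_le_one_iff_abs_le_one x).2 (abs_lt.2 hx).le)
      nlinarith [sq_nonneg (dualChange x)]
  rcases le_total a b with h | h
  · nlinarith [key a b ha hb h]
  · nlinarith [key b a hb ha h]

/-- The integrated form of this inequality, `massFunctional_le_fderiv`, is what makes the constraint
regular. -/
theorem half_sq_dualChange_le (t : ℝ) : dualChange t ^ 2 ≤ 2 * (dualMass t * t) := by
  have key : ∀ t : ℝ, 0 ≤ t → dualChange t ^ 2 ≤ 2 * (dualMass t * t) := by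
    intro t ht
    have h := dualChange_mul_sqrt_le ht
    have h0 := dualChange_nonneg ht
    have h1 := sqrt_pos_aux (dualChange t)
    unfold dualMass
    rw [show 2 * (dualChange t * (1 / √(1 + 2 * dualChange t ^ 2)) * t)
      = dualChange t * (2 * t) / √(1 + 2 * dualChange t ^ 2) by ring, le_div_iff₀ h1]
    nlinarith
  rcases le_total 0 t with ht | ht
  · exact key t ht
  · have := key (-t) (by linarith)
    rw [dualChange_neg, dualMass_neg] at this
    linarith

theorem sq_dualMass_le (t : ℝ) : dualMass t ^ 2 ≤ dualChange t ^ 2 := by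
  unfold dualMass
  rw [mul_pow, div_pow, one_pow, Real.sq_sqrt (by positivity)]
  apply mul_le_of_le_one_right (sq_nonneg _)
  rw [div_le_one (by positivity)]
  nlinarith [sq_nonneg (dualChange t)]

theorem hasDerivAt_abs_rpow_mul {r : ℝ} (hr : 0 < r) (x : ℝ) :
    HasDerivAt (fun x : ℝ => |x| ^ r * x) ((r + 1) * |x| ^ r) x := by
  have hne : ∀ y : ℝ, y ≠ 0 → HasDerivAt (fun x : ℝ => |x| ^ r * x) ((r + 1) * |y| ^ r) y := by
    intro y hy
    have h := (((hasDerivAt_abs hy).rpow_const (p := r) (Or.inl (abs_ne_zero.2 hy))).mul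
      (hasDerivAt_id y))
    refine h.congr_deriv ?_
    have h1 : |y| ^ (r - 1) * |y| = |y| ^ r := by
      rw [Real.rpow_sub_one (abs_ne_zero.2 hy), div_mul_cancel₀ _ (abs_ne_zero.2 hy)]
    have h2 : (SignType.sign y : ℝ) * y = |y| := by
      rcases lt_or_gt_of_ne hy with h | h
      · simp [h, abs_of_neg]
      · simp [h, abs_of_pos]
    simp only [id]
    linear_combination r * h1 + r * |y| ^ (r - 1) * h2
  have hc : Continuous fun x : ℝ => |x| ^ r :=
    continuous_abs.rpow_const fun _ => Or.inr hr.le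
  by_cases hx : x = 0
  · subst hx
    -- At the origin the derivative is the continuous extension of the derivative found elsewhere.
    exact hasDerivAt_of_hasDerivAt_of_ne (g := fun x : ℝ => (r + 1) * |x| ^ r)
      (fun y hy => hne y hy) (hc.mul continuous_id).continuousAt
      (continuous_const.mul hc).continuousAt
  · exact hne x hx

theorem hasDerivAt_dualPower {p : ℝ} (hp : 2 < p) (t : ℝ) :
    HasDerivAt (dualPower p) ((p - 2) * |dualChange t| ^ (p - 2) * (1 / (1 + 2 * dualChange t ^ 2))
      + |dualChange t| ^ (p - 2) * (1 / (1 + 2 * dualChange t ^ 2) ^ 2)) t := by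
  have h1 := ((hasDerivAt_abs_rpow_mul (r := p - 2) (by linarith) (dualChange t)).comp t
    (hasDerivAt_dualChange t)).mul
    (((hasDerivAt_sqrt_aux (dualChange t)).comp t (hasDerivAt_dualChange t)).inv
      (sqrt_pos_aux _).ne')
  have e : dualPower p = ((fun x : ℝ => |x| ^ (p - 2) * x) ∘ dualChange) *
      ((fun s : ℝ => √(1 + 2 * s ^ 2)) ∘ dualChange)⁻¹ := by
    funext t
    simp [dualMass, dualPower, mul_assoc]
  rw [e]
  refine h1.congr_deriv ?_
  simp only [Function.comp, Pi.inv_apply]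
  set s := √(1 + 2 * dualChange t ^ 2) with hs
  have h1 : 0 < s := sqrt_pos_aux _
  have h2 : 1 + 2 * dualChange t ^ 2 = s ^ 2 := (Real.sq_sqrt (by positivity)).symm
  rw [h2]
  field_simp
  linear_combination (-|dualChange t| ^ (p - 2)) * h2

theorem continuous_dualPower {p : ℝ} (hp : 2 < p) : Continuous (dualPower p) :=
  continuous_iff_continuousAt.2 fun t => (hasDerivAt_dualPower hp t).continuousAt

theorem dualPower_zero (p : ℝ) : dualPower p 0 = 0 := by simp [dualPower, dualMass_zero]

theorem dualPower_neg (p t : ℝ) : dualPower p (-t) = -dualPower p t := by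
  simp [dualPower, dualMass_neg, dualChange_neg]

/-- With `y = |f(t)|` the derivative is at most `p y^(p-2) / (1 + 2y²)`. It is bounded for `y ≤ 1`
and of order `y^(p-4)` beyond, which `y² ≤ 2|t|` turns into `|t|ʳ`. -/
theorem abs_deriv_dualPower_le {p r : ℝ} (hp : 2 < p) (hr : 0 ≤ r) (hpr : p ≤ 4 + 2 * r) (t : ℝ) :
    |(p - 2) * |dualChange t| ^ (p - 2) * (1 / (1 + 2 * dualChange t ^ 2))
      + |dualChange t| ^ (p - 2) * (1 / (1 + 2 * dualChange t ^ 2) ^ 2)|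
      ≤ (p * 2 ^ r) * (1 + |t| ^ r) := by
  set y := |dualChange t| with hy
  have hy0 : 0 ≤ y := abs_nonneg _
  have hsq : dualChange t ^ 2 = y ^ 2 := (sq_abs _).symm
  rw [hsq]
  have hD : 0 < 1 + 2 * y ^ 2 := by positivity
  have hY : 0 ≤ y ^ (p - 2) := Real.rpow_nonneg hy0 _
  have hp2 : 0 < p - 2 := by linarith
  rw [abs_of_nonneg (by positivity)]
  have h1 : (1 / (1 + 2 * y ^ 2) ^ 2) ≤ 1 / (1 + 2 * y ^ 2) :=
    one_div_le_one_div_of_le hD (by nlinarith [sq_nonneg y])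
  have h2 : (p - 2) * y ^ (p - 2) * (1 / (1 + 2 * y ^ 2)) + y ^ (p - 2) * (1 / (1 + 2 * y ^ 2) ^ 2)
      ≤ p * (y ^ (p - 2) * (1 / (1 + 2 * y ^ 2))) := by
    have := mul_le_mul_of_nonneg_left h1 hY
    have h3 : 0 ≤ y ^ (p - 2) * (1 / (1 + 2 * y ^ 2)) := by positivity
    nlinarith
  refine h2.trans ?_
  rw [mul_assoc]
  apply mul_le_mul_of_nonneg_left _ (by linarith)
  have h2r : (1 : ℝ) ≤ 2 ^ r := Real.one_le_rpow (by norm_num) hr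
  have htr : 0 ≤ |t| ^ r := Real.rpow_nonneg (abs_nonneg t) _
  rcases le_total y 1 with hy1 | hy1
  · have ha : y ^ (p - 2) ≤ 1 := Real.rpow_le_one hy0 hy1 hp2.le
    have hb : 1 / (1 + 2 * y ^ 2) ≤ 1 := by
      rw [div_le_one hD]
      nlinarith [sq_nonneg y]
    have hb0 : 0 ≤ 1 / (1 + 2 * y ^ 2) := by positivity
    nlinarith [mul_le_mul ha hb hb0 zero_le_one]
  -- Here `p - 2 ≤ 2 + 2r`: two powers of `y` are absorbed by the denominator, the other `2r` become
  -- `|t|ʳ`.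
  · have hy2 : y ^ (p - 2) ≤ y ^ (2 : ℝ) * (y ^ 2) ^ r := by
      rw [← Real.rpow_natCast y 2, ← Real.rpow_mul hy0, ← Real.rpow_add (by linarith)]
      apply Real.rpow_le_rpow_of_exponent_le hy1
      push_cast
      linarith
    have hy3 : (y ^ 2) ^ r ≤ 2 ^ r * |t| ^ r := by
      rw [← Real.mul_rpow (by norm_num) (abs_nonneg t)]
      apply Real.rpow_le_rpow (by positivity) _ hr
      apply le_of_sq_le_sq _ (by positivity)
      have := dualChange_pow_four_le t
      have h4 : (y ^ 2) ^ 2 = dualChange t ^ 4 := by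
        rw [← hsq]
        ring
      rw [h4, mul_pow, sq_abs]
      nlinarith [sq_nonneg t]
    have hyy : 0 ≤ (y ^ 2) ^ r := Real.rpow_nonneg (by positivity) _
    rw [mul_one_div, div_le_iff₀ hD]
    calc y ^ (p - 2) ≤ y ^ (2 : ℝ) * (y ^ 2) ^ r := hy2
      _ = y ^ 2 * (y ^ 2) ^ r := by norm_cast
      _ ≤ (1 + 2 * y ^ 2) * (2 ^ r * |t| ^ r) := by
          apply mul_le_mul (by nlinarith [sq_nonneg y]) hy3 hyy hD.le
      _ ≤ _ := by nlinarith

theorem abs_dualPower_sub_le {p r : ℝ} (hp : 2 < p) (hr : 0 ≤ r) (hpr : p ≤ 4 + 2 * r) (a b : ℝ) :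
    |dualPower p a - dualPower p b| ≤ (p * 2 ^ r) * (|a - b| * (1 + |a| ^ r + |b| ^ r)) := by
  have h := (convex_uIcc b a).norm_image_sub_le_of_norm_hasDerivWithin_le
    (C := (p * 2 ^ r) * (1 + |a| ^ r + |b| ^ r)) (f := dualPower p)
    (fun t _ => (hasDerivAt_dualPower hp t).hasDerivWithinAt) (fun t ht => ?_)
    left_mem_uIcc right_mem_uIcc
  · simp only [Real.norm_eq_abs] at h
    linarith
  · refine (abs_deriv_dualPower_le hp hr hpr t).trans ?_
    apply mul_le_mul_of_nonneg_left _ (by positivity)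
    have ha : 0 ≤ |a| ^ r := Real.rpow_nonneg (abs_nonneg _) _
    have hb : 0 ≤ |b| ^ r := Real.rpow_nonneg (abs_nonneg _) _
    have hmax : |t| ≤ max |b| |a| := by
      rcases mem_uIcc.1 ht with h | h
      · exact abs_le_max_abs_abs h.1 h.2
      · rw [max_comm]
        exact abs_le_max_abs_abs h.1 h.2
    rcases le_max_iff.1 hmax with h | h
    · have := Real.rpow_le_rpow (abs_nonneg t) h hr
      linarith
    · have := Real.rpow_le_rpow (abs_nonneg t) h hr
      linarith

/-! ### `L²` norms of averages -/

theorem eLpNorm_two_eq_lintegral {X G : Type*} [MeasurableSpace X] [NormedAddCommGroup G]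
    {μ : Measure X} (f : X → G) :
    eLpNorm f 2 μ = (∫⁻ x, ‖f x‖ₑ ^ (2 : ℝ) ∂μ) ^ (1 / 2 : ℝ) := by
  rw [eLpNorm_eq_lintegral_rpow_enorm_toReal (by norm_num) (by norm_num)]
  norm_num

theorem eLpNorm_two_rpow_two {X G : Type*} [MeasurableSpace X] [NormedAddCommGroup G]
    {μ : Measure X} (f : X → G) :
    eLpNorm f 2 μ ^ (2 : ℝ) = ∫⁻ x, ‖f x‖ₑ ^ (2 : ℝ) ∂μ := by
  rw [eLpNorm_two_eq_lintegral, ← ENNReal.rpow_mul]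
  norm_num

/-- Minkowski's inequality for the `L²` norm of an average. -/
theorem eLpNorm_average_le {X T G : Type*} [MeasurableSpace X] [MeasurableSpace T]
    [NormedAddCommGroup G] [NormedSpace ℝ G] {μ : Measure X} [SFinite μ] {ν : Measure T}
    [IsProbabilityMeasure ν] {F : X → T → G}
    (hF : AEStronglyMeasurable (Function.uncurry F) (μ.prod ν)) {C : ℝ≥0∞}
    (hC : ∀ᵐ t ∂ν, eLpNorm (fun x => F x t) 2 μ ≤ C) :
    eLpNorm (fun x => ∫ t, F x t ∂ν) 2 μ ≤ C := by
  -- Jensen's inequality, as the comparison of `L¹` and `L²` norms on a probability space.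
  have h1 : ∀ᵐ x ∂μ, ‖∫ t, F x t ∂ν‖ₑ ^ (2 : ℝ) ≤ ∫⁻ t, ‖F x t‖ₑ ^ (2 : ℝ) ∂ν := by
    filter_upwards [hF.prodMk_left] with x hx
    rw [← eLpNorm_two_rpow_two (fun t => F x t)]
    apply ENNReal.rpow_le_rpow _ (by norm_num)
    refine (enorm_integral_le_lintegral_enorm _).trans ?_
    rw [← eLpNorm_one_eq_lintegral_enorm]
    exact eLpNorm_le_eLpNorm_of_exponent_le (by norm_num) hx
  have h2 : eLpNorm (fun x => ∫ t, F x t ∂ν) 2 μ ^ (2 : ℝ) ≤ C ^ (2 : ℝ) := by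
    rw [eLpNorm_two_rpow_two]
    calc ∫⁻ x, ‖∫ t, F x t ∂ν‖ₑ ^ (2 : ℝ) ∂μ
        ≤ ∫⁻ x, ∫⁻ t, ‖F x t‖ₑ ^ (2 : ℝ) ∂ν ∂μ := lintegral_mono_ae h1
      _ = ∫⁻ t, ∫⁻ x, ‖F x t‖ₑ ^ (2 : ℝ) ∂μ ∂ν :=
          lintegral_lintegral_swap (hF.enorm.pow_const _)
      _ ≤ ∫⁻ _, C ^ (2 : ℝ) ∂ν := by
          apply lintegral_mono_ae
          filter_upwards [hC] with t ht
          rw [← eLpNorm_two_rpow_two (fun x => F x t)]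
          exact ENNReal.rpow_le_rpow ht (by norm_num)
      _ = C ^ (2 : ℝ) := by simp
  exact (ENNReal.rpow_le_rpow_iff (by norm_num)).1 h2

/-! ### Mollification -/

section Moll

variable {E : Type*} [NormedAddCommGroup E] [InnerProductSpace ℝ E] [FiniteDimensional ℝ E]
  [MeasurableSpace E] [BorelSpace E]
variable {G : Type*} [NormedAddCommGroup G] [NormedSpace ℝ G]

/-- The mollification of `g` by a normalised bump function. -/
noncomputable def moll (ρ : ContDiffBump (0 : E)) (g : E → G) : E → G :=
  convolution (ρ.normed volume) g (ContinuousLinearMap.lsmul ℝ ℝ) volume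

theorem moll_apply (ρ : ContDiffBump (0 : E)) (g : E → G) (x : E) :
    moll ρ g x = ∫ t, ρ.normed volume t • g (x - t) := rfl

theorem moll_apply_swap (ρ : ContDiffBump (0 : E)) (g : E → G) (x : E) :
    moll ρ g x = ∫ t, ρ.normed volume (x - t) • g t := convolution_lsmul_swap

/-- The probability measure with density a normalised bump function. -/
noncomputable def mollMeasure (ρ : ContDiffBump (0 : E)) : Measure E :=
  volume.withDensity fun t => ENNReal.ofReal (ρ.normed volume t)

theorem measurable_normed (ρ : ContDiffBump (0 : E)) :
    Measurable (ρ.normed (volume : Measure E)) := ρ.continuous_normed.measurable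

instance isProbabilityMeasure_mollMeasure (ρ : ContDiffBump (0 : E)) :
    IsProbabilityMeasure (mollMeasure ρ) := by
  constructor
  rw [mollMeasure, withDensity_apply _ MeasurableSet.univ, Measure.restrict_univ,
    ← ofReal_integral_eq_lintegral_ofReal ρ.integrable_normed
      (Eventually.of_forall fun x => ρ.nonneg_normed x), ρ.integral_normed, ENNReal.ofReal_one]

theorem mollMeasure_absolutelyContinuous (ρ : ContDiffBump (0 : E)) :
    mollMeasure ρ ≪ volume := withDensity_absolutelyContinuous _ _

theorem integral_mollMeasure (ρ : ContDiffBump (0 : E)) (h : E → G) :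
    ∫ t, h t ∂mollMeasure ρ = ∫ t, ρ.normed volume t • h t := by
  unfold mollMeasure
  rw [integral_withDensity_eq_integral_toReal_smul₀ (measurable_normed ρ).ennreal_ofReal.aemeasurable
    (Eventually.of_forall fun _ => ENNReal.ofReal_lt_top)]
  simp only [ENNReal.toReal_ofReal (ρ.nonneg_normed _)]

theorem ae_mollMeasure_norm_le (ρ : ContDiffBump (0 : E)) :
    ∀ᵐ t ∂mollMeasure ρ, ‖t‖ ≤ ρ.rOut := by
  unfold mollMeasure
  rw [ae_withDensity_iff (measurable_normed ρ).ennreal_ofReal]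
  apply Eventually.of_forall
  intro t ht
  have h : t ∈ Function.support (ρ.normed (volume : Measure E)) := by
    intro h0
    simp [h0] at ht
  rw [ρ.support_normed_eq] at h
  simpa using (Metric.mem_ball.1 h).le

theorem integrable_mollMeasure (ρ : ContDiffBump (0 : E)) {g : E → G}
    (hg : LocallyIntegrable g volume) (x : E) :
    Integrable (fun t => g (x - t)) (mollMeasure ρ) := by
  unfold mollMeasure
  rw [integrable_withDensity_iff_integrable_smul' (measurable_normed ρ).ennreal_ofReal
    (Eventually.of_forall fun _ => ENNReal.ofReal_lt_top)]
  simp only [ENNReal.toReal_ofReal (ρ.nonneg_normed _)]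
  exact (ρ.hasCompactSupport_normed.convolutionExists_left (ContinuousLinearMap.lsmul ℝ ℝ)
    ρ.continuous_normed hg x).integrable

theorem MemLp.locallyIntegrable_two {G : Type*} [NormedAddCommGroup G] {g : E → G} (hg : MemLp g 2 volume) :
    LocallyIntegrable g volume := hg.locallyIntegrable (by norm_num)

theorem continuous_moll (ρ : ContDiffBump (0 : E)) {g : E → G} (hg : LocallyIntegrable g volume) :
    Continuous (moll ρ g) :=
  ρ.hasCompactSupport_normed.continuous_convolution_left _ ρ.continuous_normed hg

theorem contDiff_moll [CompleteSpace G] (ρ : ContDiffBump (0 : E)) {g : E → G}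
    (hg : LocallyIntegrable g volume) : ContDiff ℝ ∞ (moll ρ g) :=
  ρ.hasCompactSupport_normed.contDiff_convolution_left _ ρ.contDiff_normed hg

theorem aestronglyMeasurable_sub_prod {g : E → G} (hg : AEStronglyMeasurable g volume)
    {ν : Measure E} [SFinite ν] :
    AEStronglyMeasurable (fun z : E × E => g (z.1 - z.2)) ((volume : Measure E).prod ν) := by
  exact hg.comp_quasiMeasurePreserving (quasiMeasurePreserving_sub_of_right_invariant volume ν)

theorem eLpNorm_translate {g : E → G} (hg : AEStronglyMeasurable g volume) (t : E) :
    eLpNorm (fun x => g (x - t)) 2 volume = eLpNorm g 2 volume :=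
  eLpNorm_comp_measurePreserving hg (measurePreserving_sub_right volume t)

theorem eLpNorm_moll_le (ρ : ContDiffBump (0 : E)) {g : E → G} (hg : MemLp g 2 volume) :
    eLpNorm (moll ρ g) 2 volume ≤ eLpNorm g 2 volume := by
  have h : moll ρ g = fun x => ∫ t, g (x - t) ∂mollMeasure ρ := by
    funext x
    rw [integral_mollMeasure, moll_apply]
  rw [h]
  exact eLpNorm_average_le (aestronglyMeasurable_sub_prod hg.1)
    (Eventually.of_forall fun t => (eLpNorm_translate hg.1 t).le)

theorem memLp_moll (ρ : ContDiffBump (0 : E)) {g : E → G} (hg : MemLp g 2 volume) :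
    MemLp (moll ρ g) 2 volume :=
  ⟨(continuous_moll ρ (MemLp.locallyIntegrable_two hg)).aestronglyMeasurable,
    (eLpNorm_moll_le ρ hg).trans_lt hg.2⟩

/-- The error of mollification is an average of the differences `g(· - t) - g` over `‖t‖ ≤ ρ.rOut`,
so Minkowski's inequality applies. -/
theorem eLpNorm_moll_sub_le [CompleteSpace G] (ρ : ContDiffBump (0 : E)) {g : E → G} (hg : MemLp g 2 volume)
    {C : ℝ≥0∞} (hC : ∀ t : E, ‖t‖ ≤ ρ.rOut → eLpNorm (fun x => g (x - t) - g x) 2 volume ≤ C) :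
    eLpNorm (fun x => moll ρ g x - g x) 2 volume ≤ C := by
  have h : (fun x => moll ρ g x - g x) = fun x => ∫ t, g (x - t) - g x ∂mollMeasure ρ := by
    funext x
    rw [integral_sub (integrable_mollMeasure ρ (MemLp.locallyIntegrable_two hg) x)
      (integrable_const _), integral_mollMeasure, moll_apply]
    simp
  rw [h]
  refine eLpNorm_average_le ((aestronglyMeasurable_sub_prod hg.1).sub hg.1.comp_fst) ?_
  filter_upwards [ae_mollMeasure_norm_le ρ] with t ht
  exact hC t ht


/-- Jensen's inequality for the mollifying measure, whose density is bounded and supported in a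
ball. The constant depends on `ρ` alone: local `L²` mass controls pointwise values uniformly in `x`
and `g`. -/
theorem exists_enorm_moll_le (ρ : ContDiffBump (0 : E)) : ∃ C : ℝ≥0∞, C ≠ ⊤ ∧
    ∀ g : E → G, MemLp g 2 volume → ∀ x : E, ‖moll ρ g x‖ₑ ^ (2 : ℝ) ≤
      C * ∫⁻ y in Metric.ball x ρ.rOut, ‖g y‖ₑ ^ (2 : ℝ) := by
  obtain ⟨K, hK⟩ := ρ.continuous_normed.bounded_above_of_compact_support
    (ρ.hasCompactSupport_normed (μ := (volume : Measure E)))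
  refine ⟨ENNReal.ofReal K, ENNReal.ofReal_ne_top, fun g hg x => ?_⟩
  have hm : AEStronglyMeasurable (fun t => g (x - t)) volume :=
    hg.1.comp_quasiMeasurePreserving (quasiMeasurePreserving_sub_left volume x)
  have h1 : moll ρ g x = ∫ t, g (x - t) ∂mollMeasure ρ := by
    rw [integral_mollMeasure, moll_apply]
  have h2 : ‖moll ρ g x‖ₑ ^ (2 : ℝ) ≤ ∫⁻ t, ‖g (x - t)‖ₑ ^ (2 : ℝ) ∂mollMeasure ρ := by
    rw [h1, ← eLpNorm_two_rpow_two (fun t => g (x - t))]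
    apply ENNReal.rpow_le_rpow _ (by norm_num)
    refine (enorm_integral_le_lintegral_enorm _).trans ?_
    rw [← eLpNorm_one_eq_lintegral_enorm]
    exact eLpNorm_le_eLpNorm_of_exponent_le (by norm_num)
      (hm.mono_ac (mollMeasure_absolutelyContinuous ρ))
  refine h2.trans ?_
  unfold mollMeasure
  rw [lintegral_withDensity_eq_lintegral_mul₀ (measurable_normed ρ).ennreal_ofReal.aemeasurable
    (hm.enorm.pow_const _)]
  have h3 := lintegral_sub_left_eq_self (μ := (volume : Measure E))
    (fun y => ENNReal.ofReal (ρ.normed volume (x - y)) * ‖g y‖ₑ ^ (2 : ℝ)) x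
  simp only [sub_sub_cancel] at h3
  simp only [Pi.mul_apply]
  rw [h3, ← lintegral_const_mul' _ _ ENNReal.ofReal_ne_top,
    ← lintegral_indicator Metric.isOpen_ball.measurableSet]
  apply lintegral_mono
  intro y
  by_cases hy : y ∈ Metric.ball x ρ.rOut
  · rw [indicator_of_mem hy]
    exact mul_le_mul' (ENNReal.ofReal_le_ofReal ((le_abs_self _).trans (hK _))) le_rfl
  · have h0 : ρ.normed (volume : Measure E) (x - y) = 0 := by
      by_contra hne
      have : x - y ∈ Function.support (ρ.normed (volume : Measure E)) := hne
      rw [ρ.support_normed_eq, mem_ball_zero_iff, ← dist_eq_norm, dist_comm] at this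
      exact hy this
    simp [h0]

theorem fderiv_moll_apply (ρ : ContDiffBump (0 : E)) {u : E → ℝ} (hu : LocallyIntegrable u volume)
    (x y : E) :
    fderiv ℝ (moll ρ u) x y = ∫ s, fderiv ℝ (ρ.normed volume) (x - s) y * u s := by
  have hd := ρ.hasCompactSupport_normed.hasFDerivAt_convolution_left
    (ContinuousLinearMap.lsmul ℝ ℝ) (μ := (volume : Measure E))
    (ρ.contDiff_normed (μ := (volume : Measure E)) (n := 1)) hu x
  have h1 : fderiv ℝ (moll ρ u) x = _ := hd.fderiv
  have hint : ConvolutionExistsAt (fderiv ℝ (ρ.normed (volume : Measure E))) u x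
      (ContinuousLinearMap.precompL E (ContinuousLinearMap.lsmul ℝ ℝ)) volume :=
    ((ρ.hasCompactSupport_normed (μ := (volume : Measure E))).fderiv ℝ).convolutionExists_left _
      ((ρ.contDiff_normed (μ := (volume : Measure E)) (n := 1)).continuous_fderiv (by simp)) hu x
  rw [h1, convolution_def, ContinuousLinearMap.integral_apply hint.integrable]
  have h3 := integral_sub_left_eq_self
    (fun s => fderiv ℝ (ρ.normed (volume : Measure E)) (x - s) y * u s) volume x
  simp only [sub_sub_cancel] at h3
  rw [← h3]
  rfl

theorem fderiv_comp_sub_left {φ : E → ℝ} (hφ : Differentiable ℝ φ) (x s y : E) :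
    fderiv ℝ (fun s => φ (x - s)) s y = -fderiv ℝ φ (x - s) y := by
  have h := (hφ (x - s)).hasFDerivAt.comp s ((hasFDerivAt_id s).const_sub x)
  have h2 : fderiv ℝ (fun s => φ (x - s)) s = _ := h.fderiv
  rw [h2]
  simp

theorem hasCompactSupport_comp_sub_left {φ : E → ℝ} (hφ : HasCompactSupport φ) (x : E) :
    HasCompactSupport fun s => φ (x - s) :=
  hφ.comp_homeomorph (Homeomorph.subLeft x)

/-- The weak gradient is tested with the reflected kernel `s ↦ ρ(x - s)`. -/
theorem fderiv_moll_of_isWeakGradient (ρ : ContDiffBump (0 : E)) {u : E → ℝ} {g : E → E}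
    (hu : MemLp u 2 volume) (hg : MemLp g 2 volume) (h : IsWeakGradient u g) (x y : E) :
    fderiv ℝ (moll ρ u) x y = inner ℝ (moll ρ g x) y := by
  have hρ : ContDiff ℝ ∞ (ρ.normed (volume : Measure E)) := ρ.contDiff_normed
  rw [fderiv_moll_apply ρ (MemLp.locallyIntegrable_two hu)]
  have h1 := h (fun s => ρ.normed volume (x - s)) (hρ.comp (contDiff_const.sub contDiff_id))
    (hasCompactSupport_comp_sub_left ρ.hasCompactSupport_normed x) y
  simp only [fderiv_comp_sub_left (hρ.differentiable (by simp))] at h1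
  have h2 : ∫ s, u s * -fderiv ℝ (ρ.normed volume) (x - s) y
      = -∫ s, fderiv ℝ (ρ.normed volume) (x - s) y * u s := by
    rw [← integral_neg]
    congr 1
    funext s
    ring
  rw [h2, neg_inj] at h1
  rw [h1, moll_apply_swap, real_inner_comm, ← integral_inner]
  · congr 1
    funext s
    rw [inner_smul_right, real_inner_comm]
    ring
  · have := (((ρ.hasCompactSupport_normed (μ := (volume : Measure E))).convolutionExists_left (ContinuousLinearMap.lsmul ℝ ℝ)
      ρ.continuous_normed (MemLp.locallyIntegrable_two hg) x).integrable_swap)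
    exact this

/-! ### Translations -/

/-- Translations form a continuous family of measure preserving maps, and composition with such a
family is continuous in `L²`. -/
theorem tendsto_eLpNorm_translate_sub {g : E → G} (hg : MemLp g 2 volume) :
    Tendsto (fun t : E => eLpNorm (fun x => g (x - t) - g x) 2 volume) (𝓝 0) (𝓝 0) := by
  let c : E → C(E, E) := fun t => ⟨fun x => x - t, by fun_prop⟩
  have hc : Continuous c :=
    (ContinuousMap.mk (fun a : E × E => a.2 - a.1) (by fun_prop)).curry.continuous
  have hmp : ∀ t, MeasurePreserving (c t) volume volume := fun t =>
    measurePreserving_sub_right volume t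
  have h := (continuous_const (y := hg.toLp g)).compMeasurePreservingLp hc hmp (by norm_num)
  have h0 : Lp.compMeasurePreserving (c 0) (hmp 0) (hg.toLp g) = hg.toLp g := by
    rw [Lp.toLp_compMeasurePreserving]
    congr 1
    funext x
    simp [c]
  have h1 := (h.tendsto 0).edist (tendsto_const_nhds (x := hg.toLp g))
  rw [h0, edist_self] at h1
  refine h1.congr fun t => ?_
  rw [Lp.toLp_compMeasurePreserving, Lp.edist_toLp_toLp]
  rfl

/-- A sequence of bump functions concentrating at the origin. -/
noncomputable def bumpSeq (E : Type*) [NormedAddCommGroup E] (n : ℕ) : ContDiffBump (0 : E) where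
  rIn := 1 / (2 * ((n : ℝ) + 1))
  rOut := 1 / ((n : ℝ) + 1)
  rIn_pos := by positivity
  rIn_lt_rOut := by
    apply one_div_lt_one_div_of_lt (by positivity)
    linarith [(Nat.cast_nonneg n : (0 : ℝ) ≤ n)]

theorem bumpSeq_rOut (n : ℕ) : (bumpSeq E n).rOut = 1 / ((n : ℝ) + 1) := rfl

theorem tendsto_eLpNorm_moll_sub [CompleteSpace G] {g : E → G} (hg : MemLp g 2 volume) :
    Tendsto (fun n => eLpNorm (fun x => moll (bumpSeq E n) g x - g x) 2 volume) atTop (𝓝 0) := by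
  rw [ENNReal.tendsto_nhds_zero]
  intro ε hε
  obtain ⟨δ, hδ, hball⟩ := Metric.eventually_nhds_iff.1
    (ENNReal.tendsto_nhds_zero.1 (tendsto_eLpNorm_translate_sub hg) ε hε)
  have h := (tendsto_one_div_add_atTop_nhds_zero_nat (𝕜 := ℝ)).eventually (gt_mem_nhds hδ)
  filter_upwards [h] with n hn
  apply eLpNorm_moll_sub_le _ hg
  intro t ht
  apply hball
  rw [dist_zero_right]
  exact ht.trans_lt (by rwa [bumpSeq_rOut])

/-- The fundamental theorem of calculus along the segment from `x` to `x - t` writes the difference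
as an average over `[0, 1]`; Minkowski's inequality does the rest. -/
theorem eLpNorm_translate_sub_le_of_contDiff {u : E → ℝ} {g : E → E} (hu : ContDiff ℝ 1 u)
    (hg : Continuous g) (h : ∀ x y, fderiv ℝ u x y = inner ℝ (g x) y) (t : E) :
    eLpNorm (fun x => u (x - t) - u x) 2 volume ≤ ‖t‖ₑ * eLpNorm g 2 volume := by
  have : IsProbabilityMeasure (volume.restrict (Ioc (0 : ℝ) 1)) := ⟨by simp⟩
  have h1 : (fun x => u (x - t) - u x)
      = fun x => ∫ s in Ioc (0 : ℝ) 1, inner ℝ (g (x - s • t)) (-t) := by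
    funext x
    rw [← intervalIntegral.integral_of_le zero_le_one]
    have hd : ∀ s ∈ uIcc (0 : ℝ) 1,
        HasDerivAt (fun s : ℝ => u (x - s • t)) (inner ℝ (g (x - s • t)) (-t)) s := by
      intro s _
      have h2 : HasDerivAt (fun s : ℝ => x - s • t) (-t) s := by
        have := ((hasDerivAt_id s).smul_const t).const_sub x
        rwa [one_smul] at this
      have h3 := ((hu.differentiable (by simp)) (x - s • t)).hasFDerivAt.comp_hasDerivAt s h2
      rw [h] at h3
      exact h3
    rw [intervalIntegral.integral_eq_sub_of_hasDerivAt hd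
      (Continuous.intervalIntegrable (by fun_prop) _ _)]
    simp
  rw [h1]
  apply eLpNorm_average_le
  · exact (Continuous.aestronglyMeasurable (by fun_prop))
  · apply Eventually.of_forall
    intro s
    calc eLpNorm (fun x => inner ℝ (g (x - s • t)) (-t)) 2 volume
        ≤ ‖t‖₊ • eLpNorm (fun x => g (x - s • t)) 2 volume := by
          apply eLpNorm_le_nnreal_smul_eLpNorm_of_ae_le_mul
          apply Eventually.of_forall
          intro x
          rw [mul_comm, ← NNReal.coe_le_coe]
          simpa using norm_inner_le_norm (𝕜 := ℝ) (g (x - s • t)) (-t)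
      _ = ‖t‖ₑ * eLpNorm g 2 volume := by
          rw [eLpNorm_translate hg.aestronglyMeasurable]
          rfl

theorem eLpNorm_translate_sub_le {u : E → ℝ} {g : E → E} (hu : MemLp u 2 volume)
    (hg : MemLp g 2 volume) (h : IsWeakGradient u g) (t : E) :
    eLpNorm (fun x => u (x - t) - u x) 2 volume ≤ ‖t‖ₑ * eLpNorm g 2 volume := by
  have hmu : ∀ n, MemLp (moll (bumpSeq E n) u) 2 volume := fun n => memLp_moll _ hu
  have key : ∀ n, eLpNorm (fun x => u (x - t) - u x) 2 volume ≤
      ‖t‖ₑ * eLpNorm g 2 volume + 2 * eLpNorm (fun x => moll (bumpSeq E n) u x - u x) 2 volume := by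
    intro n
    set m := moll (bumpSeq E n) u
    have hd : AEStronglyMeasurable (fun x => m x - u x) volume := (hmu n).1.sub hu.1
    have hqm : Measure.QuasiMeasurePreserving (fun x : E => x - t) volume volume :=
      (measurePreserving_sub_right volume t).quasiMeasurePreserving
    have hdt : AEStronglyMeasurable (fun x => m (x - t) - u (x - t)) volume :=
      hd.comp_quasiMeasurePreserving hqm
    have hm : AEStronglyMeasurable (fun x => m (x - t) - m x) volume :=
      ((hmu n).1.comp_quasiMeasurePreserving hqm).sub (hmu n).1
    -- Replacing `u` by its mollification costs the same `L²` error at `x` and at `x - t`, hence the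
    -- factor 2 in `key`.
    have e : (fun x => u (x - t) - u x) = (fun x => (m (x - t) - m x) + (m x - u x))
        - fun x => m (x - t) - u (x - t) := by
      funext x
      simp only [Pi.sub_apply]
      ring
    have h1 : eLpNorm (fun x => m (x - t) - m x) 2 volume ≤ ‖t‖ₑ * eLpNorm g 2 volume :=
      (eLpNorm_translate_sub_le_of_contDiff
        ((contDiff_moll _ (MemLp.locallyIntegrable_two hu)).of_le (by exact_mod_cast le_top))
        (continuous_moll _ (MemLp.locallyIntegrable_two hg))
        (fderiv_moll_of_isWeakGradient _ hu hg h) t).trans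
        (by gcongr; exact eLpNorm_moll_le _ hg)
    rw [e]
    calc _ ≤ eLpNorm (fun x => (m (x - t) - m x) + (m x - u x)) 2 volume
          + eLpNorm (fun x => m (x - t) - u (x - t)) 2 volume :=
          eLpNorm_sub_le (hm.add hd) hdt (by norm_num)
      _ ≤ (eLpNorm (fun x => m (x - t) - m x) 2 volume + eLpNorm (fun x => m x - u x) 2 volume)
          + eLpNorm (fun x => m x - u x) 2 volume := by
          gcongr
          · exact eLpNorm_add_le hm hd (by norm_num)
          · exact (eLpNorm_translate hd t).le
      _ ≤ _ := by
          rw [two_mul, ← add_assoc]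
          gcongr
  have hlim := (ENNReal.Tendsto.const_mul (a := 2) (tendsto_eLpNorm_moll_sub hu)
    (Or.inr (by norm_num))).const_add (‖t‖ₑ * eLpNorm g 2 volume)
  rw [mul_zero, add_zero] at hlim
  exact ge_of_tendsto' hlim key

/-- Unlike the bare `L²` convergence of mollifications, this rate is uniform on bounded subsets of
`H¹`; the compactness argument depends on it. -/
theorem eLpNorm_moll_sub_le_of_isWeakGradient (ρ : ContDiffBump (0 : E)) {u : E → ℝ} {g : E → E}
    (hu : MemLp u 2 volume) (hg : MemLp g 2 volume) (h : IsWeakGradient u g) :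
    eLpNorm (fun x => moll ρ u x - u x) 2 volume ≤ ENNReal.ofReal ρ.rOut * eLpNorm g 2 volume := by
  apply eLpNorm_moll_sub_le _ hu
  intro t ht
  refine (eLpNorm_translate_sub_le hu hg h t).trans ?_
  gcongr
  rw [← ofReal_norm]
  exact ENNReal.ofReal_le_ofReal ht

end Moll

section SobolevBasics

variable {E : Type*} [NormedAddCommGroup E] [InnerProductSpace ℝ E] [FiniteDimensional ℝ E]
  [MeasurableSpace E] [BorelSpace E]

/-! ### Basic structure of `H¹` -/

theorem IsWeakGradient.congr_ae {u u' : E → ℝ} {g g' : E → E} (h : IsWeakGradient u g)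
    (hu : u =ᵐ[volume] u') (hg : g =ᵐ[volume] g') : IsWeakGradient u' g' := by
  intro φ hφ hc y
  have h1 : ∫ x, u' x * fderiv ℝ φ x y = ∫ x, u x * fderiv ℝ φ x y := by
    apply integral_congr_ae
    filter_upwards [hu] with x hx
    rw [hx]
  have h2 : ∫ x, inner ℝ (g' x) y * φ x = ∫ x, inner ℝ (g x) y * φ x := by
    apply integral_congr_ae
    filter_upwards [hg] with x hx
    rw [hx]
  rw [h1, h2, h φ hφ hc y]

/-- The function part of an element of `H¹`, as an element of `L²`. -/
noncomputable def fnL : H1 E →L[ℝ] Lp ℝ 2 (volume : Measure E) :=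
  (WithLp.fstL 2 ℝ _ _).comp (H1 E).subtypeL

/-- The gradient part of an element of `H¹`, as an element of `L²`. -/
noncomputable def gradL : H1 E →L[ℝ] Lp E 2 (volume : Measure E) :=
  (WithLp.sndL 2 ℝ _ _).comp (H1 E).subtypeL

theorem coe_fnL (v : H1 E) : (fnL v : E → ℝ) = fn v := rfl

theorem coe_gradL (v : H1 E) : (gradL v : E → E) = grad v := rfl

theorem memLp_fn (v : H1 E) : MemLp (fn v) 2 volume := Lp.memLp (fnL v)

theorem memLp_grad (v : H1 E) : MemLp (grad v) 2 volume := Lp.memLp (gradL v)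

theorem isWeakGradient_fn_grad (v : H1 E) : IsWeakGradient (fn v) (grad v) := v.2

theorem inner_H1 (v w : H1 E) :
    inner ℝ v w = inner ℝ (fnL v) (fnL w) + inner ℝ (gradL v) (gradL w) :=
  WithLp.prod_inner_apply _ _

theorem norm_sq_H1 (v : H1 E) : ‖v‖ ^ 2 = ‖fnL v‖ ^ 2 + ‖gradL v‖ ^ 2 :=
  WithLp.prod_norm_sq_eq_of_L2 _

theorem norm_fnL_le (v : H1 E) : ‖fnL v‖ ≤ ‖v‖ :=
  abs_le_of_sq_le_sq' (by rw [norm_sq_H1]; nlinarith [sq_nonneg ‖gradL v‖]) (norm_nonneg _) |>.2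

theorem norm_gradL_le (v : H1 E) : ‖gradL v‖ ≤ ‖v‖ :=
  abs_le_of_sq_le_sq' (by rw [norm_sq_H1]; nlinarith [sq_nonneg ‖fnL v‖]) (norm_nonneg _) |>.2

theorem norm_H1_le (v : H1 E) : ‖v‖ ≤ ‖fnL v‖ + ‖gradL v‖ := by
  refine abs_le_of_sq_le_sq' ?_ (by positivity) |>.2
  rw [norm_sq_H1]
  nlinarith [norm_nonneg (fnL v), norm_nonneg (gradL v)]

theorem fn_add (v w : H1 E) : fn (v + w) =ᵐ[volume] fun x => fn v x + fn w x := by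
  have h := Lp.coeFn_add (fnL v) (fnL w)
  rwa [← map_add] at h

theorem fn_sub (v w : H1 E) : fn (v - w) =ᵐ[volume] fun x => fn v x - fn w x := by
  have h := Lp.coeFn_sub (fnL v) (fnL w)
  rwa [← map_sub] at h

theorem fn_smul (c : ℝ) (v : H1 E) : fn (c • v) =ᵐ[volume] fun x => c * fn v x := by
  have h := Lp.coeFn_smul c (fnL v)
  rwa [← map_smul] at h

theorem grad_sub (v w : H1 E) : grad (v - w) =ᵐ[volume] fun x => grad v x - grad w x := by
  have h := Lp.coeFn_sub (gradL v) (gradL w)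
  rwa [← map_sub] at h

theorem norm_sq_Lp_two {G : Type*} [NormedAddCommGroup G] [InnerProductSpace ℝ G]
    (u : Lp G 2 (volume : Measure E)) : ‖u‖ ^ 2 = ∫ x, ‖u x‖ ^ 2 := by
  rw [← real_inner_self_eq_norm_sq, L2.inner_def]
  simp

theorem norm_sq_fnL (v : H1 E) : ‖fnL v‖ ^ 2 = ∫ x, fn v x ^ 2 := by
  rw [norm_sq_Lp_two]
  simp [coe_fnL]

theorem norm_sq_gradL (v : H1 E) : ‖gradL v‖ ^ 2 = ∫ x, ‖grad v x‖ ^ 2 := norm_sq_Lp_two _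

theorem integrable_sq_fn (v : H1 E) : Integrable (fun x => fn v x ^ 2) volume :=
  (memLp_fn v).integrable_sq

theorem inner_fnL_toLp (v : H1 E) {ψ : E → ℝ} (hψ : MemLp ψ 2 volume) :
    inner ℝ (fnL v) (hψ.toLp ψ) = ∫ x, fn v x * ψ x := by
  rw [L2.inner_def]
  apply integral_congr_ae
  filter_upwards [hψ.coeFn_toLp] with x hx
  rw [hx, coe_fnL]
  simp [mul_comm]

theorem inner_gradL (v w : H1 E) :
    inner ℝ (gradL v) (gradL w) = ∫ x, inner ℝ (grad v x) (grad w x) := L2.inner_def _ _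

/-- For each test function both sides of the weak gradient identity are inner products with fixed
elements of `L²`, so `H1` is an intersection of closed sets. -/
theorem isClosed_H1 : IsClosed (H1 E : Set (WithLp 2 (Lp ℝ 2 (volume : Measure E) ×
    Lp E 2 (volume : Measure E)))) := by
  have key : (H1 E : Set (WithLp 2 (Lp ℝ 2 (volume : Measure E) × Lp E 2 (volume : Measure E))))
      = ⋂ (φ : E → ℝ) (_ : ContDiff ℝ ∞ φ) (_ : HasCompactSupport φ) (y : E),
        {w | ∫ x, w.fst x * fderiv ℝ φ x y = -∫ x, inner ℝ (w.snd x) y * φ x} := by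
    ext w
    simp only [mem_iInter]
    exact Iff.rfl
  rw [key]
  refine isClosed_iInter fun φ => isClosed_iInter fun hφ => isClosed_iInter fun hc =>
    isClosed_iInter fun y => ?_
  have h1 : MemLp (fun x => fderiv ℝ φ x y) 2 (volume : Measure E) :=
    ((hφ.continuous_fderiv (by simp)).clm_apply continuous_const).memLp_of_hasCompactSupport
      (hc.fderiv_apply ℝ y)
  have h2 : MemLp (fun x => φ x • y) 2 (volume : Measure E) :=
    (hφ.continuous.smul continuous_const).memLp_of_hasCompactSupport hc.smul_right
  have e1 : ∀ u : Lp ℝ 2 (volume : Measure E),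
      ∫ x, u x * fderiv ℝ φ x y = inner ℝ u (h1.toLp _) := by
    intro u
    rw [L2.inner_def]
    apply integral_congr_ae
    filter_upwards [h1.coeFn_toLp] with x hx
    rw [hx]
    simp [mul_comm]
  have e2 : ∀ u : Lp E 2 (volume : Measure E),
      ∫ x, inner ℝ (u x) y * φ x = inner ℝ u (h2.toLp _) := by
    intro u
    rw [L2.inner_def]
    apply integral_congr_ae
    filter_upwards [h2.coeFn_toLp] with x hx
    rw [hx, inner_smul_right, mul_comm]
  simp only [e1, e2]
  exact isClosed_eq
    ((WithLp.continuous_fst 2 _ _).inner continuous_const)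
    ((WithLp.continuous_snd 2 _ _).inner continuous_const).neg

instance completeSpace_H1 : CompleteSpace (H1 E) :=
  isClosed_H1.completeSpace_coe

/-- The element of `H¹` given by a function and its weak gradient. -/
noncomputable def H1.ofWeakGradient {u : E → ℝ} {g : E → E} (hu : MemLp u 2 volume)
    (hg : MemLp g 2 volume) (h : IsWeakGradient u g) : H1 E :=
  ⟨WithLp.toLp 2 (hu.toLp u, hg.toLp g),
    h.congr_ae hu.coeFn_toLp.symm hg.coeFn_toLp.symm⟩

theorem fn_ofWeakGradient {u : E → ℝ} {g : E → E} (hu : MemLp u 2 volume)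
    (hg : MemLp g 2 volume) (h : IsWeakGradient u g) :
    fn (H1.ofWeakGradient hu hg h) =ᵐ[volume] u := hu.coeFn_toLp

theorem grad_ofWeakGradient {u : E → ℝ} {g : E → E} (hu : MemLp u 2 volume)
    (hg : MemLp g 2 volume) (h : IsWeakGradient u g) :
    grad (H1.ofWeakGradient hu hg h) =ᵐ[volume] g := hg.coeFn_toLp

theorem integral_mul_fderiv_eq_neg {φ ψ : E → ℝ} (hφ : ContDiff ℝ 1 φ) (hψ : ContDiff ℝ 1 ψ)
    (hc : HasCompactSupport ψ) (y : E) :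
    ∫ x, φ x * fderiv ℝ ψ x y = -∫ x, fderiv ℝ φ x y * ψ x := by
  have c1 : Continuous fun x => fderiv ℝ φ x y :=
    (hφ.continuous_fderiv (by simp)).clm_apply continuous_const
  have c2 : Continuous fun x => fderiv ℝ ψ x y :=
    (hψ.continuous_fderiv (by simp)).clm_apply continuous_const
  exact integral_mul_fderiv_eq_neg_fderiv_mul_of_integrable
    ((c1.mul hψ.continuous).integrable_of_hasCompactSupport hc.mul_left)
    ((hφ.continuous.mul c2).integrable_of_hasCompactSupport (hc.fderiv_apply ℝ y).mul_left)
    ((hφ.continuous.mul hψ.continuous).integrable_of_hasCompactSupport hc.mul_left)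
    (fun x _ => hφ.differentiable (by simp) x) (fun x _ => hψ.differentiable (by simp) x)

theorem isWeakGradient_of_contDiff {u : E → ℝ} {g : E → E} (hu : ContDiff ℝ 1 u)
    (h : ∀ x y, fderiv ℝ u x y = inner ℝ (g x) y) : IsWeakGradient u g := by
  intro φ hφ hc y
  rw [integral_mul_fderiv_eq_neg hu (hφ.of_le (by exact_mod_cast le_top)) hc y]
  simp only [h]

/-- The mollification of an element of `H¹`. -/
noncomputable def mollH (ρ : ContDiffBump (0 : E)) (v : H1 E) : H1 E :=
  H1.ofWeakGradient (memLp_moll ρ (memLp_fn v)) (memLp_moll ρ (memLp_grad v))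
    (isWeakGradient_of_contDiff
      ((contDiff_moll ρ (MemLp.locallyIntegrable_two (memLp_fn v))).of_le
        (by exact_mod_cast le_top))
      (fderiv_moll_of_isWeakGradient ρ (memLp_fn v) (memLp_grad v) (isWeakGradient_fn_grad v)))

theorem fn_mollH (ρ : ContDiffBump (0 : E)) (v : H1 E) :
    fn (mollH ρ v) =ᵐ[volume] moll ρ (fn v) := fn_ofWeakGradient _ _ _

theorem grad_mollH (ρ : ContDiffBump (0 : E)) (v : H1 E) :
    grad (mollH ρ v) =ᵐ[volume] moll ρ (grad v) := grad_ofWeakGradient _ _ _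

theorem norm_fnL_eq (v : H1 E) : ‖fnL v‖ = (eLpNorm (fn v) 2 volume).toReal := Lp.norm_def _

theorem norm_gradL_eq (v : H1 E) : ‖gradL v‖ = (eLpNorm (grad v) 2 volume).toReal := Lp.norm_def _

theorem norm_gradL_mollH_le (ρ : ContDiffBump (0 : E)) (v : H1 E) :
    ‖gradL (mollH ρ v)‖ ≤ ‖gradL v‖ := by
  rw [norm_gradL_eq, norm_gradL_eq, eLpNorm_congr_ae (grad_mollH ρ v)]
  exact ENNReal.toReal_mono (memLp_grad v).2.ne (eLpNorm_moll_le ρ (memLp_grad v))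

theorem norm_fnL_mollH_le (ρ : ContDiffBump (0 : E)) (v : H1 E) :
    ‖fnL (mollH ρ v)‖ ≤ ‖fnL v‖ := by
  rw [norm_fnL_eq, norm_fnL_eq, eLpNorm_congr_ae (fn_mollH ρ v)]
  exact ENNReal.toReal_mono (memLp_fn v).2.ne (eLpNorm_moll_le ρ (memLp_fn v))

theorem norm_fnL_mollH_sub_le (ρ : ContDiffBump (0 : E)) (v : H1 E) :
    ‖fnL (mollH ρ v - v)‖ ≤ ρ.rOut * ‖gradL v‖ := by
  have h : fn (mollH ρ v - v) =ᵐ[volume] fun x => moll ρ (fn v) x - fn v x := by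
    filter_upwards [fn_sub (mollH ρ v) v, fn_mollH ρ v] with x h1 h2
    rw [h1, h2]
  rw [norm_fnL_eq, norm_gradL_eq, eLpNorm_congr_ae h, ← ENNReal.toReal_ofReal ρ.rOut_pos.le,
    ← ENNReal.toReal_mul]
  exact ENNReal.toReal_mono (ENNReal.mul_ne_top ENNReal.ofReal_ne_top (memLp_grad v).2.ne)
    (eLpNorm_moll_sub_le_of_isWeakGradient ρ (memLp_fn v) (memLp_grad v)
      (isWeakGradient_fn_grad v))

theorem tendsto_mollH (v : H1 E) : Tendsto (fun n => mollH (bumpSeq E n) v) atTop (𝓝 v) := by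
  rw [tendsto_iff_norm_sub_tendsto_zero]
  have h1 : Tendsto (fun n => ‖fnL (mollH (bumpSeq E n) v - v)‖) atTop (𝓝 0) := by
    have h := (ENNReal.tendsto_toReal ENNReal.zero_ne_top).comp (tendsto_eLpNorm_moll_sub (memLp_fn v))
    rw [ENNReal.toReal_zero] at h
    refine h.congr fun n => ?_
    rw [norm_fnL_eq, Function.comp]
    congr 1
    apply eLpNorm_congr_ae
    filter_upwards [fn_sub (mollH (bumpSeq E n) v) v, fn_mollH (bumpSeq E n) v] with x h1 h2
    rw [h1, h2]
  have h2 : Tendsto (fun n => ‖gradL (mollH (bumpSeq E n) v - v)‖) atTop (𝓝 0) := by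
    have h := (ENNReal.tendsto_toReal ENNReal.zero_ne_top).comp
      (tendsto_eLpNorm_moll_sub (memLp_grad v))
    rw [ENNReal.toReal_zero] at h
    refine h.congr fun n => ?_
    rw [norm_gradL_eq, Function.comp]
    congr 1
    apply eLpNorm_congr_ae
    filter_upwards [grad_sub (mollH (bumpSeq E n) v) v, grad_mollH (bumpSeq E n) v] with x h1 h2
    rw [h1, h2]
  have h3 := h1.add h2
  rw [add_zero] at h3
  exact squeeze_zero (fun _ => norm_nonneg _) (fun n => norm_H1_le _) h3

/-! ### The Sobolev inequality -/

/-- A fixed smooth cutoff, equal to `1` on the unit ball. -/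
noncomputable def cutoff (E : Type*) [NormedAddCommGroup E] : ContDiffBump (0 : E) where
  rIn := 1
  rOut := 2
  rIn_pos := one_pos
  rIn_lt_rOut := one_lt_two

/-- The Gagliardo–Nirenberg–Sobolev inequality for compactly supported functions is applied to `χ(rₙ
x) u(x)`, and Fatou's lemma removes the cutoff. Membership of `u` in `L²` makes the gradient of the
cutoff harmless. -/
theorem eLpNorm_sobolev_of_contDiff {p' : NNReal} (hn : 0 < Module.finrank ℝ E)
    (hp' : (p' : ℝ)⁻¹ = (2 : ℝ)⁻¹ - (Module.finrank ℝ E : ℝ)⁻¹) {u : E → ℝ} {g : E → E}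
    (hu : ContDiff ℝ 1 u) (hu2 : MemLp u 2 volume) (hg : MemLp g 2 volume)
    (h : ∀ x y, fderiv ℝ u x y = inner ℝ (g x) y) :
    eLpNorm u p' volume ≤
      eLpNormLESNormFDerivOfEqInnerConst (volume : Measure E) 2 * eLpNorm g 2 volume := by
  set S : ℝ≥0∞ := ↑(eLpNormLESNormFDerivOfEqInnerConst (volume : Measure E) 2)
  have hχ : ContDiff ℝ 1 (cutoff E : E → ℝ) := (cutoff E).contDiff
  obtain ⟨K, hK⟩ := (hχ.continuous_fderiv (by simp)).bounded_above_of_compact_support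
    ((cutoff E).hasCompactSupport.fderiv ℝ)
  have hK0 : 0 ≤ K := (norm_nonneg _).trans (hK 0)
  let r : ℕ → ℝ := fun n => 1 / ((n : ℝ) + 1)
  have hr : ∀ n, 0 < r n := fun n => by positivity
  let w : ℕ → E → ℝ := fun n x => cutoff E (r n • x) * u x
  have hcs : ∀ n, HasCompactSupport fun x => cutoff E (r n • x) := fun n =>
    (cutoff E).hasCompactSupport.comp_smul (hr n).ne'
  have hcd : ∀ n, ContDiff ℝ 1 fun x => cutoff E (r n • x) := fun n =>
    hχ.comp (contDiff_const_smul _)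
  have hw1 : ∀ n, ContDiff ℝ 1 (w n) := fun n => (hcd n).mul hu
  have hw2 : ∀ n, HasCompactSupport (w n) := fun n => (hcs n).mul_right
  have hfd : ∀ n x, fderiv ℝ (w n) x = cutoff E (r n • x) • fderiv ℝ u x
      + u x • (r n • fderiv ℝ (cutoff E) (r n • x)) := by
    intro n x
    have h1 : HasFDerivAt (fun x => cutoff E (r n • x)) (r n • fderiv ℝ (cutoff E) (r n • x)) x := by
      have := ((hχ.differentiable (by simp)) (r n • x)).hasFDerivAt.comp x
        ((hasFDerivAt_id x).const_smul (r n))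
      refine this.congr_fderiv ?_
      ext y
      simp
    exact (h1.mul ((hu.differentiable (by simp)) x).hasFDerivAt).fderiv
  have hnorm : ∀ x, ‖fderiv ℝ u x‖ ≤ ‖g x‖ := by
    intro x
    apply ContinuousLinearMap.opNorm_le_bound _ (norm_nonneg _)
    intro y
    rw [h]
    exact norm_inner_le_norm _ _
  -- The cutoff at scale `1 / rₙ = n + 1` has gradient at most `K rₙ`, which tends to zero.
  have hbound : ∀ n, eLpNorm (fderiv ℝ (w n)) 2 volume ≤
      eLpNorm g 2 volume + ENNReal.ofReal (K * r n) * eLpNorm u 2 volume := by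
    intro n
    have m1 : AEStronglyMeasurable (fun x => ‖g x‖) (volume : Measure E) := hg.1.norm
    have m2 : AEStronglyMeasurable (fun x => (K * r n) * ‖u x‖) (volume : Measure E) :=
      hu2.1.norm.const_mul _
    calc eLpNorm (fderiv ℝ (w n)) 2 volume
        ≤ eLpNorm (fun x => ‖g x‖ + (K * r n) * ‖u x‖) 2 volume := by
          apply eLpNorm_mono_real
          intro x
          rw [hfd]
          refine (norm_add_le _ _).trans (add_le_add ?_ ?_)
          · rw [norm_smul, Real.norm_of_nonneg (cutoff E).nonneg]
            exact (mul_le_of_le_one_left (norm_nonneg _) (cutoff E).le_one).trans (hnorm x)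
          · rw [norm_smul, norm_smul, Real.norm_of_nonneg (hr n).le]
            have := mul_le_mul_of_nonneg_left (hK (r n • x))
              (mul_nonneg (norm_nonneg (u x)) (hr n).le)
            linarith
      _ ≤ eLpNorm (fun x => ‖g x‖) 2 volume + eLpNorm (fun x => (K * r n) * ‖u x‖) 2 volume :=
          eLpNorm_add_le m1 m2 (by norm_num)
      _ = _ := by
          rw [eLpNorm_norm]
          congr 1
          have := eLpNorm_const_smul (K * r n) (fun x => ‖u x‖) 2 (volume : Measure E)
          rw [eLpNorm_norm, Real.enorm_of_nonneg (by have := hr n; positivity)] at this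
          exact this
  have hGNS : ∀ n, eLpNorm (w n) p' volume ≤
      S * (eLpNorm g 2 volume + ENNReal.ofReal (K * r n) * eLpNorm u 2 volume) := by
    intro n
    have := eLpNorm_le_eLpNorm_fderiv_of_eq_inner (volume : Measure E) (hw1 n) (hw2 n) (p := 2)
      (p' := p') (by norm_num) hn (by simpa using hp')
    exact this.trans (mul_le_mul' le_rfl (hbound n))
  have hpt : ∀ᵐ x ∂(volume : Measure E), Tendsto (fun n => w n x) atTop (𝓝 (u x)) := by
    apply Eventually.of_forall
    intro x
    have h1 : Tendsto (fun n => r n • x) atTop (𝓝 ((0 : ℝ) • x)) :=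
      (tendsto_one_div_add_atTop_nhds_zero_nat (𝕜 := ℝ)).smul_const x
    have h2 := (hχ.continuous.tendsto _).comp h1
    rw [zero_smul, (cutoff E).one_of_mem_closedBall (by simp [(cutoff E).rIn_pos.le])] at h2
    have := h2.mul_const (u x)
    rwa [one_mul] at this
  have hlim : Tendsto (fun n => S * (eLpNorm g 2 volume
      + ENNReal.ofReal (K * r n) * eLpNorm u 2 volume)) atTop (𝓝 (S * eLpNorm g 2 volume)) := by
    have h1 : Tendsto (fun n => ENNReal.ofReal (K * r n)) atTop (𝓝 0) := by
      have := ENNReal.tendsto_ofReal ((tendsto_one_div_add_atTop_nhds_zero_nat (𝕜 := ℝ)).const_mul K)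
      simpa [r] using this
    have h2 := (ENNReal.Tendsto.mul_const h1 (Or.inr hu2.2.ne)).const_add (eLpNorm g 2 volume)
    rw [zero_mul, add_zero] at h2
    exact ENNReal.Tendsto.const_mul h2 (Or.inr ENNReal.coe_ne_top)
  refine (Lp.eLpNorm_lim_le_liminf_eLpNorm (fun n => (hw1 n).continuous.aestronglyMeasurable) u
    hpt).trans ?_
  rw [← hlim.liminf_eq]
  exact liminf_le_liminf (Eventually.of_forall hGNS)

/-- Mollifications satisfy the inequality with a gradient norm no larger than that of `v`; Fatou's
lemma along an almost everywhere convergent subsequence passes it to `v`. -/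
theorem eLpNorm_sobolev {p' : NNReal} (hn : 0 < Module.finrank ℝ E)
    (hp' : (p' : ℝ)⁻¹ = (2 : ℝ)⁻¹ - (Module.finrank ℝ E : ℝ)⁻¹) (v : H1 E) :
    eLpNorm (fn v) p' volume ≤
      eLpNormLESNormFDerivOfEqInnerConst (volume : Measure E) 2 * eLpNorm (grad v) 2 volume := by
  have hm := tendstoInMeasure_of_tendsto_eLpNorm (p := 2) (by norm_num)
    (fun n => (memLp_moll (bumpSeq E n) (memLp_fn v)).1) (memLp_fn v).1
    (tendsto_eLpNorm_moll_sub (memLp_fn v))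
  obtain ⟨k, -, hk⟩ := hm.exists_seq_tendsto_ae
  refine (Lp.eLpNorm_lim_le_liminf_eLpNorm
    (fun n => (memLp_moll (bumpSeq E (k n)) (memLp_fn v)).1) _ hk).trans ?_
  refine liminf_le_of_le (by isBoundedDefault) fun b hb => ?_
  obtain ⟨n, hn'⟩ := hb.exists
  refine hn'.trans ((eLpNorm_sobolev_of_contDiff hn hp'
    ((contDiff_moll _ (MemLp.locallyIntegrable_two (memLp_fn v))).of_le (by exact_mod_cast le_top))
    (memLp_moll _ (memLp_fn v)) (memLp_moll _ (memLp_grad v))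
    (fderiv_moll_of_isWeakGradient _ (memLp_fn v) (memLp_grad v) (isWeakGradient_fn_grad v))).trans
    (mul_le_mul' le_rfl (eLpNorm_moll_le _ (memLp_grad v))))

/-- Hölder with exponents `n/2` and `n/(n-2)`: the power `2/n` of `a` becomes `a` itself, and `v²`
becomes the Sobolev power `2n/(n-2)`. The weight `a` is left free, to be used with `v²` and with
`f(v)²`. -/
theorem lintegral_rpow_mul_sq_le (hn : 2 < Module.finrank ℝ E) (v : H1 E) {a : E → ℝ≥0∞}
    (ha : AEMeasurable a volume) :
    ∫⁻ x, a x ^ (2 / (Module.finrank ℝ E : ℝ)) * ‖fn v x‖ₑ ^ (2 : ℝ) ≤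
      (∫⁻ x, a x) ^ (2 / (Module.finrank ℝ E : ℝ)) *
        (eLpNormLESNormFDerivOfEqInnerConst (volume : Measure E) 2 * eLpNorm (grad v) 2 volume)
          ^ (2 : ℝ) := by
  have hn2 : (2 : ℝ) < (Module.finrank ℝ E : ℝ) := by exact_mod_cast hn
  set n : ℝ := (Module.finrank ℝ E : ℝ) with hndef
  have hconj : (n / 2).HolderConjugate (n / (n - 2)) := by
    rw [Real.holderConjugate_iff]
    refine ⟨by linarith, ?_⟩
    have : n - 2 ≠ 0 := by linarith
    field_simp
    ring
  let p' : NNReal := ⟨2 * n / (n - 2), by apply div_nonneg <;> linarith⟩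
  have hp'v : (p' : ℝ) = 2 * n / (n - 2) := rfl
  have hp'0 : 0 < (p' : ℝ) := by rw [hp'v]; apply div_pos <;> linarith
  have hS := eLpNorm_sobolev (p' := p') (by lia) (by
    rw [hp'v, ← hndef]
    have : n - 2 ≠ 0 := by linarith
    field_simp) v
  have hH := ENNReal.lintegral_mul_le_Lp_mul_Lq (volume : Measure E) hconj
    (f := fun x => a x ^ (2 / n)) (g := fun x => ‖fn v x‖ₑ ^ (2 : ℝ)) (ha.pow_const _)
    ((memLp_fn v).1.enorm.pow_const _)
  refine hH.trans (mul_le_mul' ?_ ?_)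
  · simp only [← ENNReal.rpow_mul]
    have h1 : 2 / n * (n / 2) = 1 := by field_simp
    rw [h1]
    simp
  · refine le_trans (le_of_eq ?_) (ENNReal.rpow_le_rpow hS (by norm_num))
    rw [eLpNorm_eq_lintegral_rpow_enorm_toReal (by simpa using hp'0.ne') (by simp),
      ← ENNReal.rpow_mul]
    simp only [← ENNReal.rpow_mul, ENNReal.coe_toReal, hp'v]
    congr 2
    · funext x
      congr 1
      ring
    · have : n - 2 ≠ 0 := by linarith
      field_simp

/-- The constant in the interpolation inequality `integral_rpow_mul_sq_le`. -/
noncomputable def sobConst (E : Type*) [NormedAddCommGroup E] [InnerProductSpace ℝ E]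
    [FiniteDimensional ℝ E] [MeasurableSpace E] [BorelSpace E] : ℝ :=
  (eLpNormLESNormFDerivOfEqInnerConst (volume : Measure E) 2 : ℝ) ^ 2

theorem sobConst_nonneg : 0 ≤ sobConst E := sq_nonneg _

theorem integral_rpow_mul_sq_le (hn : 2 < Module.finrank ℝ E) (v : H1 E) {a : E → ℝ}
    (ha0 : ∀ x, 0 ≤ a x) (ha : Integrable a volume) :
    Integrable (fun x => a x ^ (2 / (Module.finrank ℝ E : ℝ)) * fn v x ^ 2) volume ∧
    ∫ x, a x ^ (2 / (Module.finrank ℝ E : ℝ)) * fn v x ^ 2 ≤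
      sobConst E * (∫ x, a x) ^ (2 / (Module.finrank ℝ E : ℝ)) * ‖gradL v‖ ^ 2 := by
  set r : ℝ := 2 / (Module.finrank ℝ E : ℝ) with hr
  have hr0 : 0 ≤ r := by positivity
  have h := lintegral_rpow_mul_sq_le hn v (a := fun x => ENNReal.ofReal (a x))
    ha.aemeasurable.ennreal_ofReal
  rw [← hr] at h
  have e1 : ∀ x, ENNReal.ofReal (a x) ^ r * ‖fn v x‖ₑ ^ (2 : ℝ)
      = ENNReal.ofReal (a x ^ r * fn v x ^ 2) := by
    intro x
    rw [ENNReal.ofReal_mul (Real.rpow_nonneg (ha0 x) _), ENNReal.ofReal_rpow_of_nonneg (ha0 x) hr0,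
      ← sq_abs (fn v x), ENNReal.ofReal_pow (abs_nonneg _), ← Real.enorm_eq_ofReal_abs]
    norm_cast
  simp only [e1] at h
  rw [← ofReal_integral_eq_lintegral_ofReal ha (Eventually.of_forall ha0)] at h
  have e2 : ENNReal.ofReal (∫ x, a x) ^ r *
      ((eLpNormLESNormFDerivOfEqInnerConst (volume : Measure E) 2 : ℝ≥0∞)
        * eLpNorm (grad v) 2 volume) ^ (2 : ℝ)
      = ENNReal.ofReal (sobConst E * (∫ x, a x) ^ r * ‖gradL v‖ ^ 2) := by
    have h1 : eLpNorm (grad v) 2 volume = ENNReal.ofReal ‖gradL v‖ := by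
      rw [norm_gradL_eq, ENNReal.ofReal_toReal (memLp_grad v).2.ne]
    rw [h1, ENNReal.ofReal_rpow_of_nonneg (integral_nonneg ha0) hr0, ← ENNReal.ofReal_coe_nnreal,
      ← ENNReal.ofReal_mul NNReal.zero_le_coe,
      ENNReal.ofReal_rpow_of_nonneg (by positivity) (by norm_num),
      ← ENNReal.ofReal_mul (Real.rpow_nonneg (integral_nonneg ha0) _)]
    congr 1
    rw [show ((2 : ℝ)) = ((2 : ℕ) : ℝ) by norm_num, Real.rpow_natCast]
    unfold sobConst
    push_cast
    ring
  rw [e2] at h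
  have hm : AEStronglyMeasurable (fun x => a x ^ r * fn v x ^ 2) (volume : Measure E) :=
    ((ha.aemeasurable.pow_const r).mul ((memLp_fn v).1.aemeasurable.pow_const 2)).aestronglyMeasurable
  have h0 : ∀ x, 0 ≤ a x ^ r * fn v x ^ 2 := fun x =>
    mul_nonneg (Real.rpow_nonneg (ha0 x) _) (sq_nonneg _)
  refine ⟨⟨hm, ?_⟩, ?_⟩
  · rw [hasFiniteIntegral_iff_ofReal (Eventually.of_forall h0)]
    exact h.trans_lt ENNReal.ofReal_lt_top
  · rw [integral_eq_lintegral_of_nonneg_ae (Eventually.of_forall h0) hm]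
    refine ENNReal.toReal_le_of_le_ofReal ?_ h
    have := Real.rpow_nonneg (integral_nonneg ha0 : 0 ≤ ∫ x, a x) r
    have := sobConst_nonneg (E := E)
    positivity

end SobolevBasics

/-! ### Nonlinearities of subcritical growth -/

/-- Nonlinearities that are locally Lipschitz with a constant growing at most like `|t|^r`. -/
structure IsGrowth (r : ℝ) (k : ℝ → ℝ) : Prop where
  continuous : Continuous k
  map_zero : k 0 = 0
  bound : ∃ C, 0 ≤ C ∧ ∀ a b, |k a - k b| ≤ C * (|a - b| * (1 + |a| ^ r + |b| ^ r))

theorem IsGrowth.add_smul {r : ℝ} {k l : ℝ → ℝ} (hk : IsGrowth r k) (hl : IsGrowth r l) (c : ℝ) :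
    IsGrowth r fun t => k t + c * l t := by
  obtain ⟨C, hC0, hC⟩ := hk.bound
  obtain ⟨D, hD0, hD⟩ := hl.bound
  refine ⟨hk.continuous.add (continuous_const.mul hl.continuous), ?_, C + |c| * D, by positivity,
    fun a b => ?_⟩
  · simp [hk.map_zero, hl.map_zero]
  · have h : k a + c * l a - (k b + c * l b) = (k a - k b) + c * (l a - l b) := by ring
    rw [h]
    refine (abs_add_le _ _).trans ?_
    rw [abs_mul]
    nlinarith [hC a b, mul_le_mul_of_nonneg_left (hD a b) (abs_nonneg c)]

theorem isGrowth_dualMass {r : ℝ} : IsGrowth r dualMass := by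
  refine ⟨continuous_dualMass, dualMass_zero, 1, zero_le_one, fun a b => ?_⟩
  have h := abs_dualMass_sub_le a b
  have h1 : 0 ≤ |a| ^ r := Real.rpow_nonneg (abs_nonneg _) _
  have h2 : 0 ≤ |b| ^ r := Real.rpow_nonneg (abs_nonneg _) _
  nlinarith [abs_nonneg (a - b)]

theorem isGrowth_dualPower {p r : ℝ} (hp : 2 < p) (hr : 0 ≤ r) (hpr : p ≤ 4 + 2 * r) :
    IsGrowth r (dualPower p) :=
  ⟨continuous_dualPower hp, dualPower_zero p, p * 2 ^ r, by positivity,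
    abs_dualPower_sub_le hp hr hpr⟩

theorem abs_rpow_le_of_mem_uIcc {r a b t : ℝ} (hr : 0 ≤ r) (ht : t ∈ uIcc a b) :
    |t| ^ r ≤ |a| ^ r + |b| ^ r := by
  have ha : 0 ≤ |a| ^ r := Real.rpow_nonneg (abs_nonneg _) _
  have hb : 0 ≤ |b| ^ r := Real.rpow_nonneg (abs_nonneg _) _
  have hmax : |t| ≤ max |a| |b| := by
    rcases mem_uIcc.1 ht with h | h
    · exact abs_le_max_abs_abs h.1 h.2
    · rw [max_comm]
      exact abs_le_max_abs_abs h.1 h.2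
  rcases le_max_iff.1 hmax with h | h
  · have := Real.rpow_le_rpow (abs_nonneg t) h hr
    linarith
  · have := Real.rpow_le_rpow (abs_nonneg t) h hr
    linarith

/-- The mean value inequality for `K(t) - k(a) t` on the segment from `a` to `b`. The factor 2 is
there because `|a|ʳ` occurs both directly and in the bound of `|t|ʳ`. -/
theorem abs_primitive_sub_sub_le {r C : ℝ} {k K : ℝ → ℝ} (hr : 0 ≤ r) (hC0 : 0 ≤ C)
    (hC : ∀ a b, |k a - k b| ≤ C * (|a - b| * (1 + |a| ^ r + |b| ^ r)))
    (hK : ∀ t, HasDerivAt K (k t) t) (a b : ℝ) :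
    |K b - K a - k a * (b - a)| ≤ 2 * C * (|b - a| * (|b - a| * (1 + |a| ^ r + |b| ^ r))) := by
  have h := (convex_uIcc a b).norm_image_sub_le_of_norm_hasDerivWithin_le
    (f := fun t => K t - k a * t) (f' := fun t => k t - k a)
    (C := 2 * C * (|b - a| * (1 + |a| ^ r + |b| ^ r)))
    (fun t _ => ?_) (fun t ht => ?_) left_mem_uIcc right_mem_uIcc
  · simp only [Real.norm_eq_abs] at h
    have e : K b - k a * b - (K a - k a * a) = K b - K a - k a * (b - a) := by ring
    rw [e] at h
    linarith
  · have := (hK t).sub ((hasDerivAt_id t).const_mul (k a))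
    rw [mul_one] at this
    exact this.hasDerivWithinAt
  · rw [Real.norm_eq_abs]
    refine (hC t a).trans ?_
    rw [mul_assoc 2 C, mul_left_comm 2 C]
    apply mul_le_mul_of_nonneg_left _ hC0
    have h1 : |t - a| ≤ |b - a| := by
      rcases mem_uIcc.1 ht with h | h
      · rw [abs_of_nonneg (by linarith), abs_of_nonneg (by linarith)]
        linarith
      · rw [abs_of_nonpos (by linarith), abs_of_nonpos (by linarith)]
        linarith
    have h2 := abs_rpow_le_of_mem_uIcc hr ht
    have ha : 0 ≤ |a| ^ r := Real.rpow_nonneg (abs_nonneg _) _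
    have hb : 0 ≤ |b| ^ r := Real.rpow_nonneg (abs_nonneg _) _
    have ht : 0 ≤ |t| ^ r := Real.rpow_nonneg (abs_nonneg _) _
    calc |t - a| * (1 + |t| ^ r + |a| ^ r) ≤ |b - a| * (2 * (1 + |a| ^ r + |b| ^ r)) := by
          apply mul_le_mul h1 (by linarith) (by linarith) (abs_nonneg _)
      _ = _ := by ring

theorem IsGrowth.abs_le {r C : ℝ} {k : ℝ → ℝ} (hr : 0 < r) (hk : IsGrowth r k)
    (hC : ∀ a b, |k a - k b| ≤ C * (|a - b| * (1 + |a| ^ r + |b| ^ r))) (t : ℝ) :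
    |k t| ≤ C * (|t| * (1 + |t| ^ r + |t| ^ r)) := by
  have h := hC t 0
  simp only [hk.map_zero, sub_zero, abs_zero, Real.zero_rpow hr.ne'] at h
  refine h.trans ?_
  by_cases hC0 : 0 ≤ C
  · have h2 : 0 ≤ |t| ^ r := Real.rpow_nonneg (abs_nonneg _) _
    apply mul_le_mul_of_nonneg_left _ hC0
    apply mul_le_mul_of_nonneg_left _ (abs_nonneg _)
    linarith
  -- A negative `C` would contradict the hypothesis at the points 1 and 0.
  · exfalso
    have h1 := hC 1 0
    have h2 : 0 < |(1 : ℝ) - 0| * (1 + |(1 : ℝ)| ^ r + |(0 : ℝ)| ^ r) := by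
      rw [abs_zero, Real.zero_rpow hr.ne']
      norm_num
    nlinarith [abs_nonneg (k 1 - k 0)]

theorem abs_primitive_sub_le {r C : ℝ} {k K : ℝ → ℝ} (hr : 0 < r) (hC0 : 0 ≤ C)
    (hk : IsGrowth r k) (hC : ∀ a b, |k a - k b| ≤ C * (|a - b| * (1 + |a| ^ r + |b| ^ r)))
    (hK : ∀ t, HasDerivAt K (k t) t) (a b : ℝ) :
    |K b - K a| ≤ 4 * C * ((|a| + |b|) * (|b - a| * (1 + |a| ^ r + |b| ^ r))) := by
  have h1 := abs_primitive_sub_sub_le hr.le hC0 hC hK a b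
  have h2 := hk.abs_le hr hC a
  have ha : 0 ≤ |a| ^ r := Real.rpow_nonneg (abs_nonneg _) _
  have hb : 0 ≤ |b| ^ r := Real.rpow_nonneg (abs_nonneg _) _
  have h3 : |K b - K a| ≤ |K b - K a - k a * (b - a)| + |k a| * |b - a| := by
    rw [← abs_mul]
    have := abs_add_le (K b - K a - k a * (b - a)) (k a * (b - a))
    simpa using this
  have h4 : |b - a| ≤ |a| + |b| := by
    have := abs_sub b a
    linarith
  set w := |b - a| with hw
  have hw0 : 0 ≤ w := abs_nonneg _
  have h5 : |k a| * w ≤ 2 * C * (|a| * (w * (1 + |a| ^ r + |b| ^ r))) := by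
    have e1 := mul_le_mul_of_nonneg_right h2 hw0
    refine e1.trans ?_
    have e2 : 0 ≤ C * (|a| * w) := by positivity
    nlinarith
  have h6 : 2 * C * (w * (w * (1 + |a| ^ r + |b| ^ r)))
      ≤ 2 * C * ((|a| + |b|) * (w * (1 + |a| ^ r + |b| ^ r))) := by
    gcongr
  have h7 : 2 * C * (|a| * (w * (1 + |a| ^ r + |b| ^ r)))
      ≤ 2 * C * ((|a| + |b|) * (w * (1 + |a| ^ r + |b| ^ r))) := by
    gcongr
    linarith [abs_nonneg b]
  linarith

/-! ### Superposition operators from `H¹` to `L²` and their integral functionals -/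

section Nemytskii

variable {E : Type*} [NormedAddCommGroup E] [InnerProductSpace ℝ E] [FiniteDimensional ℝ E]
  [MeasurableSpace E] [BorelSpace E]

theorem integral_abs_mul_le {f g : E → ℝ} (hf : MemLp f 2 volume) (hg : MemLp g 2 volume) :
    ∫ x, |f x * g x| ≤ √(∫ x, f x ^ 2) * √(∫ x, g x ^ 2) := by
  have h := integral_mul_norm_le_Lp_mul_Lq (μ := (volume : Measure E)) Real.HolderConjugate.two_two
    (f := f) (g := g) (by simpa using hf) (by simpa using hg)
  simp only [Real.norm_eq_abs] at h
  simp only [abs_mul]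
  refine h.trans (le_of_eq ?_)
  rw [Real.sqrt_eq_rpow, Real.sqrt_eq_rpow]
  simp only [Real.rpow_two, sq_abs]

/-- The exponent `2 / dim E`. -/
noncomputable def growthExp (E : Type*) [NormedAddCommGroup E] [InnerProductSpace ℝ E] : ℝ :=
  2 / (Module.finrank ℝ E : ℝ)

theorem growthExp_pos (hn : 2 < Module.finrank ℝ E) : 0 < growthExp E := by
  have : (2 : ℝ) < Module.finrank ℝ E := by exact_mod_cast hn
  unfold growthExp
  positivity

/-- The weight `|w| (1 + |a|^r + |b|^r)`. -/
noncomputable def growthWeight (a b w : H1 E) (x : E) : ℝ :=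
  fn w x * (1 + |fn a x| ^ growthExp E + |fn b x| ^ growthExp E)

/-- The constant in the `L²` bound of `growthWeight`. -/
noncomputable def growthConst (a b : H1 E) : ℝ :=
  3 * (1 + sobConst E) * (1 + (‖a‖ ^ 2) ^ growthExp E + (‖b‖ ^ 2) ^ growthExp E)

theorem growthConst_nonneg (a b : H1 E) : 0 ≤ growthConst a b := by
  have := sobConst_nonneg (E := E)
  unfold growthConst
  positivity

theorem growthConst_le (hn : 2 < Module.finrank ℝ E) {a b : H1 E} {R : ℝ} (ha : ‖a‖ ≤ R)
    (hb : ‖b‖ ≤ R) : growthConst a b ≤ 3 * (1 + sobConst E) * (1 + 2 * (R ^ 2) ^ growthExp E) := by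
  have h := sobConst_nonneg (E := E)
  have hr := (growthExp_pos hn).le
  have h1 : (‖a‖ ^ 2) ^ growthExp E ≤ (R ^ 2) ^ growthExp E := by gcongr
  have h2 : (‖b‖ ^ 2) ^ growthExp E ≤ (R ^ 2) ^ growthExp E := by gcongr
  unfold growthConst
  apply mul_le_mul_of_nonneg_left _ (by positivity)
  linarith

theorem abs_rpow_sq (t r : ℝ) : (|t| ^ r) ^ 2 = (t ^ 2) ^ r := by
  rw [← sq_abs t, ← Real.rpow_natCast, ← Real.rpow_mul (abs_nonneg t), ← Real.rpow_natCast,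
    ← Real.rpow_mul (abs_nonneg t), mul_comm]

/-- Squaring `|a|ʳ` gives `(a²)ʳ`, the weight of the interpolation inequality for `r = 2 / dim E`;
the factor 3 comes from `(1 + A + B)² ≤ 3(1 + A² + B²)`. -/
theorem growthWeight_bound (hn : 2 < Module.finrank ℝ E) (a b w : H1 E) :
    MemLp (growthWeight a b w) 2 volume ∧
      ∫ x, growthWeight a b w x ^ 2 ≤ growthConst a b * ‖w‖ ^ 2 := by
  set r := growthExp E with hr
  have hr0 : 0 < r := growthExp_pos hn
  obtain ⟨ia, ha⟩ := integral_rpow_mul_sq_le hn w (fun x => sq_nonneg (fn a x)) (integrable_sq_fn a)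
  obtain ⟨ib, hb⟩ := integral_rpow_mul_sq_le hn w (fun x => sq_nonneg (fn b x)) (integrable_sq_fn b)
  rw [← norm_sq_fnL] at ha hb
  change Integrable (fun x => (fn a x ^ 2) ^ r * fn w x ^ 2) volume at ia
  change Integrable (fun x => (fn b x ^ 2) ^ r * fn w x ^ 2) volume at ib
  change ∫ x, (fn a x ^ 2) ^ r * fn w x ^ 2 ≤ _ * (_) ^ r * _ at ha
  change ∫ x, (fn b x ^ 2) ^ r * fn w x ^ 2 ≤ _ * (_) ^ r * _ at hb
  have iw := integrable_sq_fn w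
  have hm : AEStronglyMeasurable (growthWeight a b w) volume := by
    have ma := (memLp_fn a).1.norm.aemeasurable.pow_const r
    have mb := (memLp_fn b).1.norm.aemeasurable.pow_const r
    exact ((memLp_fn w).1.aemeasurable.mul ((aemeasurable_const.add ma).add mb)).aestronglyMeasurable
  have hpt : ∀ x, growthWeight a b w x ^ 2 ≤
      3 * (fn w x ^ 2 + (fn a x ^ 2) ^ r * fn w x ^ 2 + (fn b x ^ 2) ^ r * fn w x ^ 2) := by
    intro x
    rw [growthWeight, ← abs_rpow_sq, ← abs_rpow_sq, mul_pow]
    set A := |fn a x| ^ r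
    set B := |fn b x| ^ r
    have : (1 + A + B) ^ 2 ≤ 3 * (1 + A ^ 2 + B ^ 2) := by
      nlinarith [sq_nonneg (1 - A), sq_nonneg (1 - B), sq_nonneg (A - B)]
    nlinarith [mul_le_mul_of_nonneg_left this (sq_nonneg (fn w x))]
  have iwa : Integrable (fun x => fn w x ^ 2 + (fn a x ^ 2) ^ r * fn w x ^ 2) volume := iw.add ia
  have hint : Integrable (fun x => 3 * (fn w x ^ 2 + (fn a x ^ 2) ^ r * fn w x ^ 2
      + (fn b x ^ 2) ^ r * fn w x ^ 2)) volume := (iwa.add ib).const_mul 3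
  have hsq : Integrable (fun x => growthWeight a b w x ^ 2) volume := by
    refine hint.mono' (hm.pow 2) (Eventually.of_forall fun x => ?_)
    rw [Real.norm_of_nonneg (sq_nonneg _)]
    exact hpt x
  refine ⟨(memLp_two_iff_integrable_sq hm).2 hsq, ?_⟩
  have h1 := integral_mono hsq hint hpt
  refine h1.trans ?_
  rw [integral_const_mul, integral_add iwa ib, integral_add iw ia, ← norm_sq_fnL]
  have hS := sobConst_nonneg (E := E)
  have pa : (‖fnL a‖ ^ 2) ^ r ≤ (‖a‖ ^ 2) ^ r := by
    gcongr
    exact norm_fnL_le a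
  have pb : (‖fnL b‖ ^ 2) ^ r ≤ (‖b‖ ^ 2) ^ r := by
    gcongr
    exact norm_fnL_le b
  have qa : 0 ≤ (‖fnL a‖ ^ 2) ^ r := by positivity
  have qb : 0 ≤ (‖fnL b‖ ^ 2) ^ r := by positivity
  have pw1 : ‖fnL w‖ ^ 2 ≤ ‖w‖ ^ 2 := by
    gcongr
    exact norm_fnL_le w
  have pw2 : ‖gradL w‖ ^ 2 ≤ ‖w‖ ^ 2 := by
    gcongr
    exact norm_gradL_le w
  have ha2 : sobConst E * (‖fnL a‖ ^ 2) ^ r * ‖gradL w‖ ^ 2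
      ≤ sobConst E * (‖a‖ ^ 2) ^ r * ‖w‖ ^ 2 := by gcongr
  have hb2 : sobConst E * (‖fnL b‖ ^ 2) ^ r * ‖gradL w‖ ^ 2
      ≤ sobConst E * (‖b‖ ^ 2) ^ r * ‖w‖ ^ 2 := by gcongr
  unfold growthConst
  have t1 : 0 ≤ sobConst E * ‖w‖ ^ 2 := by positivity
  have t2 : 0 ≤ (‖a‖ ^ 2) ^ r * ‖w‖ ^ 2 := by positivity
  have t3 : 0 ≤ (‖b‖ ^ 2) ^ r * ‖w‖ ^ 2 := by positivity
  rw [← hr]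
  nlinarith

theorem memLp_nem (hn : 2 < Module.finrank ℝ E) {k : ℝ → ℝ} (hk : IsGrowth (growthExp E) k)
    (v : H1 E) : MemLp (fun x => k (fn v x)) 2 volume := by
  obtain ⟨C, hC0, hC⟩ := hk.bound
  refine ((growthWeight_bound hn v v v).1.const_mul C).mono
    (hk.continuous.comp_aestronglyMeasurable (memLp_fn v).1) (Eventually.of_forall fun x => ?_)
  have h := hk.abs_le (growthExp_pos hn) hC (fn v x)
  rw [Real.norm_eq_abs, Real.norm_eq_abs, growthWeight, abs_mul, abs_mul, abs_of_nonneg hC0,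
    abs_of_nonneg (a := 1 + _ + _) (by positivity)]
  exact h

/-- The superposition operator `v ↦ k(v)` from `H¹` to `L²`. -/
noncomputable def nem (hn : 2 < Module.finrank ℝ E) {k : ℝ → ℝ} (hk : IsGrowth (growthExp E) k)
    (v : H1 E) : Lp ℝ 2 (volume : Measure E) := (memLp_nem hn hk v).toLp _

theorem coe_nem (hn : 2 < Module.finrank ℝ E) {k : ℝ → ℝ} (hk : IsGrowth (growthExp E) k)
    (v : H1 E) : nem hn hk v =ᵐ[volume] fun x => k (fn v x) := (memLp_nem hn hk v).coeFn_toLp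

theorem inner_nem (hn : 2 < Module.finrank ℝ E) {k : ℝ → ℝ} (hk : IsGrowth (growthExp E) k)
    (v h : H1 E) : inner ℝ (nem hn hk v) (fnL h) = ∫ x, k (fn v x) * fn h x := by
  rw [real_inner_comm, nem, inner_fnL_toLp]
  simp only [mul_comm]

/-- A Lipschitz bound on bounded sets with values in `L²`, not merely in the dual of `H¹`. It yields
the continuity of the derivatives and their boundedness on bounded sets. -/
theorem norm_nem_sub_le (hn : 2 < Module.finrank ℝ E) {k : ℝ → ℝ} (hk : IsGrowth (growthExp E) k)
    {C : ℝ} (hC0 : 0 ≤ C)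
    (hC : ∀ a b, |k a - k b| ≤ C * (|a - b| * (1 + |a| ^ growthExp E + |b| ^ growthExp E)))
    (a b : H1 E) :
    ‖nem hn hk a - nem hn hk b‖ ≤ C * √(growthConst a b) * ‖a - b‖ := by
  have h1 : ‖nem hn hk a - nem hn hk b‖ ^ 2 ≤ C ^ 2 * (growthConst a b * ‖a - b‖ ^ 2) := by
    rw [norm_sq_Lp_two]
    obtain ⟨hL, hI⟩ := growthWeight_bound hn a b (a - b)
    calc ∫ x, ‖(nem hn hk a - nem hn hk b : Lp ℝ 2 (volume : Measure E)) x‖ ^ 2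
        ≤ ∫ x, C ^ 2 * growthWeight a b (a - b) x ^ 2 := by
          apply integral_mono_ae (Lp.memLp _).norm.integrable_sq (hL.integrable_sq.const_mul _)
          filter_upwards [Lp.coeFn_sub (nem hn hk a) (nem hn hk b), coe_nem hn hk a,
            coe_nem hn hk b, fn_sub a b] with x h1 h2 h3 h4
          rw [h1, Pi.sub_apply, h2, h3, growthWeight, h4, Real.norm_eq_abs, ← mul_pow]
          rw [sq_abs]
          apply sq_le_sq.2
          refine (hC _ _).trans (le_of_eq ?_)
          rw [abs_mul, abs_mul, abs_of_nonneg hC0, abs_of_nonneg (a := 1 + _ + _) (by positivity)]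
      _ ≤ _ := by
          rw [integral_const_mul]
          exact mul_le_mul_of_nonneg_left hI (sq_nonneg _)
  refine abs_le_of_sq_le_sq' ?_ (by positivity) |>.2
  rw [mul_pow, mul_pow, Real.sq_sqrt (growthConst_nonneg a b)]
  linarith

theorem continuous_nem (hn : 2 < Module.finrank ℝ E) {k : ℝ → ℝ} (hk : IsGrowth (growthExp E) k) :
    Continuous (nem hn hk) := by
  obtain ⟨C, hC0, hC⟩ := hk.bound
  rw [continuous_iff_continuousAt]
  intro a
  rw [ContinuousAt, tendsto_iff_norm_sub_tendsto_zero]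
  have hb : Tendsto (fun b : H1 E => C * √(growthConst b a) * ‖b - a‖) (𝓝 a) (𝓝 0) := by
    have hr := (growthExp_pos hn).le
    have hc : Continuous fun b : H1 E => C * √(growthConst b a) * ‖b - a‖ := by
      unfold growthConst
      have : Continuous fun b : H1 E => (‖b‖ ^ 2) ^ growthExp E :=
        (continuous_norm.pow 2).rpow_const fun _ => Or.inr hr
      fun_prop
    have := hc.tendsto a
    simpa using this
  exact squeeze_zero (fun _ => norm_nonneg _) (fun b => norm_nem_sub_le hn hk hC0 hC b a) hb

theorem integrable_primitive (hn : 2 < Module.finrank ℝ E) {k K : ℝ → ℝ}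
    (hk : IsGrowth (growthExp E) k) (hK : ∀ t, HasDerivAt K (k t) t) (hK0 : K 0 = 0) (v : H1 E) :
    Integrable (fun x => K (fn v x)) volume := by
  obtain ⟨C, hC0, hC⟩ := hk.bound
  have hKc : Continuous K := continuous_iff_continuousAt.2 fun t => (hK t).continuousAt
  have h := ((memLp_fn v).integrable_mul (growthWeight_bound hn v v v).1).norm.const_mul (4 * C)
  refine h.mono' (hKc.comp_aestronglyMeasurable (memLp_fn v).1) (Eventually.of_forall fun x => ?_)
  have h1 := abs_primitive_sub_le (growthExp_pos hn) hC0 hk hC hK 0 (fn v x)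
  rw [hK0, sub_zero, sub_zero, abs_zero, Real.zero_rpow (growthExp_pos hn).ne', zero_add] at h1
  rw [Real.norm_eq_abs]
  refine h1.trans ?_
  apply mul_le_mul_of_nonneg_left _ (by positivity)
  rw [Real.norm_eq_abs, Pi.mul_apply, growthWeight, abs_mul, abs_mul,
    abs_of_nonneg (a := 1 + _ + _) (by positivity)]
  have : 0 ≤ |fn v x| ^ growthExp E := by positivity
  gcongr

theorem tendsto_integral_abs_primitive_sub (hn : 2 < Module.finrank ℝ E) {k K : ℝ → ℝ}
    (hk : IsGrowth (growthExp E) k) (hK : ∀ t, HasDerivAt K (k t) t) (hK0 : K 0 = 0)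
    {v : ℕ → H1 E} {w : H1 E} (hv : Tendsto v atTop (𝓝 w)) :
    Tendsto (fun n => ∫ x, |K (fn (v n) x) - K (fn w x)|) atTop (𝓝 0) := by
  obtain ⟨C, hC0, hC⟩ := hk.bound
  have hr := growthExp_pos hn
  have key : ∀ n, ∫ x, |K (fn (v n) x) - K (fn w x)| ≤
      4 * C * ((‖w‖ + ‖v n‖) * √(growthConst w (v n) * ‖v n - w‖ ^ 2)) := by
    intro n
    obtain ⟨hL, hI⟩ := growthWeight_bound hn w (v n) (v n - w)
    have i1 : ∀ u : H1 E, ∫ x, |fn u x * growthWeight w (v n) (v n - w) x| ≤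
        ‖u‖ * √(growthConst w (v n) * ‖v n - w‖ ^ 2) := by
      intro u
      refine (integral_abs_mul_le (memLp_fn u) hL).trans ?_
      rw [← norm_sq_fnL, Real.sqrt_sq (norm_nonneg _)]
      gcongr
      exact norm_fnL_le u
    have j1 : ∀ u : H1 E, Integrable (fun x => |fn u x * growthWeight w (v n) (v n - w) x|) volume :=
      fun u => ((memLp_fn u).integrable_mul hL).abs
    calc ∫ x, |K (fn (v n) x) - K (fn w x)|
        ≤ ∫ x, 4 * C * (|fn w x * growthWeight w (v n) (v n - w) x|
            + |fn (v n) x * growthWeight w (v n) (v n - w) x|) := by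
          apply integral_mono_ae
            ((integrable_primitive hn hk hK hK0 _).sub (integrable_primitive hn hk hK hK0 _)).abs
            (((j1 _).add (j1 _)).const_mul _)
          filter_upwards [fn_sub (v n) w] with x hx
          refine (abs_primitive_sub_le hr hC0 hk hC hK (fn w x) (fn (v n) x)).trans (le_of_eq ?_)
          simp only [growthWeight, Pi.add_apply, hx, abs_mul]
          rw [abs_of_nonneg (a := 1 + _ + _) (by positivity)]
          ring
      _ = 4 * C * ((∫ x, |fn w x * growthWeight w (v n) (v n - w) x|)
            + ∫ x, |fn (v n) x * growthWeight w (v n) (v n - w) x|) := by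
          rw [integral_const_mul, integral_add (j1 _) (j1 _)]
      _ ≤ _ := by
          rw [add_mul]
          gcongr
          · exact i1 w
          · exact i1 (v n)
  have hb : Tendsto (fun b : H1 E => 4 * C * ((‖w‖ + ‖b‖) * √(growthConst w b * ‖b - w‖ ^ 2)))
      (𝓝 w) (𝓝 0) := by
    have hc : Continuous fun b : H1 E =>
        4 * C * ((‖w‖ + ‖b‖) * √(growthConst w b * ‖b - w‖ ^ 2)) := by
      unfold growthConst
      have : Continuous fun b : H1 E => (‖b‖ ^ 2) ^ growthExp E :=
        (continuous_norm.pow 2).rpow_const fun _ => Or.inr hr.le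
      fun_prop
    have := hc.tendsto w
    simpa using this
  exact squeeze_zero (fun n => integral_nonneg fun _ => abs_nonneg _) key (hb.comp hv)

/-- The integral functional `v ↦ ∫ K(v)` is differentiable on `H¹`. -/
theorem hasFDerivAt_integral_primitive (hn : 2 < Module.finrank ℝ E) {k K : ℝ → ℝ}
    (hk : IsGrowth (growthExp E) k) (hK : ∀ t, HasDerivAt K (k t) t) (hK0 : K 0 = 0) (v : H1 E) :
    HasFDerivAt (fun v : H1 E => ∫ x, K (fn v x))
      ((innerSL ℝ (nem hn hk v)).comp fnL) v := by
  obtain ⟨C, hC0, hC⟩ := hk.bound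
  have hr := growthExp_pos hn
  -- On the unit ball around `v` the growth constants are bounded by one number `M`, so the
  -- remainder is at most `2 C √M ‖u - v‖²`.
  set R := ‖v‖ + 1
  set M := 3 * (1 + sobConst E) * (1 + 2 * (R ^ 2) ^ growthExp E) with hM
  apply HasFDerivAt.of_isLittleO
  rw [Asymptotics.isLittleO_iff]
  intro c hc
  have hM0 : 0 ≤ 2 * C * √M := by positivity
  have hev : ∀ᶠ u in 𝓝 v, ‖u - v‖ < min 1 (c / (2 * C * √M + 1)) := by
    have : 0 < min 1 (c / (2 * C * √M + 1)) := by positivity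
    filter_upwards [Metric.ball_mem_nhds v this] with u hu
    rwa [← dist_eq_norm]
  filter_upwards [hev] with u hu
  obtain ⟨hL, hI⟩ := growthWeight_bound hn v u (u - v)
  have hu1 : ‖u‖ ≤ R := by
    have := norm_add_le (u - v) v
    rw [sub_add_cancel] at this
    have h2 := hu.trans_le (min_le_left _ _)
    simp only [R]
    linarith
  have hgc : growthConst v u ≤ M := growthConst_le hn (by simp [R]) hu1
  have hinner : ((innerSL ℝ (nem hn hk v)).comp fnL) (u - v)
      = ∫ x, k (fn v x) * fn (u - v) x := by
    rw [ContinuousLinearMap.comp_apply, innerSL_apply_apply, inner_nem]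
  have i3 : Integrable (fun x => k (fn v x) * fn (u - v) x) volume :=
    (memLp_nem hn hk v).integrable_mul (memLp_fn _)
  have iu := integrable_primitive hn hk hK hK0 u
  have iv := integrable_primitive hn hk hK hK0 v
  have iuv : Integrable (fun x => K (fn u x) - K (fn v x)) volume := iu.sub iv
  rw [hinner, ← integral_sub iu iv, ← integral_sub iuv i3]
  have hmain : ‖∫ x, K (fn u x) - K (fn v x) - k (fn v x) * fn (u - v) x‖
      ≤ 2 * C * √M * ‖u - v‖ ^ 2 := by
    refine (norm_integral_le_integral_norm _).trans ?_
    calc ∫ x, ‖K (fn u x) - K (fn v x) - k (fn v x) * fn (u - v) x‖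
        ≤ ∫ x, 2 * C * |fn (u - v) x * growthWeight v u (u - v) x| := by
          apply integral_mono_ae ((iu.sub iv).sub i3).norm
            (((memLp_fn _).integrable_mul hL).abs.const_mul _)
          filter_upwards [fn_sub u v] with x hx
          have h := abs_primitive_sub_sub_le hr.le hC0 hC hK (fn v x) (fn u x)
          change |K (fn u x) - K (fn v x) - k (fn v x) * fn (u - v) x| ≤
            2 * C * |fn (u - v) x * growthWeight v u (u - v) x|
          rw [growthWeight, hx]
          refine h.trans (le_of_eq ?_)
          rw [abs_mul, abs_mul, abs_of_nonneg (a := 1 + _ + _) (by positivity)]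
      _ ≤ 2 * C * (‖u - v‖ * √(growthConst v u * ‖u - v‖ ^ 2)) := by
          rw [integral_const_mul]
          gcongr
          refine (integral_abs_mul_le (memLp_fn _) hL).trans ?_
          rw [← norm_sq_fnL, Real.sqrt_sq (norm_nonneg _)]
          gcongr
          exact norm_fnL_le _
      _ ≤ _ := by
          rw [Real.sqrt_mul (growthConst_nonneg v u), Real.sqrt_sq (norm_nonneg _)]
          have := Real.sqrt_le_sqrt hgc
          calc _ = 2 * C * √(growthConst v u) * ‖u - v‖ ^ 2 := by ring
            _ ≤ _ := by gcongr
  refine hmain.trans ?_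
  have h2 : (2 * C * √M + 1) * ‖u - v‖ ≤ c := by
    have := hu.le.trans (min_le_right _ _)
    rwa [le_div_iff₀ (by positivity), mul_comm] at this
  nlinarith [norm_nonneg (u - v)]

theorem contDiff_integral_primitive (hn : 2 < Module.finrank ℝ E) {k K : ℝ → ℝ}
    (hk : IsGrowth (growthExp E) k) (hK : ∀ t, HasDerivAt K (k t) t) (hK0 : K 0 = 0) :
    ContDiff ℝ 1 (fun v : H1 E => ∫ x, K (fn v x)) := by
  rw [contDiff_one_iff_hasFDerivAt]
  refine ⟨fun v => (innerSL ℝ (nem hn hk v)).comp fnL, ?_,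
    hasFDerivAt_integral_primitive hn hk hK hK0⟩
  exact ((innerSL ℝ).continuous.comp (continuous_nem hn hk)).clm_comp continuous_const

end Nemytskii

/-! ### The Pohozaev identity -/

section Pohozaev

variable {E : Type*} [NormedAddCommGroup E] [InnerProductSpace ℝ E] [FiniteDimensional ℝ E]
  [MeasurableSpace E] [BorelSpace E]

theorem two_le_infty : (2 : WithTop ℕ∞) ≤ ((⊤ : ℕ∞) : WithTop ℕ∞) := by
  have h : ((2 : ℕ∞) : WithTop ℕ∞) ≤ ((⊤ : ℕ∞) : WithTop ℕ∞) := WithTop.coe_le_coe.2 le_top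
  exact h

theorem one_add_one_le_infty : (1 + 1 : WithTop ℕ∞) ≤ ((⊤ : ℕ∞) : WithTop ℕ∞) := by
  rw [one_add_one_eq_two]
  exact two_le_infty

theorem inner_moll (ρ : ContDiffBump (0 : E)) {g : E → E} (hg : MemLp g 2 volume) (x y : E) :
    inner ℝ (moll ρ g x) y = moll ρ (fun x => inner ℝ (g x) y) x := by
  have hint : Integrable (fun t => ρ.normed volume (x - t) • g t) volume :=
    ((ρ.hasCompactSupport_normed (μ := (volume : Measure E))).convolutionExists_left
      (ContinuousLinearMap.lsmul ℝ ℝ)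
      ρ.continuous_normed (MemLp.locallyIntegrable_two hg) x).integrable_swap
  rw [moll_apply_swap, moll_apply_swap, real_inner_comm, ← integral_inner hint]
  congr 1
  funext s
  rw [inner_smul_right, real_inner_comm, smul_eq_mul]

theorem fderiv_moll_fn (ρ : ContDiffBump (0 : E)) (v : H1 E) (x y : E) :
    fderiv ℝ (moll ρ (fn v)) x y = moll ρ (fun x => inner ℝ (grad v x) y) x := by
  rw [fderiv_moll_of_isWeakGradient ρ (memLp_fn v) (memLp_grad v) (isWeakGradient_fn_grad v),
    inner_moll ρ (memLp_grad v)]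

theorem inner_gradient_eq_fderiv (φ : E → ℝ) (x y : E) :
    inner ℝ (gradient φ x) y = fderiv ℝ φ x y := by
  rw [gradient, InnerProductSpace.toDual_symm_apply]

theorem continuous_gradient_of_contDiff {φ : E → ℝ} (hφ : ContDiff ℝ ∞ φ) :
    Continuous (gradient φ) :=
  (InnerProductSpace.toDual ℝ E).symm.continuous.comp (hφ.continuous_fderiv (by simp))

theorem hasCompactSupport_gradient {φ : E → ℝ} (hc : HasCompactSupport φ) :
    HasCompactSupport (gradient φ) :=
  (hc.fderiv ℝ).comp_left (g := (InnerProductSpace.toDual ℝ E).symm) (by simp)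

/-- A test function, as an element of `H¹`. -/
noncomputable def H1.ofTest {φ : E → ℝ} (hφ : ContDiff ℝ ∞ φ) (hc : HasCompactSupport φ) : H1 E :=
  H1.ofWeakGradient (hφ.continuous.memLp_of_hasCompactSupport hc)
    ((continuous_gradient_of_contDiff hφ).memLp_of_hasCompactSupport (hasCompactSupport_gradient hc))
    (isWeakGradient_of_contDiff (hφ.of_le (by exact_mod_cast le_top))
      fun x y => (inner_gradient_eq_fderiv φ x y).symm)

/-- The weak equation tested with `s ↦ ρ(x - s)` becomes a pointwise equation for the mollified
gradient, with the mollified right-hand side. Thus no second derivatives of `v` are needed. -/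
theorem sum_fderiv_moll_eq {ι : Type*} [Fintype ι] (b : OrthonormalBasis ι ℝ E)
    (ρ : ContDiffBump (0 : E)) {v : H1 E} {F : E → ℝ}
    (heq : ∀ h : H1 E, inner ℝ (gradL v) (gradL h) = ∫ x, F x * fn h x) (x : E) :
    ∑ i, fderiv ℝ (moll ρ fun x => inner ℝ (grad v x) (b i)) x (b i) = -moll ρ F x := by
  have hρ : ContDiff ℝ ∞ (ρ.normed (volume : Measure E)) := ρ.contDiff_normed
  have hφ : ContDiff ℝ ∞ fun s => ρ.normed (volume : Measure E) (x - s) :=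
    hρ.comp (contDiff_const.sub contDiff_id)
  have hc : HasCompactSupport fun s => ρ.normed (volume : Measure E) (x - s) :=
    hasCompactSupport_comp_sub_left ρ.hasCompactSupport_normed x
  have h := heq (H1.ofTest hφ hc)
  have h1 : ∫ s, F s * fn (H1.ofTest hφ hc) s = moll ρ F x := by
    rw [moll_apply_swap]
    apply integral_congr_ae
    filter_upwards [fn_ofWeakGradient (u := fun s => ρ.normed (volume : Measure E) (x - s)) _ _ _]
      with s hs
    rw [H1.ofTest, hs, smul_eq_mul, mul_comm]
  have h2 : ∀ i, fderiv ℝ (moll ρ fun x => inner ℝ (grad v x) (b i)) x (b i)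
      = -∫ s, inner ℝ (grad v s) (b i) * fderiv ℝ (fun s => ρ.normed (volume : Measure E) (x - s)) s (b i) := by
    intro i
    rw [fderiv_moll_apply ρ (MemLp.locallyIntegrable_two ((memLp_grad v).inner_const (b i))),
      ← integral_neg]
    congr 1
    funext s
    rw [fderiv_comp_sub_left (hρ.differentiable (by simp))]
    ring
  have h3 : inner ℝ (gradL v) (gradL (H1.ofTest hφ hc)) = ∑ i, ∫ s, inner ℝ (grad v s) (b i) *
      fderiv ℝ (fun s => ρ.normed (volume : Measure E) (x - s)) s (b i) := by
    rw [inner_gradL, ← integral_finsetSum]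
    · apply integral_congr_ae
      filter_upwards [grad_ofWeakGradient (u := fun s => ρ.normed (volume : Measure E) (x - s))
        (g := gradient fun s => ρ.normed (volume : Measure E) (x - s)) _ _ _] with s hs
      rw [H1.ofTest, hs, ← b.sum_inner_mul_inner (grad v s)]
      refine Finset.sum_congr rfl fun i _ => ?_
      rw [← inner_gradient_eq_fderiv]
      exact congrArg (inner ℝ (grad v s) (b i) * ·)
        (real_inner_comm (F := E) (gradient (fun s => ρ.normed (volume : Measure E) (x - s)) s) (b i))
    · intro i _
      have : MemLp (fun s => inner ℝ (grad v s) (b i)) 2 volume :=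
        (memLp_grad v).inner_const (b i)
      exact this.integrable_mul (q := 2)
        (((hφ.continuous_fderiv (by simp)).clm_apply continuous_const).memLp_of_hasCompactSupport
          (hc.fderiv_apply ℝ (b i)))
  simp only [h2]
  rw [Finset.sum_neg_distrib, ← h3, h, h1]

theorem tendsto_integral_mul_mul {f g : ℕ → E → ℝ} {f₀ g₀ θ : E → ℝ}
    (hf : ∀ n, MemLp (f n) 2 volume) (hf₀ : MemLp f₀ 2 volume)
    (hg : ∀ n, MemLp (g n) 2 volume) (hg₀ : MemLp g₀ 2 volume)
    (hfl : Tendsto (fun n => eLpNorm (fun x => f n x - f₀ x) 2 volume) atTop (𝓝 0))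
    (hgl : Tendsto (fun n => eLpNorm (fun x => g n x - g₀ x) 2 volume) atTop (𝓝 0))
    (hθ : Continuous θ) {C : ℝ} (hC : ∀ x, ‖θ x‖ ≤ C) :
    Tendsto (fun n => ∫ x, θ x * (f n x * g n x)) atTop (𝓝 (∫ x, θ x * (f₀ x * g₀ x))) := by
  have hbd : ∀ u : E → ℝ, MemLp u 2 volume → MemLp (fun x => θ x * u x) 2 volume := by
    intro u hu
    refine (hu.const_mul C).mono (hθ.aestronglyMeasurable.mul hu.1) (Eventually.of_forall fun x => ?_)
    rw [norm_mul, norm_mul]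
    gcongr
    exact (hC x).trans (le_abs_self _)
  have e : ∀ (u w : E → ℝ) (hu : MemLp u 2 volume) (hw : MemLp w 2 volume),
      ∫ x, θ x * (u x * w x) = inner ℝ ((hbd u hu).toLp _) (hw.toLp _) := by
    intro u w hu hw
    rw [L2.inner_def]
    apply integral_congr_ae
    filter_upwards [(hbd u hu).coeFn_toLp, hw.coeFn_toLp] with x h1 h2
    rw [h1, h2]
    simp
    ring
  have t1 : Tendsto (fun n => (hbd _ (hf n)).toLp _) atTop (𝓝 ((hbd _ hf₀).toLp _)) := by
    rw [Lp.tendsto_Lp_iff_tendsto_eLpNorm'']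
    have hl := ENNReal.Tendsto.const_mul (a := ‖C‖ₑ) hfl (Or.inr (by simp))
    rw [mul_zero] at hl
    refine tendsto_of_tendsto_of_tendsto_of_le_of_le tendsto_const_nhds hl (fun _ => zero_le)
      fun n => ?_
    have := eLpNorm_const_smul C (fun x => f n x - f₀ x) 2 (volume : Measure E)
    rw [← this]
    apply eLpNorm_mono
    intro x
    simp only [Pi.sub_apply, Pi.smul_apply, smul_eq_mul, norm_mul, ← mul_sub]
    gcongr
    exact (hC x).trans (le_abs_self _)
  have t2 : Tendsto (fun n => (hg n).toLp _) atTop (𝓝 (hg₀.toLp _)) := by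
    rw [Lp.tendsto_Lp_iff_tendsto_eLpNorm'']
    exact hgl
  have := t1.inner (𝕜 := ℝ) t2
  rw [e _ _ hf₀ hg₀]
  exact this.congr fun n => (e _ _ (hf n) (hg n)).symm

/-- The local Pohozaev identity with a compactly supported vector field. -/
theorem pohozaev_vectorField (hn : 2 < Module.finrank ℝ E) {ι : Type*} [Fintype ι]
    (b : OrthonormalBasis ι ℝ E) {k K : ℝ → ℝ} (hk : IsGrowth (growthExp E) k)
    (hK : ∀ t, HasDerivAt K (k t) t) (hK0 : K 0 = 0) {v : H1 E}
    (heq : ∀ h : H1 E, inner ℝ (gradL v) (gradL h) = ∫ x, k (fn v x) * fn h x)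
    {X : ι → E → ℝ} (hX : ∀ j, ContDiff ℝ 1 (X j)) (hc : ∀ j, HasCompactSupport (X j)) :
    ∑ j, ∫ x, fderiv ℝ (X j) x (b j) * K (fn v x) =
      -(∑ i, ∑ j, ∫ x, fderiv ℝ (X j) x (b i) * (inner ℝ (grad v x) (b i) * inner ℝ (grad v x) (b j)))
      + 1 / 2 * ∑ i, ∑ j, ∫ x, fderiv ℝ (X j) x (b j) *
        (inner ℝ (grad v x) (b i) * inner ℝ (grad v x) (b i)) := by
  let w : ι → E → ℝ := fun i x => inner ℝ (grad v x) (b i)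
  have hw : ∀ i, MemLp (w i) 2 volume := fun i => (memLp_grad v).inner_const (b i)
  let u : ℕ → E → ℝ := fun n => moll (bumpSeq E n) (fn v)
  let G : ℕ → ι → E → ℝ := fun n i => moll (bumpSeq E n) (w i)
  let F : ℕ → E → ℝ := fun n => moll (bumpSeq E n) fun x => k (fn v x)
  have hkv : MemLp (fun x => k (fn v x)) 2 volume := memLp_nem hn hk v
  have hu : ∀ n, ContDiff ℝ ∞ (u n) := fun n =>
    contDiff_moll _ (MemLp.locallyIntegrable_two (memLp_fn v))
  have hG : ∀ n i, ContDiff ℝ 1 (G n i) := fun n i =>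
    (contDiff_moll _ (MemLp.locallyIntegrable_two (hw i))).of_le (by exact_mod_cast le_top)
  have hG2 : ∀ n i, MemLp (G n i) 2 volume := fun n i => memLp_moll _ (hw i)
  have hdu : ∀ n x i, fderiv ℝ (u n) x (b i) = G n i x := fun n x i => fderiv_moll_fn _ v x (b i)
  -- `G n i` is the `i`-th partial derivative of the smooth function `u n`, so this is the symmetry
  -- of second derivatives.
  have hsymm : ∀ n x i j, fderiv ℝ (G n j) x (b i) = fderiv ℝ (G n i) x (b j) := by
    intro n x i j
    have e : ∀ j, G n j = fun x => fderiv ℝ (u n) x (b j) := fun j => funext fun x => (hdu n x j).symm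
    have hd : Differentiable ℝ (fderiv ℝ (u n)) :=
      ((hu n).fderiv_right (m := 1) one_add_one_le_infty).differentiable (by simp)
    have e2 : ∀ i j, fderiv ℝ (G n j) x (b i) = fderiv ℝ (fderiv ℝ (u n)) x (b i) (b j) := by
      intro i j
      rw [e j, fderiv_clm_apply (hd x) (differentiableAt_const _)]
      simp
    rw [e2, e2]
    have hs : IsSymmSndFDerivAt ℝ (u n) x :=
      (hu n).contDiffAt.isSymmSndFDerivAt (by simpa using two_le_infty)
    exact hs.eq _ _
  have hdiv : ∀ n x, ∑ i, fderiv ℝ (G n i) x (b i) = -F n x := fun n x =>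
    sum_fderiv_moll_eq b (bumpSeq E n) heq x
  have cX : ∀ j y, Continuous fun x => fderiv ℝ (X j) x y := fun j y =>
    ((hX j).continuous_fderiv (by simp)).clm_apply continuous_const
  have cG : ∀ n i y, Continuous fun x => fderiv ℝ (G n i) x y := fun n i y =>
    ((hG n i).continuous_fderiv (by simp)).clm_apply continuous_const
  have sX : ∀ j y, HasCompactSupport fun x => fderiv ℝ (X j) x y := fun j y =>
    (hc j).fderiv_apply ℝ y
  -- The equation is multiplied by `X · ∇u` and integrated by parts twice; after `hsymm`, the term
  -- with second derivatives is half the derivative of `(∂ᵢu)²`.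
  have hA : ∀ n i j, ∫ x, fderiv ℝ (G n i) x (b i) * (X j x * G n j x) =
      -(∫ x, fderiv ℝ (X j) x (b i) * (G n i x * G n j x))
      + 1 / 2 * ∫ x, fderiv ℝ (X j) x (b j) * (G n i x * G n i x) := by
    intro n i j
    have h1 := integral_mul_fderiv_eq_neg (hG n i) ((hX j).mul (hG n j)) (hc j).mul_right (b i)
    have h2 := integral_mul_fderiv_eq_neg ((hG n i).mul (hG n i)) (hX j) (hc j) (b j)
    have d1 : ∀ x, fderiv ℝ (X j * G n j) x (b i)
        = X j x * fderiv ℝ (G n j) x (b i) + G n j x * fderiv ℝ (X j) x (b i) := by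
      intro x
      rw [fderiv_mul ((hX j).differentiable (by simp) x) ((hG n j).differentiable (by simp) x)]
      simp
    have d2 : ∀ x, fderiv ℝ (G n i * G n i) x (b j) = 2 * (G n i x * fderiv ℝ (G n j) x (b i)) := by
      intro x
      rw [fderiv_mul ((hG n i).differentiable (by simp) x) ((hG n i).differentiable (by simp) x),
        hsymm n x i j]
      simp
      ring
    change ∫ x, G n i x * fderiv ℝ (X j * G n j) x (b i) = _ at h1
    change _ = -∫ x, fderiv ℝ (G n i * G n i) x (b j) * X j x at h2
    simp only [d1] at h1
    simp only [d2] at h2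
    have i1 : Integrable (fun x => X j x * (G n i x * fderiv ℝ (G n j) x (b i))) volume :=
      ((hX j).continuous.mul ((hG n i).continuous.mul (cG n j (b i)))).integrable_of_hasCompactSupport
        (hc j).mul_right
    have i2 : Integrable (fun x => fderiv ℝ (X j) x (b i) * (G n i x * G n j x)) volume :=
      ((cX j (b i)).mul ((hG n i).continuous.mul (hG n j).continuous)).integrable_of_hasCompactSupport
        (sX j (b i)).mul_right
    have e1 : ∫ x, G n i x * (X j x * fderiv ℝ (G n j) x (b i) + G n j x * fderiv ℝ (X j) x (b i))
        = (∫ x, X j x * (G n i x * fderiv ℝ (G n j) x (b i)))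
          + ∫ x, fderiv ℝ (X j) x (b i) * (G n i x * G n j x) := by
      rw [← integral_add i1 i2]
      congr 1
      funext x
      ring
    have e2 : ∫ x, 2 * (G n i x * fderiv ℝ (G n j) x (b i)) * X j x
        = 2 * ∫ x, X j x * (G n i x * fderiv ℝ (G n j) x (b i)) := by
      rw [← integral_const_mul]
      congr 1
      funext x
      ring
    have e3 : ∫ x, G n i x * G n i x * fderiv ℝ (X j) x (b j)
        = ∫ x, fderiv ℝ (X j) x (b j) * (G n i x * G n i x) := by
      congr 1
      funext x
      ring
    rw [e1] at h1
    rw [e2] at h2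
    rw [e3] at h2
    change _ = -∫ x, fderiv ℝ (G n i) x (b i) * (X j x * G n j x) at h1
    linarith
  have hB : ∀ n, -∑ j, ∫ x, X j x * (F n x * G n j x) =
      -(∑ i, ∑ j, ∫ x, fderiv ℝ (X j) x (b i) * (G n i x * G n j x))
      + 1 / 2 * ∑ i, ∑ j, ∫ x, fderiv ℝ (X j) x (b j) * (G n i x * G n i x) := by
    intro n
    have e : ∀ j, -∫ x, X j x * (F n x * G n j x)
        = ∑ i, ∫ x, fderiv ℝ (G n i) x (b i) * (X j x * G n j x) := by
      intro j
      rw [← integral_finsetSum, ← integral_neg]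
      · congr 1
        funext x
        rw [← Finset.sum_mul, hdiv]
        ring
      · intro i _
        exact ((cG n i (b i)).mul ((hX j).continuous.mul
          (hG n j).continuous)).integrable_of_hasCompactSupport ((hc j).mul_right).mul_left
    rw [← Finset.sum_neg_distrib]
    simp only [e]
    rw [Finset.sum_comm]
    simp only [hA, Finset.sum_add_distrib, Finset.sum_neg_distrib, Finset.mul_sum]
  have tw : ∀ i, Tendsto (fun n => eLpNorm (fun x => G n i x - w i x) 2 volume) atTop (𝓝 0) :=
    fun i => tendsto_eLpNorm_moll_sub (hw i)
  have tF : Tendsto (fun n => eLpNorm (fun x => F n x - k (fn v x)) 2 volume) atTop (𝓝 0) :=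
    tendsto_eLpNorm_moll_sub hkv
  have bX : ∀ j, ∃ C, ∀ x, ‖X j x‖ ≤ C := fun j =>
    (hX j).continuous.bounded_above_of_compact_support (hc j)
  have bdX : ∀ j y, ∃ C, ∀ x, ‖fderiv ℝ (X j) x y‖ ≤ C := fun j y =>
    (cX j y).bounded_above_of_compact_support (sX j y)
  -- Every integrand is a bounded weight times two factors converging in `L²`, so the regularised
  -- identity survives the limit.
  have hlim : -∑ j, ∫ x, X j x * (k (fn v x) * w j x) =
      -(∑ i, ∑ j, ∫ x, fderiv ℝ (X j) x (b i) * (w i x * w j x))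
      + 1 / 2 * ∑ i, ∑ j, ∫ x, fderiv ℝ (X j) x (b j) * (w i x * w i x) := by
    have l1 : Tendsto (fun n => -∑ j, ∫ x, X j x * (F n x * G n j x)) atTop
        (𝓝 (-∑ j, ∫ x, X j x * (k (fn v x) * w j x))) :=
      (tendsto_finsetSum _ fun j _ => tendsto_integral_mul_mul (fun n => memLp_moll _ hkv) hkv
        (fun n => hG2 n j) (hw j) tF (tw j) (hX j).continuous (bX j).choose_spec).neg
    have l2 : Tendsto (fun n => -(∑ i, ∑ j, ∫ x, fderiv ℝ (X j) x (b i) * (G n i x * G n j x))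
      + 1 / 2 * ∑ i, ∑ j, ∫ x, fderiv ℝ (X j) x (b j) * (G n i x * G n i x)) atTop
      (𝓝 (-(∑ i, ∑ j, ∫ x, fderiv ℝ (X j) x (b i) * (w i x * w j x))
      + 1 / 2 * ∑ i, ∑ j, ∫ x, fderiv ℝ (X j) x (b j) * (w i x * w i x))) := by
      apply Tendsto.add
      · exact (tendsto_finsetSum _ fun i _ => tendsto_finsetSum _ fun j _ =>
          tendsto_integral_mul_mul (fun n => hG2 n i) (hw i) (fun n => hG2 n j) (hw j) (tw i) (tw j)
            (cX j (b i)) (bdX j (b i)).choose_spec).neg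
      · exact (tendsto_finsetSum _ fun i _ => tendsto_finsetSum _ fun j _ =>
          tendsto_integral_mul_mul (fun n => hG2 n i) (hw i) (fun n => hG2 n i) (hw i) (tw i) (tw i)
            (cX j (b j)) (bdX j (b j)).choose_spec).const_mul _
    exact tendsto_nhds_unique l1 (l2.congr fun n => (hB n).symm)
  have hKd : ContDiff ℝ 1 K := by
    rw [contDiff_one_iff_deriv]
    refine ⟨fun t => (hK t).differentiableAt, ?_⟩
    have : deriv K = k := funext fun t => (hK t).deriv
    rw [this]
    exact hk.continuous
  -- The chain rule `∂ⱼ K(v) = k(v) ∂ⱼv` in weak form. The approximation here is `k (u n)`,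
  -- different from the mollified `k(v)` in `F n`; it converges in `L²` because `nem` is continuous.
  have hC : ∀ j, ∫ x, fderiv ℝ (X j) x (b j) * K (fn v x) = -∫ x, X j x * (k (fn v x) * w j x) := by
    intro j
    have hmk : ∀ n, (fun x => k (u n x)) =ᵐ[volume] fun x => k (fn (mollH (bumpSeq E n) v) x) := by
      intro n
      filter_upwards [fn_mollH (bumpSeq E n) v] with x hx
      rw [hx]
    have hku : ∀ n, MemLp (fun x => k (u n x)) 2 volume := fun n =>
      (memLp_congr_ae (hmk n)).2 (memLp_nem hn hk _)
    have tk : Tendsto (fun n => eLpNorm (fun x => k (u n x) - k (fn v x)) 2 volume) atTop (𝓝 0) := by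
      have h := ((continuous_nem hn hk).tendsto v).comp (tendsto_mollH v)
      have h2 := (Lp.tendsto_Lp_iff_tendsto_eLpNorm'' _ (fun n => memLp_nem hn hk _) _
        (memLp_nem hn hk v)).1 h
      refine h2.congr fun n => eLpNorm_congr_ae ?_
      filter_upwards [hmk n] with x hx
      rw [Pi.sub_apply, hx]
    have hid : ∀ n, ∫ x, fderiv ℝ (X j) x (b j) * K (u n x)
        = -∫ x, X j x * (k (u n x) * G n j x) := by
      intro n
      have hu1 : ContDiff ℝ 1 (u n) := (hu n).of_le (by exact_mod_cast le_top)
      have h := integral_mul_fderiv_eq_neg (hKd.comp hu1) (hX j) (hc j) (b j)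
      have d : ∀ x, fderiv ℝ (K ∘ u n) x (b j) = k (u n x) * G n j x := by
        intro x
        have h1 := (hK (u n x)).comp_hasFDerivAt x (hu1.differentiable (by simp) x).hasFDerivAt
        rw [h1.fderiv, ← hdu]
        simp
      simp only [d, Function.comp] at h
      simp only [mul_comm (fderiv ℝ (X j) _ (b j)), h, mul_comm (X j _)]
    have t1 := (tendsto_integral_mul_mul hku hkv (fun n => hG2 n j) (hw j) tk (tw j)
      (hX j).continuous (bX j).choose_spec).neg
    have t2 : Tendsto (fun n => ∫ x, fderiv ℝ (X j) x (b j) * K (u n x)) atTop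
        (𝓝 (∫ x, fderiv ℝ (X j) x (b j) * K (fn v x))) := by
      obtain ⟨C, hC⟩ := bdX j (b j)
      rw [tendsto_iff_norm_sub_tendsto_zero]
      have h0 := (tendsto_integral_abs_primitive_sub hn hk hK hK0 (tendsto_mollH v)).const_mul C
      rw [mul_zero] at h0
      refine squeeze_zero (fun _ => norm_nonneg _) (fun n => ?_) h0
      have hae : (fun x => K (u n x)) =ᵐ[volume] fun x => K (fn (mollH (bumpSeq E n) v) x) := by
        filter_upwards [fn_mollH (bumpSeq E n) v] with x hx
        rw [hx]
      have i1 : Integrable (fun x => K (u n x)) volume :=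
        (integrable_primitive hn hk hK hK0 _).congr hae.symm
      have i2 := integrable_primitive hn hk hK hK0 v
      have m := (cX j (b j)).aestronglyMeasurable (μ := (volume : Measure E))
      rw [← integral_sub (i1.bdd_mul m (Eventually.of_forall hC))
        (i2.bdd_mul m (Eventually.of_forall hC)), ← integral_const_mul]
      refine (norm_integral_le_integral_norm _).trans ?_
      apply integral_mono_of_nonneg (Eventually.of_forall fun _ => norm_nonneg _)
        (((integrable_primitive hn hk hK hK0 _).sub i2).abs.const_mul C)
      filter_upwards [hae] with x hx
      rw [hx, ← mul_sub, norm_mul]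
      exact mul_le_mul_of_nonneg_right (hC x) (norm_nonneg _)
    exact tendsto_nhds_unique t2 (t1.congr fun n => (hid n).symm)
  simp only [hC]
  rw [Finset.sum_neg_distrib]
  exact hlim

/-- The Pohozaev identity for weak solutions of `-Δv = k(v)` in `H¹`. -/
theorem pohozaev (hn : 2 < Module.finrank ℝ E) {k K : ℝ → ℝ} (hk : IsGrowth (growthExp E) k)
    (hK : ∀ t, HasDerivAt K (k t) t) (hK0 : K 0 = 0) {v : H1 E}
    (heq : ∀ h : H1 E, inner ℝ (gradL v) (gradL h) = ∫ x, k (fn v x) * fn h x) :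
    (Module.finrank ℝ E : ℝ) * ∫ x, K (fn v x) =
      ((Module.finrank ℝ E : ℝ) / 2 - 1) * ‖gradL v‖ ^ 2 := by
  let b := stdOrthonormalBasis ℝ E
  set N := Module.finrank ℝ E
  let r : ℕ → ℝ := fun m => 1 / ((m : ℝ) + 1)
  have hr : ∀ m, 0 < r m := fun m => by positivity
  have tr : Tendsto r atTop (𝓝 0) := tendsto_one_div_add_atTop_nhds_zero_nat
  -- The generator of dilations, cut off. Its rescaling `X m` keeps the same bound on first
  -- derivatives, while these tend pointwise to those of the identity field.
  let Y : Fin N → E → ℝ := fun j x => cutoff E x * inner ℝ x (b j)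
  have hχ : ContDiff ℝ 1 (cutoff E : E → ℝ) := (cutoff E).contDiff
  have hY : ∀ j, ContDiff ℝ 1 (Y j) := fun j => hχ.mul (contDiff_id.inner ℝ contDiff_const)
  have hYc : ∀ j, HasCompactSupport (Y j) := fun j => (cutoff E).hasCompactSupport.mul_right
  have cY : ∀ j y, Continuous fun x => fderiv ℝ (Y j) x y := fun j y =>
    ((hY j).continuous_fderiv (by simp)).clm_apply continuous_const
  have bY : ∀ j y, ∃ C, ∀ x, ‖fderiv ℝ (Y j) x y‖ ≤ C := fun j y =>
    (cY j y).bounded_above_of_compact_support ((hYc j).fderiv_apply ℝ y)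
  have hY0 : ∀ i j, fderiv ℝ (Y j) 0 (b i) = if i = j then 1 else 0 := by
    intro i j
    have h1 := (hχ.differentiable (by simp) 0).hasFDerivAt.mul
      ((hasFDerivAt_id (0 : E)).inner ℝ (hasFDerivAt_const (b j) (0 : E)))
    have h2 : fderiv ℝ (Y j) 0 = _ := h1.fderiv
    rw [h2]
    simp [(cutoff E).one_of_mem_closedBall (x := 0) (by simp [(cutoff E).rIn_pos.le]),
      orthonormal_iff_ite.1 b.orthonormal]
  let X : ℕ → Fin N → E → ℝ := fun m j x => (r m)⁻¹ * Y j (r m • x)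
  have hX : ∀ m j, ContDiff ℝ 1 (X m j) := fun m j =>
    contDiff_const.mul ((hY j).comp (contDiff_const_smul _))
  have hXc : ∀ m j, HasCompactSupport (X m j) := fun m j =>
    ((hYc j).comp_smul (hr m).ne').mul_left
  have hdX : ∀ m j x y, fderiv ℝ (X m j) x y = fderiv ℝ (Y j) (r m • x) y := by
    intro m j x y
    have h1 := (((hY j).differentiable (by simp) (r m • x)).hasFDerivAt.comp x
      ((hasFDerivAt_id x).const_smul (r m))).const_mul (r m)⁻¹
    have h2 : fderiv ℝ (X m j) x = _ := h1.fderiv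
    rw [h2]
    simp [(hr m).ne']
  have lim : ∀ (i j : Fin N) (Q : E → ℝ), Integrable Q volume →
      Tendsto (fun m => ∫ x, fderiv ℝ (X m j) x (b i) * Q x) atTop
        (𝓝 ((if i = j then 1 else 0) * ∫ x, Q x)) := by
    intro i j Q hQ
    obtain ⟨C, hC⟩ := bY j (b i)
    rw [← integral_const_mul]
    refine tendsto_integral_of_dominated_convergence (fun x => C * ‖Q x‖) (fun m => ?_)
      (hQ.norm.const_mul C) (fun m => Eventually.of_forall fun x => ?_)
      (Eventually.of_forall fun x => ?_)
    · exact (((hX m j).continuous_fderiv (by simp)).clm_apply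
        continuous_const).aestronglyMeasurable.mul hQ.1
    · rw [hdX, norm_mul]
      exact mul_le_mul_of_nonneg_right (hC _) (norm_nonneg _)
    · simp only [hdX]
      apply Tendsto.mul_const
      have h1 : Tendsto (fun m => r m • x) atTop (𝓝 0) := by
        simpa using tr.smul_const x
      have h2 := ((cY j (b i)).tendsto 0).comp h1
      rw [hY0] at h2
      exact h2
  have hid := fun m => pohozaev_vectorField hn b hk hK hK0 heq (hX m) (hXc m)
  have iw : ∀ i j, Integrable (fun x => inner ℝ (grad v x) (b i) * inner ℝ (grad v x) (b j)) volume :=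
    fun i j => ((memLp_grad v).inner_const (b i)).integrable_mul ((memLp_grad v).inner_const (b j))
  have l1 := tendsto_finsetSum (Finset.univ : Finset (Fin N)) fun j _ =>
    lim j j _ (integrable_primitive hn hk hK hK0 v)
  have l2 := (tendsto_finsetSum (Finset.univ : Finset (Fin N)) fun i _ =>
    tendsto_finsetSum (Finset.univ : Finset (Fin N)) fun j _ => lim i j _ (iw i j)).neg.add
    ((tendsto_finsetSum (Finset.univ : Finset (Fin N)) fun i _ =>
    tendsto_finsetSum (Finset.univ : Finset (Fin N)) fun j _ => lim j j _ (iw i i)).const_mul (1 / 2))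
  -- With `∂ᵢXⱼ = δᵢⱼ` in the limit, the left side becomes `N ∫ K(v)` and the right side `-‖∇v‖² +
  -- (N/2) ‖∇v‖²`.
  have huniq := tendsto_nhds_unique l1 (l2.congr fun m => (hid m).symm)
  have hsum : ∑ i, ∫ x, inner ℝ (grad v x) (b i) * inner ℝ (grad v x) (b i) = ‖gradL v‖ ^ 2 := by
    rw [norm_sq_gradL, ← integral_finsetSum _ fun i _ => iw i i]
    congr 1
    funext x
    rw [← real_inner_self_eq_norm_sq, ← b.sum_inner_mul_inner]
    simp only [real_inner_comm (b _)]
  simp only [if_true, one_mul, Finset.sum_const, Finset.card_univ, Fintype.card_fin, ite_mul,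
    zero_mul, Finset.sum_ite_eq, Finset.mem_univ, nsmul_eq_mul, ← Finset.mul_sum, hsum] at huniq
  linarith

end Pohozaev

/-! ### Symmetries acting on `H¹` -/

section Symmetry

variable {E : Type*} [NormedAddCommGroup E] [InnerProductSpace ℝ E] [FiniteDimensional ℝ E]
  [MeasurableSpace E] [BorelSpace E]

/-- The weak gradient is determined by the function, so symmetries required of the function alone
hold in `H¹`. -/
theorem fnL_injective : Function.Injective (fnL : H1 E → Lp ℝ 2 (volume : Measure E)) := by
  rw [injective_iff_map_eq_zero]
  intro v hv
  have h0 : ∀ᵐ x, fn v x = 0 := by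
    have := Lp.coeFn_zero ℝ 2 (volume : Measure E)
    rw [← hv] at this
    filter_upwards [this] with x hx
    exact hx
  have hg : ∀ᵐ x, grad v x = 0 := by
    apply ae_eq_zero_of_integral_contDiff_smul_eq_zero
      (MemLp.locallyIntegrable_two (memLp_grad v))
    intro φ hφ hc
    have hint : Integrable (fun x => φ x • grad v x) volume :=
      (MemLp.locallyIntegrable_two (memLp_grad v)).integrable_smul_left_of_hasCompactSupport
        hφ.continuous hc
    refine ext_inner_left ℝ fun y => ?_
    rw [inner_zero_right, ← integral_inner hint]
    have h := isWeakGradient_fn_grad v φ hφ hc y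
    have h1 : ∫ x, fn v x * fderiv ℝ φ x y = 0 := by
      apply integral_eq_zero_of_ae
      filter_upwards [h0] with x hx
      simp [hx]
    rw [h1, eq_comm, neg_eq_zero] at h
    rw [← h]
    congr 1
    funext x
    rw [inner_smul_right, real_inner_comm, mul_comm]
  have h2 : gradL v = 0 := by
    apply Lp.ext
    filter_upwards [hg, Lp.coeFn_zero E 2 (volume : Measure E)] with x h1 h2
    rw [coe_gradL, h1, h2]
    rfl
  have h3 : ‖v‖ ^ 2 = 0 := by
    rw [norm_sq_H1, hv, h2]
    simp
  simpa using h3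

theorem measurableEmbedding_isometry (L : E ≃ₗᵢ[ℝ] E) : MeasurableEmbedding L :=
  L.toHomeomorph.measurableEmbedding

theorem integral_comp_isometry {G : Type*} [NormedAddCommGroup G] [NormedSpace ℝ G]
    (L : E ≃ₗᵢ[ℝ] E) (h : E → G) : ∫ x, h (L x) = ∫ x, h x :=
  L.measurePreserving.integral_comp (measurableEmbedding_isometry L) h

theorem IsWeakGradient.comp_isometry {u : E → ℝ} {g : E → E} (h : IsWeakGradient u g)
    (L : E ≃ₗᵢ[ℝ] E) : IsWeakGradient (fun x => u (L x)) (fun x => L.symm (g (L x))) := by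
  intro φ hφ hc y
  have hψ : ContDiff ℝ ∞ fun z => φ (L.symm z) :=
    hφ.comp L.symm.toContinuousLinearEquiv.contDiff
  have hψc : HasCompactSupport fun z => φ (L.symm z) := hc.comp_homeomorph L.symm.toHomeomorph
  have hd : ∀ z, fderiv ℝ (fun z => φ (L.symm z)) z (L y) = fderiv ℝ φ (L.symm z) y := by
    intro z
    have h1 := (hφ.differentiable (by simp) (L.symm z)).hasFDerivAt.comp z
      L.symm.toContinuousLinearEquiv.hasFDerivAt
    have h2 : fderiv ℝ (fun z => φ (L.symm z)) z = _ := h1.fderiv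
    rw [h2]
    simp
  have key := h _ hψ hψc (L y)
  rw [← integral_comp_isometry L, ← integral_comp_isometry L (fun x => inner ℝ (g x) (L y) * _)] at key
  simp only [hd, L.symm_apply_apply] at key
  rw [key]
  congr 2
  funext x
  rw [← L.inner_map_map (L.symm (g (L x))), L.apply_symm_apply]

theorem memLp_comp_isometry {G : Type*} [NormedAddCommGroup G] {h : E → G} (hh : MemLp h 2 volume)
    (L : E ≃ₗᵢ[ℝ] E) : MemLp (fun x => h (L x)) 2 volume :=
  hh.comp_measurePreserving L.measurePreserving

/-- Composition of an element of `H¹` with a linear isometry. -/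
noncomputable def compH (L : E ≃ₗᵢ[ℝ] E) (v : H1 E) : H1 E :=
  H1.ofWeakGradient (memLp_comp_isometry (memLp_fn v) L)
    ((L.symm.toContinuousLinearEquiv : E →L[ℝ] E).comp_memLp'
      (memLp_comp_isometry (memLp_grad v) L))
    ((isWeakGradient_fn_grad v).comp_isometry L)

theorem fn_compH (L : E ≃ₗᵢ[ℝ] E) (v : H1 E) : fn (compH L v) =ᵐ[volume] fun x => fn v (L x) :=
  fn_ofWeakGradient _ _ _

theorem grad_compH (L : E ≃ₗᵢ[ℝ] E) (v : H1 E) :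
    grad (compH L v) =ᵐ[volume] fun x => L.symm (grad v (L x)) := grad_ofWeakGradient _ _ _

theorem integral_mul_fn_compH (L : E ≃ₗᵢ[ℝ] E) (F : E → ℝ) (h : H1 E) :
    ∫ x, F (L x) * fn (compH L h) x = ∫ x, F x * fn h x := by
  rw [← integral_comp_isometry L (fun x => F x * fn h x)]
  apply integral_congr_ae
  filter_upwards [fn_compH L h] with x hx
  rw [hx]

theorem inner_gradL_compH (L : E ≃ₗᵢ[ℝ] E) (v h : H1 E) :
    inner ℝ (gradL (compH L v)) (gradL (compH L h)) = inner ℝ (gradL v) (gradL h) := by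
  rw [inner_gradL, inner_gradL, ← integral_comp_isometry L fun x => inner ℝ (grad v x) (grad h x)]
  apply integral_congr_ae
  filter_upwards [grad_compH L v, grad_compH L h] with x h1 h2
  rw [h1, h2, L.symm.inner_map_map]

theorem inner_fnL (v h : H1 E) : inner ℝ (fnL v) (fnL h) = ∫ x, fn v x * fn h x := by
  rw [L2.inner_def]
  congr 1
  funext x
  simp [coe_fnL, mul_comm]

theorem inner_compH (L : E ≃ₗᵢ[ℝ] E) (v h : H1 E) :
    inner ℝ (compH L v) (compH L h) = inner ℝ v h := by
  rw [inner_H1, inner_H1, inner_gradL_compH, inner_fnL, inner_fnL,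
    ← integral_mul_fn_compH L (fn v) h]
  congr 1
  apply integral_congr_ae
  filter_upwards [fn_compH L v] with x h1
  rw [h1]

theorem H1.ext_fn {v w : H1 E} (h : fn v =ᵐ[volume] fn w) : v = w :=
  fnL_injective (Lp.ext h)

/-- The elements `v` of `H¹` with `v(L x) = ε v(x)` for all `(L, ε)` in a given family. -/
def symSub (𝒢 : Set ((E ≃ₗᵢ[ℝ] E) × ℝ)) : Submodule ℝ (H1 E) where
  carrier := {v | ∀ g ∈ 𝒢, ∀ᵐ x, fn v (g.1 x) = g.2 * fn v x}
  zero_mem' := by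
    intro g _
    have h0 : ∀ᵐ x, fn (0 : H1 E) x = 0 := by
      have h := Lp.coeFn_zero ℝ 2 (volume : Measure E)
      rw [← map_zero (fnL (E := E))] at h
      exact h
    filter_upwards [h0, g.1.measurePreserving.quasiMeasurePreserving.ae h0] with x h1 h2
    rw [h1, h2, mul_zero]
  add_mem' := by
    intro v w hv hw g hg
    filter_upwards [hv g hg, hw g hg, fn_add v w,
      g.1.measurePreserving.quasiMeasurePreserving.ae (fn_add v w)] with x h1 h2 h3 h4
    rw [h3, h4, h1, h2, mul_add]
  smul_mem' := by
    intro c v hv g hg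
    filter_upwards [hv g hg, fn_smul c v,
      g.1.measurePreserving.quasiMeasurePreserving.ae (fn_smul c v)] with x h1 h2 h3
    rw [h2, h3, h1]
    ring

theorem mem_symSub_iff {𝒢 : Set ((E ≃ₗᵢ[ℝ] E) × ℝ)} {v : H1 E} :
    v ∈ symSub 𝒢 ↔ ∀ g ∈ 𝒢, ∀ᵐ x, fn v (g.1 x) = g.2 * fn v x := Iff.rfl

theorem mem_symSub_iff_compH {𝒢 : Set ((E ≃ₗᵢ[ℝ] E) × ℝ)} {v : H1 E} :
    v ∈ symSub 𝒢 ↔ ∀ g ∈ 𝒢, compH g.1 v = g.2 • v := by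
  rw [mem_symSub_iff]
  refine forall₂_congr fun g _ => ⟨fun h => ?_, fun h => ?_⟩
  · apply H1.ext_fn
    filter_upwards [h, fn_compH g.1 v, fn_smul g.2 v] with x h1 h2 h3
    rw [h2, h3, h1]
  · have h0 := fn_compH g.1 v
    rw [h] at h0
    filter_upwards [h0, fn_smul g.2 v] with x h1 h2
    rw [← h1, h2]

theorem norm_fnL_compH_sub (L : E ≃ₗᵢ[ℝ] E) (v w : H1 E) :
    ‖fnL (compH L v) - fnL (compH L w)‖ = ‖fnL v - fnL w‖ := by
  rw [← map_sub, ← map_sub, norm_fnL_eq, norm_fnL_eq]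
  congr 1
  have h := eLpNorm_comp_measurePreserving (p := 2) (memLp_fn (v - w)).1 L.measurePreserving
  rw [← h]
  apply eLpNorm_congr_ae
  filter_upwards [fn_sub (compH L v) (compH L w), fn_compH L v, fn_compH L w,
    L.measurePreserving.quasiMeasurePreserving.ae (fn_sub v w)] with x h1 h2 h3 h4
  rw [h1, h2, h3, Function.comp, h4]

theorem isClosed_symSub (𝒢 : Set ((E ≃ₗᵢ[ℝ] E) × ℝ)) : IsClosed (symSub 𝒢 : Set (H1 E)) := by
  have key : (symSub 𝒢 : Set (H1 E)) =
      ⋂ g ∈ 𝒢, {v | fnL (compH g.1 v) = g.2 • fnL v} := by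
    ext v
    simp only [mem_iInter, mem_ofPred_eq, SetLike.mem_coe, mem_symSub_iff_compH, ← map_smul,
      fnL_injective.eq_iff]
  rw [key]
  refine isClosed_biInter fun g _ => isClosed_eq ?_ ((g.2 • fnL (E := E)).continuous)
  have : LipschitzWith 1 fun v => fnL (compH g.1 v) := by
    apply LipschitzWith.of_dist_le_mul
    intro v w
    rw [dist_eq_norm, dist_eq_norm, norm_fnL_compH_sub, ← map_sub]
    simpa using norm_fnL_le (v - w)
  exact this.continuous

/-- The principle of symmetric criticality: a weak equation that holds against symmetric test
functions holds against all test functions. -/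
theorem symmetric_criticality (hn : 2 < Module.finrank ℝ E) {𝒢 : Set ((E ≃ₗᵢ[ℝ] E) × ℝ)}
    (h𝒢 : ∀ g ∈ 𝒢, g.2 ^ 2 = 1) {k : ℝ → ℝ} (hk : IsGrowth (growthExp E) k)
    (hodd : ∀ t, k (-t) = -k t) {v : H1 E} (hv : v ∈ symSub 𝒢)
    (heq : ∀ h ∈ symSub 𝒢, inner ℝ (gradL v) (gradL h) = ∫ x, k (fn v x) * fn h x) (h : H1 E) :
    inner ℝ (gradL v) (gradL h) = ∫ x, k (fn v x) * fn h x := by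
  let J : H1 E →L[ℝ] ℝ := (innerSL ℝ (gradL v)).comp gradL - (innerSL ℝ (nem hn hk v)).comp fnL
  have hJ : ∀ h, J h = inner ℝ (gradL v) (gradL h) - ∫ x, k (fn v x) * fn h x := by
    intro h
    simp [J, inner_nem]
  -- The Riesz representative of the defect of the equation inherits the symmetry of `J`, since the
  -- group acts by isometries. The defect vanishes on symmetric elements, in particular at `w`, so
  -- `‖w‖² = J w = 0`.
  let w : H1 E := (InnerProductSpace.toDual ℝ (H1 E)).symm J
  have hw : ∀ h, inner ℝ w h = J h := fun h => InnerProductSpace.toDual_symm_apply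
  have hinv : ∀ g ∈ 𝒢, ∀ h, J (compH g.1 h) = g.2 * J h := by
    intro g hg h
    have hε := h𝒢 g hg
    have hε2 : g.2 = 1 ∨ g.2 = -1 := mul_self_eq_one_iff.1 (by rw [← sq]; exact hε)
    have e1 : inner ℝ (gradL v) (gradL (compH g.1 h)) = g.2 * inner ℝ (gradL v) (gradL h) := by
      have h1 := inner_gradL_compH g.1 v h
      rw [mem_symSub_iff_compH.1 hv g hg, map_smul, real_inner_smul_left] at h1
      rw [← h1, ← mul_assoc, ← sq, hε, one_mul]
    have e2 : ∫ x, k (fn v x) * fn (compH g.1 h) x = g.2 * ∫ x, k (fn v x) * fn h x := by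
      have h1 := integral_mul_fn_compH g.1 (fun x => k (fn v x)) h
      rw [← h1, ← integral_const_mul]
      apply integral_congr_ae
      filter_upwards [hv g hg] with x hx
      rw [hx]
      rcases hε2 with h | h
      · simp [h]
      · simp [h, hodd]
    rw [hJ, hJ, e1, e2]
    ring
  have hwmem : w ∈ symSub 𝒢 := by
    rw [mem_symSub_iff_compH]
    intro g hg
    have hε := h𝒢 g hg
    have e : ∀ h, inner ℝ (compH g.1 w) h = inner ℝ (g.2 • w) h := by
      intro h
      have hsurj : compH g.1 (compH g.1.symm h) = h := by
        apply H1.ext_fn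
        filter_upwards [fn_compH g.1 (compH g.1.symm h),
          g.1.measurePreserving.quasiMeasurePreserving.ae (fn_compH g.1.symm h)] with x h1 h2
        rw [h1, h2, g.1.symm_apply_apply]
      have h3 := hinv g hg (compH g.1.symm h)
      rw [hsurj] at h3
      calc inner ℝ (compH g.1 w) h = inner ℝ (compH g.1 w) (compH g.1 (compH g.1.symm h)) := by
            rw [hsurj]
        _ = J (compH g.1.symm h) := by rw [inner_compH, hw]
        _ = g.2 * J h := by rw [h3, ← mul_assoc, ← sq, hε, one_mul]
        _ = inner ℝ (g.2 • w) h := by rw [← hw]; exact (real_inner_smul_left w h g.2).symm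
    exact ext_inner_right ℝ e
  have hw0 : w = 0 := by
    have h1 := hw w
    rw [hJ, heq w hwmem, sub_self] at h1
    exact inner_self_eq_zero.1 h1
  have h2 := hw h
  rw [hw0, inner_zero_left, hJ] at h2
  linarith

/-! ### Compactness -/

/-- The critical power appearing in the interpolation inequality. -/
noncomputable def critExp (E : Type*) [NormedAddCommGroup E] [InnerProductSpace ℝ E] : ℝ :=
  2 + 2 * growthExp E

theorem abs_rpow_critExp (hn : 2 < Module.finrank ℝ E) (t : ℝ) :
    |t| ^ critExp E = (t ^ 2) ^ growthExp E * t ^ 2 := by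
  have hr := growthExp_pos hn
  rcases eq_or_ne t 0 with rfl | ht
  · rw [abs_zero, Real.zero_rpow (by unfold critExp; positivity)]
    simp
  · have h0 : 0 < |t| := abs_pos.2 ht
    rw [critExp, Real.rpow_add h0, Real.rpow_mul h0.le, mul_comm]
    norm_cast
    rw [sq_abs]

theorem integral_critExp_le (hn : 2 < Module.finrank ℝ E) (v : H1 E) :
    Integrable (fun x => |fn v x| ^ critExp E) volume ∧
      ∫ x, |fn v x| ^ critExp E ≤
        sobConst E * (‖fnL v‖ ^ 2) ^ growthExp E * ‖gradL v‖ ^ 2 := by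
  have h := integral_rpow_mul_sq_le hn v (fun x => sq_nonneg (fn v x)) (integrable_sq_fn v)
  simp only [abs_rpow_critExp hn]
  rw [norm_sq_fnL]
  exact h

/-- Every orbit of a far point contains many points that are far from each other. -/
def HasSpreadOrbits (𝒢 : Set ((E ≃ₗᵢ[ℝ] E) × ℝ)) : Prop :=
  ∀ δ : ℝ, 0 < δ → ∀ K : ℕ, ∃ R : ℝ, ∀ x : E, R ≤ ‖x‖ → ∃ L : Fin K → (E ≃ₗᵢ[ℝ] E),
    (∀ j, (L j, 1) ∈ 𝒢) ∧ ∀ i j, i ≠ j → 2 * δ ≤ dist (L i x) (L j x)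

/-- The balls around the `K` points of the orbit are disjoint and, by invariance, carry the same
mass. -/
theorem lintegral_ball_le_of_spread {𝒢 : Set ((E ≃ₗᵢ[ℝ] E) × ℝ)} {w : H1 E} (hw : w ∈ symSub 𝒢)
    {δ : ℝ} {K : ℕ} {x : E} {L : Fin K → (E ≃ₗᵢ[ℝ] E)} (hL : ∀ j, (L j, 1) ∈ 𝒢)
    (hd : ∀ i j, i ≠ j → 2 * δ ≤ dist (L i x) (L j x)) :
    (K : ℝ≥0∞) * ∫⁻ y in Metric.ball x δ, ‖fn w y‖ₑ ^ (2 : ℝ) ≤ ∫⁻ y, ‖fn w y‖ₑ ^ (2 : ℝ) := by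
  have h1 : ∀ j, ∫⁻ y in Metric.ball (L j x) δ, ‖fn w y‖ₑ ^ (2 : ℝ)
      = ∫⁻ y in Metric.ball x δ, ‖fn w y‖ₑ ^ (2 : ℝ) := by
    intro j
    rw [← (L j).measurePreserving.setLIntegral_comp_preimage_emb
      (measurableEmbedding_isometry (L j))]
    have hpre : (L j) ⁻¹' Metric.ball (L j x) δ = Metric.ball x δ := by
      rw [(L j).preimage_ball, (L j).symm_apply_apply]
    rw [hpre]
    apply lintegral_congr_ae
    apply ae_restrict_of_ae
    filter_upwards [hw _ (hL j)] with y hy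
    rw [hy, one_mul]
  have hdisj : Pairwise (Function.onFun Disjoint fun j => Metric.ball (L j x) δ) := by
    intro i j hij
    exact Metric.ball_disjoint_ball (by linarith [hd i j hij])
  calc (K : ℝ≥0∞) * ∫⁻ y in Metric.ball x δ, ‖fn w y‖ₑ ^ (2 : ℝ)
      = ∑ j, ∫⁻ y in Metric.ball (L j x) δ, ‖fn w y‖ₑ ^ (2 : ℝ) := by
        rw [Finset.sum_congr rfl fun j _ => h1 j]
        simp
    _ = ∫⁻ y in ⋃ j, Metric.ball (L j x) δ, ‖fn w y‖ₑ ^ (2 : ℝ) := by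
        rw [lintegral_iUnion (fun _ => Metric.isOpen_ball.measurableSet) hdisj, tsum_fintype]
    _ ≤ _ := setLIntegral_le_lintegral _ _

theorem lintegral_enorm_sq_eq (w : H1 E) :
    ∫⁻ y, ‖fn w y‖ₑ ^ (2 : ℝ) = ENNReal.ofReal (‖fnL w‖ ^ 2) := by
  rw [← eLpNorm_two_rpow_two, norm_fnL_eq, ENNReal.ofReal_pow ENNReal.toReal_nonneg,
    ENNReal.ofReal_toReal (memLp_fn w).2.ne]
  norm_cast

/-- Mollifications of symmetric functions decay uniformly at infinity. -/
theorem exists_moll_sq_le_of_spread {𝒢 : Set ((E ≃ₗᵢ[ℝ] E) × ℝ)} (h𝒢 : HasSpreadOrbits 𝒢)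
    (ρ : ContDiffBump (0 : E)) {M η : ℝ} (hη : 0 < η) :
    ∃ R : ℝ, ∀ w ∈ symSub 𝒢, ‖w‖ ≤ M → ∀ x : E, R ≤ ‖x‖ → moll ρ (fn w) x ^ 2 ≤ η := by
  obtain ⟨C, hC, hmoll⟩ := exists_enorm_moll_le (G := ℝ) ρ
  -- The squared mollification is at most `C` times the mass of a ball, and that mass is at most `M²
  -- / K`.
  obtain ⟨K, hK⟩ := exists_nat_gt (C.toReal * M ^ 2 / η)
  have hK0 : 0 < (K : ℝ) := lt_of_le_of_lt (by positivity) hK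
  obtain ⟨R, hR⟩ := h𝒢 ρ.rOut ρ.rOut_pos K
  refine ⟨R, fun w hw hwM x hx => ?_⟩
  obtain ⟨L, hL, hd⟩ := hR x hx
  have h1 := lintegral_ball_le_of_spread hw hL hd
  rw [lintegral_enorm_sq_eq] at h1
  have h2 := hmoll (fn w) (memLp_fn w) x
  have h3 : (K : ℝ≥0∞) * ‖moll ρ (fn w) x‖ₑ ^ (2 : ℝ) ≤ C * ENNReal.ofReal (M ^ 2) := by
    calc (K : ℝ≥0∞) * ‖moll ρ (fn w) x‖ₑ ^ (2 : ℝ)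
        ≤ K * (C * ∫⁻ y in Metric.ball x ρ.rOut, ‖fn w y‖ₑ ^ (2 : ℝ)) := by gcongr
      _ = C * (K * ∫⁻ y in Metric.ball x ρ.rOut, ‖fn w y‖ₑ ^ (2 : ℝ)) := by ring
      _ ≤ C * ENNReal.ofReal (‖fnL w‖ ^ 2) := by gcongr
      _ ≤ _ := by
          gcongr
          exact (norm_fnL_le w).trans hwM
  have h4 := ENNReal.toReal_mono (ENNReal.mul_ne_top hC ENNReal.ofReal_ne_top) h3
  rw [ENNReal.toReal_mul, ENNReal.toReal_mul, ENNReal.toReal_ofReal (by positivity),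
    ← ENNReal.toReal_rpow, ENNReal.toReal_natCast, toReal_enorm, Real.norm_eq_abs, Real.rpow_two,
    sq_abs] at h4
  rw [div_lt_iff₀ hη] at hK
  by_contra hcon
  push Not at hcon
  nlinarith

theorem abs_add_rpow_le {q : ℝ} (hq : 0 ≤ q) (a b : ℝ) :
    |a + b| ^ q ≤ 2 ^ q * (|a| ^ q + |b| ^ q) := by
  have ha : 0 ≤ |a| ^ q := by positivity
  have hb : 0 ≤ |b| ^ q := by positivity
  have h2 : (0 : ℝ) ≤ 2 ^ q := by positivity
  rcases le_total |a| |b| with h | h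
  · have h1 : |a + b| ≤ 2 * |b| := (abs_add_le a b).trans (by linarith)
    have := Real.rpow_le_rpow (abs_nonneg _) h1 hq
    rw [Real.mul_rpow (by norm_num) (abs_nonneg _)] at this
    nlinarith
  · have h1 : |a + b| ≤ 2 * |a| := (abs_add_le a b).trans (by linarith)
    have := Real.rpow_le_rpow (abs_nonneg _) h1 hq
    rw [Real.mul_rpow (by norm_num) (abs_nonneg _)] at this
    nlinarith

/-- The value of a mollification at a fixed point is a continuous linear functional on `H¹`. -/
theorem moll_tendsto_of_weak (ρ : ContDiffBump (0 : E)) {w : ℕ → H1 E}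
    (hw : ∀ ℓ : H1 E →L[ℝ] ℝ, Tendsto (fun n => ℓ (w n)) atTop (𝓝 0)) (x : E) :
    Tendsto (fun n => moll ρ (fn (w n)) x) atTop (𝓝 0) := by
  have hm : MemLp (fun s => ρ.normed (volume : Measure E) (x - s)) 2 volume :=
    (ρ.continuous_normed.comp (continuous_const.sub continuous_id)).memLp_of_hasCompactSupport
      (hasCompactSupport_comp_sub_left ρ.hasCompactSupport_normed x)
  refine (hw ((innerSL ℝ (hm.toLp _)).comp fnL)).congr fun n => ?_
  rw [ContinuousLinearMap.comp_apply, innerSL_apply_apply, real_inner_comm, inner_fnL_toLp,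
    moll_apply_swap]
  congr 1
  funext s
  rw [smul_eq_mul, mul_comm]

/-- Inside a large ball the mollifications are uniformly bounded and tend to zero pointwise, so
dominated convergence applies. Outside, their uniform decay makes the integral small for all `n` at
once. -/
theorem tendsto_integral_moll_critExp (hn : 2 < Module.finrank ℝ E)
    {𝒢 : Set ((E ≃ₗᵢ[ℝ] E) × ℝ)} (h𝒢 : HasSpreadOrbits 𝒢) (ρ : ContDiffBump (0 : E))
    {w : ℕ → H1 E} {M : ℝ} (hws : ∀ n, w n ∈ symSub 𝒢) (hM : ∀ n, ‖w n‖ ≤ M)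
    (hw : ∀ ℓ : H1 E →L[ℝ] ℝ, Tendsto (fun n => ℓ (w n)) atTop (𝓝 0)) :
    Tendsto (fun n => ∫ x, |moll ρ (fn (w n)) x| ^ critExp E) atTop (𝓝 0) := by
  have hr := growthExp_pos hn
  have hq : 0 < critExp E := by
    unfold critExp
    positivity
  have hM0 : 0 ≤ M := (norm_nonneg _).trans (hM 0)
  have hae : ∀ n, fn (mollH ρ (w n)) =ᵐ[volume] moll ρ (fn (w n)) := fun n => fn_mollH ρ (w n)
  have hint : ∀ n, Integrable (fun x => |moll ρ (fn (w n)) x| ^ critExp E) volume := by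
    intro n
    refine (integral_critExp_le hn (mollH ρ (w n))).1.congr ?_
    filter_upwards [hae n] with x hx
    rw [hx]
  have hcont : ∀ n, Continuous (moll ρ (fn (w n))) := fun n =>
    continuous_moll ρ (MemLp.locallyIntegrable_two (memLp_fn (w n)))
  have hbdd : ∃ B : ℝ, ∀ n x, |moll ρ (fn (w n)) x| ^ critExp E ≤ B := by
    obtain ⟨C, hC, hmoll⟩ := exists_enorm_moll_le (G := ℝ) ρ
    refine ⟨(√(C.toReal * M ^ 2)) ^ critExp E, fun n x => ?_⟩
    apply Real.rpow_le_rpow (abs_nonneg _) _ hq.le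
    apply Real.abs_le_sqrt
    have h2 : ‖moll ρ (fn (w n)) x‖ₑ ^ (2 : ℝ) ≤ C * ENNReal.ofReal (M ^ 2) := by
      refine (hmoll (fn (w n)) (memLp_fn (w n)) x).trans (mul_le_mul' le_rfl ?_)
      refine (setLIntegral_le_lintegral _ _).trans ?_
      rw [lintegral_enorm_sq_eq]
      gcongr
      exact (norm_fnL_le _).trans (hM n)
    have h4 := ENNReal.toReal_mono (ENNReal.mul_ne_top hC ENNReal.ofReal_ne_top) h2
    rwa [ENNReal.toReal_mul, ENNReal.toReal_ofReal (by positivity),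
      ← ENNReal.toReal_rpow, toReal_enorm, Real.norm_eq_abs, Real.rpow_two, sq_abs] at h4
  obtain ⟨B, hB⟩ := hbdd
  rw [Metric.tendsto_atTop]
  intro ε hε
  -- Where the squared mollification is at most `η`, its power `2 + 2r` is at most `ηʳ` times its
  -- square, whose integral is at most `M²`.
  obtain ⟨η, hη, hηε⟩ : ∃ η : ℝ, 0 < η ∧ η ^ growthExp E * M ^ 2 < ε / 2 := by
    have hc : Continuous fun η : ℝ => η ^ growthExp E * M ^ 2 :=
      (continuous_id.rpow_const fun _ => Or.inr hr.le).mul continuous_const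
    have h0 := hc.tendsto 0
    rw [Real.zero_rpow hr.ne', zero_mul] at h0
    have h1 := (h0.mono_left (nhdsWithin_le_nhds (s := Ioi (0 : ℝ)))).eventually (gt_mem_nhds (half_pos hε))
    obtain ⟨η, h2, h3⟩ := (h1.and (self_mem_nhdsWithin (s := Ioi (0 : ℝ)))).exists
    exact ⟨η, h3, h2⟩
  obtain ⟨R, hR⟩ := exists_moll_sq_le_of_spread h𝒢 ρ (M := M) hη
  have hin : Tendsto (fun n => ∫ x in Metric.ball (0 : E) R, |moll ρ (fn (w n)) x| ^ critExp E)
      atTop (𝓝 0) := by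
    have h0 : ∫ x in Metric.ball (0 : E) R, (0 : ℝ) = 0 := by simp
    rw [← h0]
    refine tendsto_integral_of_dominated_convergence (fun _ => B)
      (fun n => (hint n).1.restrict) ?_ (fun n => Eventually.of_forall fun x => ?_)
      (Eventually.of_forall fun x => ?_)
    · exact integrableOn_const measure_ball_lt_top.ne
    · rw [Real.norm_of_nonneg (by positivity)]
      exact hB n x
    · have h1 := (moll_tendsto_of_weak ρ hw x).abs
      rw [abs_zero] at h1
      have h2 := h1.rpow_const (p := critExp E) (Or.inr hq.le)
      rwa [Real.zero_rpow hq.ne'] at h2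
  obtain ⟨n₀, hn₀⟩ := Metric.tendsto_atTop.1 hin (ε / 2) (half_pos hε)
  refine ⟨n₀, fun n hnn => ?_⟩
  have h1 := hn₀ n hnn
  rw [Real.dist_0_eq_abs, abs_of_nonneg (integral_nonneg fun _ => by positivity)] at h1 ⊢
  have hsq : Integrable (fun x => moll ρ (fn (w n)) x ^ 2) volume :=
    (memLp_moll ρ (memLp_fn (w n))).integrable_sq
  have hsqle : ∫ x, moll ρ (fn (w n)) x ^ 2 ≤ M ^ 2 := by
    have e : ∫ x, moll ρ (fn (w n)) x ^ 2 = ‖fnL (mollH ρ (w n))‖ ^ 2 := by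
      rw [norm_sq_fnL]
      apply integral_congr_ae
      filter_upwards [hae n] with x hx
      rw [hx]
    rw [e]
    gcongr
    exact (norm_fnL_mollH_le _ _).trans ((norm_fnL_le _).trans (hM n))
  have hout : ∫ x in (Metric.ball (0 : E) R)ᶜ, |moll ρ (fn (w n)) x| ^ critExp E
      ≤ η ^ growthExp E * M ^ 2 := by
    calc ∫ x in (Metric.ball (0 : E) R)ᶜ, |moll ρ (fn (w n)) x| ^ critExp E
        ≤ ∫ x in (Metric.ball (0 : E) R)ᶜ, η ^ growthExp E * moll ρ (fn (w n)) x ^ 2 := by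
          apply setIntegral_mono_on (hint n).integrableOn (hsq.const_mul _).integrableOn
            Metric.isOpen_ball.measurableSet.compl
          intro x hx
          have hxR : R ≤ ‖x‖ := by simpa using hx
          rw [abs_rpow_critExp hn]
          have := hR (w n) (hws n) (hM n) x hxR
          gcongr
      _ ≤ ∫ x, η ^ growthExp E * moll ρ (fn (w n)) x ^ 2 :=
          setIntegral_le_integral (hsq.const_mul _) (Eventually.of_forall fun x => by positivity)
      _ ≤ _ := by
          rw [integral_const_mul]
          gcongr
  rw [← integral_add_compl Metric.isOpen_ball.measurableSet (hint n) (s := Metric.ball (0 : E) R)]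
  linarith

/-- Weakly null sequences of symmetric functions are null in `L^q`. -/
theorem tendsto_integral_critExp (hn : 2 < Module.finrank ℝ E)
    {𝒢 : Set ((E ≃ₗᵢ[ℝ] E) × ℝ)} (h𝒢 : HasSpreadOrbits 𝒢)
    {w : ℕ → H1 E} {M : ℝ} (hws : ∀ n, w n ∈ symSub 𝒢) (hM : ∀ n, ‖w n‖ ≤ M)
    (hw : ∀ ℓ : H1 E →L[ℝ] ℝ, Tendsto (fun n => ℓ (w n)) atTop (𝓝 0)) :
    Tendsto (fun n => ∫ x, |fn (w n) x| ^ critExp E) atTop (𝓝 0) := by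
  have hr := growthExp_pos hn
  have hq : 0 < critExp E := by
    unfold critExp
    positivity
  have hM0 : 0 ≤ M := (norm_nonneg _).trans (hM 0)
  have hS := sobConst_nonneg (E := E)
  -- The mollification error is small in `L²`, of order `1/(j+1)` uniformly in `n`, and bounded in
  -- gradient; the interpolation inequality makes it small in the critical power. The scale `j` is
  -- fixed before `n` tends to infinity.
  have key : ∀ j n, ∫ x, |fn (w n) x| ^ critExp E ≤
      2 ^ critExp E * ((∫ x, |moll (bumpSeq E j) (fn (w n)) x| ^ critExp E) +
        sobConst E * ((1 / ((j : ℝ) + 1) * M) ^ 2) ^ growthExp E * (2 * M) ^ 2) := by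
    intro j n
    set ρ := bumpSeq E j
    have i1 : Integrable (fun x => |moll ρ (fn (w n)) x| ^ critExp E) volume := by
      refine (integral_critExp_le hn (mollH ρ (w n))).1.congr ?_
      filter_upwards [fn_mollH ρ (w n)] with x hx
      rw [hx]
    obtain ⟨i2, h2⟩ := integral_critExp_le hn (mollH ρ (w n) - w n)
    have h3 : ‖fnL (mollH ρ (w n) - w n)‖ ≤ 1 / ((j : ℝ) + 1) * M := by
      refine (norm_fnL_mollH_sub_le ρ (w n)).trans ?_
      rw [bumpSeq_rOut]
      gcongr
      exact (norm_gradL_le _).trans (hM n)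
    have h4 : ‖gradL (mollH ρ (w n) - w n)‖ ≤ 2 * M := by
      rw [map_sub]
      have := norm_sub_le (gradL (mollH ρ (w n))) (gradL (w n))
      have a1 := norm_gradL_mollH_le ρ (w n)
      have a2 := (norm_gradL_le (w n)).trans (hM n)
      linarith
    calc ∫ x, |fn (w n) x| ^ critExp E
        ≤ ∫ x, 2 ^ critExp E * (|moll ρ (fn (w n)) x| ^ critExp E
            + |fn (mollH ρ (w n) - w n) x| ^ critExp E) := by
          apply integral_mono_ae (integral_critExp_le hn (w n)).1 ((i1.add i2).const_mul _)
          filter_upwards [fn_sub (mollH ρ (w n)) (w n), fn_mollH ρ (w n)] with x hx1 hx2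
          have h := abs_add_rpow_le hq.le (moll ρ (fn (w n)) x) (-fn (mollH ρ (w n) - w n) x)
          rw [abs_neg, hx1, hx2, neg_sub, add_sub_cancel] at h
          simp only [Pi.add_apply]
          rw [hx1, hx2]
          exact h
      _ = 2 ^ critExp E * ((∫ x, |moll ρ (fn (w n)) x| ^ critExp E)
            + ∫ x, |fn (mollH ρ (w n) - w n) x| ^ critExp E) := by
          rw [integral_const_mul, integral_add i1 i2]
      _ ≤ _ := by
          gcongr
          refine h2.trans ?_
          gcongr
  have hrem : Tendsto (fun j : ℕ => 2 ^ critExp E *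
      (sobConst E * ((1 / ((j : ℝ) + 1) * M) ^ 2) ^ growthExp E * (2 * M) ^ 2)) atTop (𝓝 0) := by
    have hc : Continuous fun t : ℝ => 2 ^ critExp E *
        (sobConst E * ((t * M) ^ 2) ^ growthExp E * (2 * M) ^ 2) := by
      have : Continuous fun t : ℝ => ((t * M) ^ 2) ^ growthExp E :=
        ((continuous_id.mul continuous_const).pow 2).rpow_const fun _ => Or.inr hr.le
      fun_prop
    have := (hc.tendsto 0).comp (tendsto_one_div_add_atTop_nhds_zero_nat (𝕜 := ℝ))
    simpa [Function.comp_def, Real.zero_rpow hr.ne'] using this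
  rw [Metric.tendsto_atTop]
  intro ε hε
  obtain ⟨j, hj⟩ := (hrem.eventually (gt_mem_nhds (half_pos hε))).exists
  have hmain := (tendsto_integral_moll_critExp hn h𝒢 (bumpSeq E j) hws hM hw).const_mul
    (2 ^ critExp E)
  rw [mul_zero] at hmain
  obtain ⟨n₀, hn₀⟩ := eventually_atTop.1 (hmain.eventually (gt_mem_nhds (half_pos hε)))
  refine ⟨n₀, fun n hnn => ?_⟩
  rw [Real.dist_0_eq_abs, abs_of_nonneg (integral_nonneg fun _ => by positivity)]
  have h1 := key j n
  have h2 := hn₀ n hnn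
  rw [mul_add] at h1
  linarith

end Symmetry

/-! ### The block orthogonal group -/

/-- The Householder reflection along `y - b` exchanges two vectors of equal length. -/
theorem exists_orthogonal_mulVec_eq {d : ℕ} {y b : Fin d → ℝ} (h : y ⬝ᵥ y = b ⬝ᵥ b) :
    ∃ A : Matrix.orthogonalGroup (Fin d) ℝ, (A : Matrix (Fin d) (Fin d) ℝ) *ᵥ y = b := by
  rcases eq_or_ne y b with rfl | hne
  · exact ⟨1, by simp⟩
  set u := y - b with hu
  have hu0 : u ⬝ᵥ u ≠ 0 := by
    rw [Ne, dotProduct_self_eq_zero, hu, sub_eq_zero]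
    exact hne
  set c := 2 / (u ⬝ᵥ u) with hc
  have hcu : c * (u ⬝ᵥ u) = 2 := div_mul_cancel₀ _ hu0
  set A : Matrix (Fin d) (Fin d) ℝ := 1 - c • Matrix.vecMulVec u u with hA
  have hAt : Aᵀ = A := by
    rw [hA, Matrix.transpose_sub, Matrix.transpose_smul, Matrix.transpose_one,
      Matrix.transpose_vecMulVec]
  have hAA : A * A = 1 := by
    have h1 : Matrix.vecMulVec u u * Matrix.vecMulVec u u
        = (u ⬝ᵥ u) • Matrix.vecMulVec u u := by
      rw [Matrix.vecMulVec_mul_vecMulVec, Matrix.vecMulVec_smul]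
    rw [hA, sub_mul, mul_sub, mul_sub, one_mul, one_mul, mul_one, smul_mul_smul_comm, h1,
      smul_smul, mul_assoc, hcu]
    module
  refine ⟨⟨A, ?_⟩, ?_⟩
  · rw [Matrix.mem_orthogonalGroup_iff]
    show A * Aᵀ = 1
    rw [hAt, hAA]
  · show A *ᵥ y = b
    have h2 : c * (u ⬝ᵥ y) = 1 := by
      have h3 : u ⬝ᵥ u = 2 * (u ⬝ᵥ y) := by
        simp only [hu, sub_dotProduct, dotProduct_sub, dotProduct_comm b y]
        linarith
      rw [h3] at hcu
      linarith
    rw [hA, Matrix.sub_mulVec, Matrix.one_mulVec, Matrix.smul_mulVec, Matrix.vecMulVec_mulVec]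
    funext i
    simp only [Pi.sub_apply, Pi.smul_apply, MulOpposite.smul_eq_mul_unop, MulOpposite.unop_op,
      smul_eq_mul, hu] at h2 ⊢
    linear_combination (-(y i - b i)) * h2

theorem dotProduct_mulVec_orthogonal {d : ℕ} (A : Matrix.orthogonalGroup (Fin d) ℝ)
    (y : Fin d → ℝ) : ((A : Matrix (Fin d) (Fin d) ℝ) *ᵥ y) ⬝ᵥ
      ((A : Matrix (Fin d) (Fin d) ℝ) *ᵥ y) = y ⬝ᵥ y := by
  have h : (A : Matrix (Fin d) (Fin d) ℝ)ᵀ * (A : Matrix (Fin d) (Fin d) ℝ) = 1 :=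
    (Matrix.mem_orthogonalGroup_iff' (Fin d) ℝ).1 A.2
  rw [Matrix.dotProduct_mulVec, ← Matrix.mulVec_transpose, Matrix.mulVec_mulVec, h,
    Matrix.one_mulVec]

/-- In dimension other than one, the sphere through a far point contains many points whose
coordinates are far from each other. -/
theorem exists_spread_orthogonal {d : ℕ} (hd : d ≠ 1) {δ : ℝ} (hδ : 0 < δ) (K : ℕ)
    {y : Fin d → ℝ} (hy : (2 * δ * K) ^ 2 ≤ y ⬝ᵥ y) :
    ∃ A : Fin K → Matrix.orthogonalGroup (Fin d) ℝ, ∀ i j, i ≠ j → ∃ l,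
      2 * δ ≤ |((A i : Matrix (Fin d) (Fin d) ℝ) *ᵥ y) l
        - ((A j : Matrix (Fin d) (Fin d) ℝ) *ᵥ y) l| := by
  -- In dimension zero the hypothesis on `y` forces `K = 0`, and there is nothing to choose.
  rcases Nat.eq_zero_or_pos d with rfl | hd0
  · have h0 : y ⬝ᵥ y = 0 := by simp [dotProduct]
    rw [h0] at hy
    have h1 : 2 * δ * K = 0 := by nlinarith [sq_nonneg (2 * δ * K)]
    have hK : K = 0 := by
      have : (K : ℝ) = 0 := (mul_eq_zero.1 h1).resolve_left (by positivity)
      exact_mod_cast this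
    subst hK
    exact ⟨fun i => i.elim0, fun i => i.elim0⟩
  · let i0 : Fin d := ⟨0, hd0⟩
    let i1 : Fin d := ⟨1, by omega⟩
    have h01 : i0 ≠ i1 := by simp [i0, i1]
    -- The images of `y` have first coordinates `0, 2δ, 4δ, …`; a second coordinate, available since
    -- `d ≥ 2`, restores the length.
    have hb : ∀ j : Fin K, ∃ A : Matrix.orthogonalGroup (Fin d) ℝ,
        ((A : Matrix (Fin d) (Fin d) ℝ) *ᵥ y) i0 = 2 * δ * j := by
      intro j
      have hjK : (j : ℝ) ≤ K := by exact_mod_cast j.2.le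
      have hle : (2 * δ * (j : ℝ)) ^ 2 ≤ y ⬝ᵥ y := le_trans (by gcongr) hy
      have he : y ⬝ᵥ y = (Pi.single i0 (2 * δ * (j : ℝ))
          + Pi.single i1 √(y ⬝ᵥ y - (2 * δ * (j : ℝ)) ^ 2)) ⬝ᵥ (Pi.single i0 (2 * δ * (j : ℝ))
          + Pi.single i1 √(y ⬝ᵥ y - (2 * δ * (j : ℝ)) ^ 2)) := by
        simp only [dotProduct_add, dotProduct_single, Pi.add_apply, Pi.single_eq_same,
          Pi.single_eq_of_ne h01, Pi.single_eq_of_ne h01.symm, add_zero, zero_add]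
        rw [← sq, ← sq, Real.sq_sqrt (by linarith)]
        ring
      obtain ⟨A, hA⟩ := exists_orthogonal_mulVec_eq he
      refine ⟨A, ?_⟩
      rw [hA, Pi.add_apply, Pi.single_eq_same, Pi.single_eq_of_ne h01, add_zero]
    choose A hA using hb
    refine ⟨A, fun i j hij => ⟨i0, ?_⟩⟩
    rw [hA, hA, ← mul_sub, abs_mul, abs_of_pos (by positivity : 0 < 2 * δ)]
    have h1 : (1 : ℝ) ≤ |(i : ℝ) - (j : ℝ)| := by
      have h2 : (1 : ℤ) ≤ |(i : ℤ) - (j : ℤ)| := by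
        apply Int.one_le_abs
        have : (i : ℕ) ≠ j := fun h => hij (Fin.ext h)
        omega
      exact_mod_cast h2
    nlinarith

/-! ### Block rotations and the exchange of blocks as linear isometries -/

variable {N m : ℕ}

theorem Space.norm_sq_eq (x : Space N m) :
    ‖x‖ ^ 2 = x.fst ⬝ᵥ x.fst + x.snd ⬝ᵥ x.snd + x.thd ⬝ᵥ x.thd := by
  rw [EuclideanSpace.norm_sq_eq, Fintype.sum_sum_type, Fintype.sum_sum_type, add_assoc]
  simp only [dotProduct, Space.fst, Space.snd, Space.thd, Real.norm_eq_abs, sq_abs, ← sq]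

theorem Space.fst_mk (a b : Fin m → ℝ) (c : Fin (N - 2 * m) → ℝ) : (Space.mk a b c).fst = a := rfl

theorem Space.snd_mk (a b : Fin m → ℝ) (c : Fin (N - 2 * m) → ℝ) : (Space.mk a b c).snd = b := rfl

theorem Space.thd_mk (a b : Fin m → ℝ) (c : Fin (N - 2 * m) → ℝ) : (Space.mk a b c).thd = c := rfl

theorem Space.ext_blocks {x y : Space N m} (h1 : x.fst = y.fst) (h2 : x.snd = y.snd)
    (h3 : x.thd = y.thd) : x = y := by
  ext i
  rcases i with i | i | i
  · exact congrFun h1 i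
  · exact congrFun h2 i
  · exact congrFun h3 i

/-- The block action as a linear isometry. -/
noncomputable def blockIso (A B : Matrix.orthogonalGroup (Fin m) ℝ)
    (C : Matrix.orthogonalGroup (Fin (N - 2 * m)) ℝ) : Space N m ≃ₗᵢ[ℝ] Space N m :=
  LinearIsometry.toLinearIsometryEquiv
    { toFun := blockAct A B C
      map_add' := fun x y => Space.ext_blocks (Matrix.mulVec_add _ x.fst y.fst)
        (Matrix.mulVec_add _ x.snd y.snd) (Matrix.mulVec_add _ x.thd y.thd)
      map_smul' := fun c x => Space.ext_blocks (Matrix.mulVec_smul _ c x.fst)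
        (Matrix.mulVec_smul _ c x.snd) (Matrix.mulVec_smul _ c x.thd)
      norm_map' := fun x => by
        refine (sq_eq_sq₀ (norm_nonneg _) (norm_nonneg _)).1 ?_
        show ‖blockAct A B C x‖ ^ 2 = _
        rw [Space.norm_sq_eq, Space.norm_sq_eq x, blockAct, Space.fst_mk, Space.snd_mk,
          Space.thd_mk, dotProduct_mulVec_orthogonal, dotProduct_mulVec_orthogonal,
          dotProduct_mulVec_orthogonal] } rfl

theorem blockIso_apply (A B : Matrix.orthogonalGroup (Fin m) ℝ)
    (C : Matrix.orthogonalGroup (Fin (N - 2 * m)) ℝ) (x : Space N m) :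
    blockIso A B C x = blockAct A B C x := rfl

/-- The exchange of the first two blocks as a linear isometry. -/
noncomputable def swapIso (N m : ℕ) : Space N m ≃ₗᵢ[ℝ] Space N m :=
  LinearIsometry.toLinearIsometryEquiv
    { toFun := swapBlocks
      map_add' := fun _ _ => Space.ext_blocks rfl rfl rfl
      map_smul' := fun _ _ => Space.ext_blocks rfl rfl rfl
      norm_map' := fun x => by
        refine (sq_eq_sq₀ (norm_nonneg _) (norm_nonneg _)).1 ?_
        show ‖swapBlocks x‖ ^ 2 = _
        rw [Space.norm_sq_eq, Space.norm_sq_eq x, swapBlocks, Space.fst_mk, Space.snd_mk,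
          Space.thd_mk, add_comm (x.snd ⬝ᵥ x.snd)] } rfl

theorem swapIso_apply (x : Space N m) : swapIso N m x = swapBlocks x := rfl

/-- The symmetries, with their signs, that define `Y_G`. -/
def blockSymmetries (N m : ℕ) : Set ((Space N m ≃ₗᵢ[ℝ] Space N m) × ℝ) :=
  {g | g = (swapIso N m, -1) ∨ ∃ A B C, g = (blockIso A B C, 1)}

theorem sq_snd_blockSymmetries {g : (Space N m ≃ₗᵢ[ℝ] Space N m) × ℝ}
    (hg : g ∈ blockSymmetries N m) : g.2 ^ 2 = 1 := by
  rcases hg with rfl | ⟨A, B, C, rfl⟩ <;> norm_num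

theorem symmetricSpace_eq (N m : ℕ) :
    symmetricSpace N m = (symSub (blockSymmetries N m) : Set (H1 (Space N m))) := by
  ext v
  rw [SetLike.mem_coe, mem_symSub_iff]
  constructor
  · rintro ⟨h1, h2⟩ g (rfl | ⟨A, B, C, rfl⟩)
    · filter_upwards [h2] with x hx
      rw [swapIso_apply, hx, neg_one_mul]
    · filter_upwards [h1 A B C] with x hx
      rw [blockIso_apply, hx, one_mul]
  · intro h
    refine ⟨fun A B C => ?_, ?_⟩
    · filter_upwards [h _ (Or.inr ⟨A, B, C, rfl⟩)] with x hx
      rw [blockIso_apply, one_mul] at hx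
      exact hx
    · filter_upwards [h _ (Or.inl rfl)] with x hx
      rw [swapIso_apply, neg_one_mul] at hx
      exact hx

/-- A far point has a large component in at least one of the three blocks, and rotating that block
alone spreads its orbit. None of the blocks has dimension one; an empty third block has norm zero
and is harmless. -/
theorem hasSpreadOrbits_blockSymmetries (hm : 2 ≤ m) (hNm : N - 2 * m ≠ 1) :
    HasSpreadOrbits (blockSymmetries N m) := by
  intro δ hδ K
  have hm1 : m ≠ 1 := by omega
  have hcoord : ∀ (x y : Space N m) (i), 2 * δ ≤ |x i - y i| → 2 * δ ≤ dist x y := by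
    intro x y i h
    rw [dist_eq_norm]
    exact h.trans (PiLp.norm_apply_le (x - y) i)
  -- The factor 2 squares to 4, which exceeds the number of blocks: if the first two squared norms
  -- are at most `(2δK)²`, the third is at least that.
  refine ⟨2 * (2 * δ * K), fun x hx => ?_⟩
  have hx2 : 4 * (2 * δ * K) ^ 2 ≤ ‖x‖ ^ 2 := by
    have : (2 * (2 * δ * K)) ^ 2 ≤ ‖x‖ ^ 2 := by gcongr
    linarith
  rw [Space.norm_sq_eq] at hx2
  rcases le_total ((2 * δ * K) ^ 2) (x.fst ⬝ᵥ x.fst) with h1 | h1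
  · obtain ⟨A, hA⟩ := exists_spread_orthogonal hm1 hδ K h1
    refine ⟨fun j => blockIso (A j) 1 1, fun j => Or.inr ⟨_, _, _, rfl⟩, fun i j hij => ?_⟩
    obtain ⟨l, hl⟩ := hA i j hij
    exact hcoord _ _ (Sum.inl l) hl
  rcases le_total ((2 * δ * K) ^ 2) (x.snd ⬝ᵥ x.snd) with h2 | h2
  · obtain ⟨A, hA⟩ := exists_spread_orthogonal hm1 hδ K h2
    refine ⟨fun j => blockIso 1 (A j) 1, fun j => Or.inr ⟨_, _, _, rfl⟩, fun i j hij => ?_⟩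
    obtain ⟨l, hl⟩ := hA i j hij
    exact hcoord _ _ (Sum.inr (Sum.inl l)) hl
  · have h3 : (2 * δ * K) ^ 2 ≤ x.thd ⬝ᵥ x.thd := by
      nlinarith [sq_nonneg (2 * δ * K)]
    obtain ⟨A, hA⟩ := exists_spread_orthogonal hNm hδ K h3
    refine ⟨fun j => blockIso 1 1 (A j), fun j => Or.inr ⟨_, _, _, rfl⟩, fun i j hij => ?_⟩
    obtain ⟨l, hl⟩ := hA i j hij
    exact hcoord _ _ (Sum.inr (Sum.inr l)) hl

theorem finrank_space (hmN : 2 * m ≤ N) : Module.finrank ℝ (Space N m) = N := by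
  rw [finrank_euclideanSpace]
  simp only [Fintype.card_sum, Fintype.card_fin]
  omega

/-! ### Constrained critical sequences -/

section Constrained

variable {X : Type*} [NormedAddCommGroup X] [NormedSpace ℝ X]

/-- The kernel of the differential of a regular constraint consists of tangent vectors. -/
theorem mem_tangentVectors_of_fderiv_eq_zero {Ψ : X → ℝ} (hΨ : ContDiff ℝ 1 Ψ)
    (S : Submodule ℝ X) {lam : ℝ} {v u h : X} (hv : v ∈ S) (hvl : Ψ v = lam) (hu : u ∈ S)
    (hu0 : fderiv ℝ Ψ v u ≠ 0) (hh : h ∈ S) (hh0 : fderiv ℝ Ψ v h = 0) :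
    h ∈ tangentVectors ((S : Set X) ∩ {w | Ψ w = lam}) v := by
  -- The constraint is restricted to the plane through `v` spanned by `h` and `u`, which lies in
  -- `S`, and solved there for the coefficient of `u` as a function of that of `h`.
  let A : ℝ × ℝ →L[ℝ] X := (ContinuousLinearMap.fst ℝ ℝ ℝ).smulRight h
    + (ContinuousLinearMap.snd ℝ ℝ ℝ).smulRight u
  have hA : ∀ z : ℝ × ℝ, A z = z.1 • h + z.2 • u := fun z => rfl
  let G : ℝ × ℝ → ℝ := fun z => Ψ (v + A z)
  have hG : ContDiffAt ℝ 1 G (0, 0) := (hΨ.comp (contDiff_const.add A.contDiff)).contDiffAt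
  have hG' : fderiv ℝ G (0, 0) = (fderiv ℝ Ψ v).comp A := by
    have h1 : HasFDerivAt Ψ (fderiv ℝ Ψ v) (v + A (0, 0)) := by
      have : v + A (0, 0) = v := by simp [hA]
      rw [this]
      exact (hΨ.differentiable one_ne_zero v).hasFDerivAt
    exact (h1.comp (0, 0) (A.hasFDerivAt.const_add v)).fderiv
  have hinv : (fderiv ℝ G (0, 0) ∘L .inr ℝ ℝ ℝ).IsInvertible := by
    refine ⟨ContinuousLinearEquiv.unitsEquivAut ℝ (Units.mk0 _ hu0), ?_⟩
    ext
    simp [hG', hA]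
  let s : ℝ → ℝ := hG.implicitFunction one_ne_zero hinv
  have hs0 : s 0 = 0 := hG.implicitFunction_apply_self one_ne_zero hinv
  have hsd : HasFDerivAt s _ 0 := (hG.hasStrictFDerivAt_implicitFunction one_ne_zero hinv).hasFDerivAt
  -- The correction along `u` is of higher order because `Ψ'(v) h = 0`, so the curve has velocity
  -- `h`.
  have hs' : HasDerivAt s 0 0 := by
    refine hsd.hasDerivAt.congr_deriv ?_
    simp [hG', hA, hh0]
  have hsC : ContDiffAt ℝ 1 s 0 := hG.contDiffAt_implicitFunction one_ne_zero hinv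
  have hsG : ∀ᶠ t in 𝓝 (0 : ℝ), G (t, s t) = G (0, 0) :=
    hG.eventually_apply_implicitFunction one_ne_zero hinv
  have hG0 : G (0, 0) = lam := by
    simp [G, hA, hvl]
  obtain ⟨ε, hε, hball⟩ := Metric.eventually_nhds_iff_ball.1
    (hsG.and (hsC.eventually (by simp)))
  have hIoo : ∀ t ∈ Ioo (-ε) ε, t ∈ Metric.ball (0 : ℝ) ε := by
    intro t ht
    rw [Real.ball_eq_Ioo, zero_sub, zero_add]
    exact ht
  refine ⟨ε, hε, fun t => t • h + s t • u, fun t ht => ?_, fun t ht => ⟨?_, ?_⟩, ?_, ?_⟩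
  · have h1 := (hball t (hIoo t ht)).2
    exact ((contDiffAt_id.smul contDiffAt_const).add (h1.smul contDiffAt_const)).contDiffWithinAt
  · exact S.add_mem hv (S.add_mem (S.smul_mem _ hh) (S.smul_mem _ hu))
  · have h1 := (hball t (hIoo t ht)).1
    rw [hG0] at h1
    exact h1
  · simp [hs0]
  · refine (((hasDerivAt_id (0 : ℝ)).smul_const h).add (hs'.smul_const u)).congr_deriv ?_
    simp

theorem abs_fderiv_le_constrainedDerivNorm {F : X → ℝ} {M : Set X} {v h : X}
    (hfin : constrainedDerivNorm F M v ≠ ⊤) (hh : ∀ t : ℝ, t • h ∈ tangentVectors M v) :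
    |fderiv ℝ F v h| ≤ (constrainedDerivNorm F M v).toReal * ‖h‖ := by
  rcases eq_or_ne h 0 with rfl | h0
  · simp
  have hn : 0 < ‖h‖ := norm_pos_iff.2 h0
  have hmem : ‖h‖⁻¹ • h ∈ {h ∈ tangentVectors M v | ‖h‖ ≤ 1} := by
    refine ⟨hh _, ?_⟩
    rw [norm_smul, norm_inv, norm_norm, inv_mul_cancel₀ hn.ne']
  have h1 : ‖fderiv ℝ F v (‖h‖⁻¹ • h)‖ₑ ≤ constrainedDerivNorm F M v :=
    le_iSup₂_of_le (f := fun h (_ : h ∈ {h ∈ tangentVectors M v | ‖h‖ ≤ 1}) =>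
      ‖fderiv ℝ F v h‖ₑ) _ hmem le_rfl
  have h2 := ENNReal.toReal_mono hfin h1
  rw [toReal_enorm, map_smul, norm_smul, norm_inv, norm_norm, Real.norm_eq_abs] at h2
  rwa [inv_mul_le_iff₀ hn, mul_comm] at h2

/-- The Lagrange multiplier rule with an error term. -/
theorem abs_fderiv_sub_multiplier_le {F Ψ : X → ℝ} (hΨ : ContDiff ℝ 1 Ψ) (S : Submodule ℝ X)
    {lam : ℝ} {v : X} (hv : v ∈ S) (hvl : Ψ v = lam) (hv0 : fderiv ℝ Ψ v v ≠ 0)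
    (hfin : constrainedDerivNorm F ((S : Set X) ∩ {w | Ψ w = lam}) v ≠ ⊤) {h : X} (hh : h ∈ S) :
    |fderiv ℝ F v h - fderiv ℝ F v v / fderiv ℝ Ψ v v * fderiv ℝ Ψ v h| ≤
      (constrainedDerivNorm F ((S : Set X) ∩ {w | Ψ w = lam}) v).toReal *
        ‖h - (fderiv ℝ Ψ v h / fderiv ℝ Ψ v v) • v‖ := by
  -- The projection of `h` onto the kernel of `Ψ'(v)` along `v`, which serves as the transversal
  -- direction.
  set h' := h - (fderiv ℝ Ψ v h / fderiv ℝ Ψ v v) • v with hh'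
  have hmem : h' ∈ S := S.sub_mem hh (S.smul_mem _ hv)
  have hker : fderiv ℝ Ψ v h' = 0 := by
    rw [hh', map_sub, map_smul, smul_eq_mul, div_mul_cancel₀ _ hv0, sub_self]
  have h1 := abs_fderiv_le_constrainedDerivNorm hfin (h := h') fun t =>
    mem_tangentVectors_of_fderiv_eq_zero hΨ S hv hvl hv hv0 (S.smul_mem t hmem)
      (by rw [map_smul, hker, smul_zero])
  have h2 : fderiv ℝ F v h' =
      fderiv ℝ F v h - fderiv ℝ F v v / fderiv ℝ Ψ v v * fderiv ℝ Ψ v h := by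
    rw [hh', map_sub, map_smul, smul_eq_mul]
    ring
  rwa [h2] at h1

end Constrained

/-! ### Weak sequential compactness in a Hilbert space -/

section Weak

variable {X : Type*} [NormedAddCommGroup X] [InnerProductSpace ℝ X] [CompleteSpace X]

/-- The sequential Banach–Alaoglu theorem for the dual of a separable space, transported by the
Riesz isomorphism. -/
theorem exists_weak_subseq [TopologicalSpace.SeparableSpace X] {v : ℕ → X} {M : ℝ}
    (hv : ∀ n, ‖v n‖ ≤ M) : ∃ w : X, ∃ k : ℕ → ℕ, StrictMono k ∧
      ∀ ℓ : X →L[ℝ] ℝ, Tendsto (fun n => ℓ (v (k n))) atTop (𝓝 (ℓ w)) := by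
  let D := InnerProductSpace.toDual ℝ X
  let x : ℕ → WeakDual ℝ X := fun n => StrongDual.toWeakDual (D (v n))
  have hx : ∀ n, x n ∈ WeakDual.toStrongDual ⁻¹' Metric.closedBall (0 : StrongDual ℝ X) M := by
    intro n
    show dist (D (v n)) 0 ≤ M
    rw [dist_zero_right, LinearIsometryEquiv.norm_map]
    exact hv n
  obtain ⟨a, _, k, hk, hlim⟩ := WeakDual.isSeqCompact_closedBall ℝ X 0 M hx
  refine ⟨D.symm (WeakDual.toStrongDual a), k, hk, fun ℓ => ?_⟩
  have h1 : Tendsto (fun n => x (k n) (D.symm ℓ)) atTop (𝓝 (a (D.symm ℓ))) :=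
    ((WeakDual.eval_continuous (D.symm ℓ)).tendsto a).comp hlim
  have h2 : ∀ n, x (k n) (D.symm ℓ) = ℓ (v (k n)) := by
    intro n
    show D (v (k n)) (D.symm ℓ) = _
    rw [InnerProductSpace.toDual_apply_apply, real_inner_comm,
      InnerProductSpace.toDual_symm_apply]
  have h3 : a (D.symm ℓ) = ℓ (D.symm (WeakDual.toStrongDual a)) := by
    rw [← InnerProductSpace.toDual_symm_apply (𝕜 := ℝ) (y := ℓ), real_inner_comm,
      InnerProductSpace.toDual_symm_apply]
    rfl
  simp only [h2, h3] at h1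
  exact h1

theorem mem_of_weak_tendsto {S : Submodule ℝ X} (hS : IsClosed (S : Set X)) {v : ℕ → X} {w : X}
    (hv : ∀ n, v n ∈ S)
    (hw : ∀ ℓ : X →L[ℝ] ℝ, Tendsto (fun n => ℓ (v n)) atTop (𝓝 (ℓ w))) : w ∈ S := by
  have : CompleteSpace S := hS.completeSpace_coe
  rw [← Submodule.orthogonal_orthogonal S, Submodule.mem_orthogonal]
  intro u hu
  have h1 := hw (innerSL ℝ u)
  have h2 : ∀ n, innerSL ℝ u (v n) = 0 := fun n =>
    Submodule.inner_left_of_mem_orthogonal (hv n) hu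
  simp only [h2] at h1
  exact (tendsto_nhds_unique h1 tendsto_const_nhds)

end Weak

/-! ### Pointwise inequalities with small constants -/

/-- A form of Young's inequality, obtained by comparing `y` with `η x`. -/
theorem rpow_sub_one_mul_le {q η x y : ℝ} (hq : 1 < q) (hη : 0 < η) (hx : 0 ≤ x) (hy : 0 ≤ y) :
    x ^ (q - 1) * y ≤ η * x ^ q + (η⁻¹) ^ (q - 1) * y ^ q := by
  have hmul : ∀ z : ℝ, 0 ≤ z → z ^ (q - 1) * z = z ^ q := by
    intro z hz
    have h := Real.rpow_add_of_nonneg hz (y := q - 1) (z := 1) (by linarith) zero_le_one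
    rw [Real.rpow_one, sub_add_cancel] at h
    exact h.symm
  have hxq : 0 ≤ x ^ q := Real.rpow_nonneg hx _
  have hyq : 0 ≤ y ^ q := Real.rpow_nonneg hy _
  have hηq : 0 ≤ (η⁻¹) ^ (q - 1) := Real.rpow_nonneg (by positivity) _
  rcases le_total y (η * x) with h | h
  · calc x ^ (q - 1) * y ≤ x ^ (q - 1) * (η * x) :=
          mul_le_mul_of_nonneg_left h (Real.rpow_nonneg hx _)
      _ = η * x ^ q := by rw [← hmul x hx]; ring
      _ ≤ _ := le_add_of_nonneg_right (mul_nonneg hηq hyq)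
  · have h1 : x ≤ η⁻¹ * y := by rwa [le_inv_mul_iff₀ hη]
    calc x ^ (q - 1) * y ≤ (η⁻¹ * y) ^ (q - 1) * y := by gcongr
      _ = (η⁻¹) ^ (q - 1) * y ^ q := by
          rw [Real.mul_rpow (by positivity) hy, ← hmul y hy]
          ring
      _ ≤ _ := le_add_of_nonneg_left (mul_nonneg hη.le hxq)

/-- `k` is `o(t)` at zero and grows at most like `|t|^(q - 1)` at infinity. -/
def IsSubcritical (q : ℝ) (k : ℝ → ℝ) : Prop :=
  ∀ δ : ℝ, 0 < δ → ∃ C : ℝ, 0 ≤ C ∧ ∀ t, |k t| ≤ δ * |t| + C * |t| ^ (q - 1)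

/-- Away from zero `1` and `|t|ʳ` are bounded by multiples of `|t|^(2r)`, so only the behaviour at
zero needs a hypothesis. `dualMass` does not satisfy it, which is why it is treated apart. -/
theorem IsGrowth.isSubcritical {r : ℝ} (hr : 0 < r) {k : ℝ → ℝ} (hk : IsGrowth r k)
    (h0 : ∀ δ : ℝ, 0 < δ → ∃ η : ℝ, 0 < η ∧ ∀ t, |t| ≤ η → |k t| ≤ δ * |t|) :
    IsSubcritical (2 + 2 * r) k := by
  intro δ hδ
  obtain ⟨C, hC0, hC⟩ := hk.bound
  obtain ⟨η, hη, hsmall⟩ := h0 δ hδ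
  refine ⟨C * ((η⁻¹) ^ (2 * r) + 2 * (η⁻¹) ^ r), by positivity, fun t => ?_⟩
  rcases le_total |t| η with h | h
  · exact (hsmall t h).trans (le_add_of_nonneg_right (by positivity))
  · have ht : 0 < |t| := hη.trans_le h
    have h1 := hk.abs_le hr hC t
    have hone : 1 ≤ η⁻¹ * |t| := by rwa [le_inv_mul_iff₀ hη, mul_one]
    have e1 : 1 ≤ (η⁻¹) ^ (2 * r) * |t| ^ (2 * r) := by
      rw [← Real.mul_rpow (by positivity) ht.le]
      exact Real.one_le_rpow hone (by positivity)
    have e2 : |t| ^ r ≤ (η⁻¹) ^ r * |t| ^ (2 * r) := by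
      have : 1 ≤ (η⁻¹) ^ r * |t| ^ r := by
        rw [← Real.mul_rpow (by positivity) ht.le]
        exact Real.one_le_rpow hone hr.le
      rw [two_mul, Real.rpow_add ht, ← mul_assoc]
      exact le_mul_of_one_le_left (by positivity) this
    have e3 : |t| ^ (2 + 2 * r - 1) = |t| * |t| ^ (2 * r) := by
      rw [show 2 + 2 * r - 1 = 1 + 2 * r by ring, Real.rpow_add ht, Real.rpow_one]
    calc |k t| ≤ C * (|t| * (1 + |t| ^ r + |t| ^ r)) := h1
      _ ≤ C * (|t| * ((η⁻¹) ^ (2 * r) * |t| ^ (2 * r) + (η⁻¹) ^ r * |t| ^ (2 * r)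
            + (η⁻¹) ^ r * |t| ^ (2 * r))) := by gcongr
      _ = C * ((η⁻¹) ^ (2 * r) + 2 * (η⁻¹) ^ r) * |t| ^ (2 + 2 * r - 1) := by
          rw [e3]
          ring
      _ ≤ _ := le_add_of_nonneg_left (by positivity)

theorem isSubcritical_dualPower {p r : ℝ} (hp : 2 < p) (hr : 0 < r) (hpr : p ≤ 4 + 2 * r) :
    IsSubcritical (2 + 2 * r) (dualPower p) := by
  refine (isGrowth_dualPower hp hr.le hpr).isSubcritical hr fun δ hδ => ?_
  -- Chosen so that its power `p - 2` is `δ`: `dualPower` is `|f|^(p-2)` times a quantity bounded by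
  -- `|t|`.
  refine ⟨δ ^ (p - 2)⁻¹, by positivity, fun t ht => ?_⟩
  have h1 : |dualChange t| ^ (p - 2) ≤ δ := by
    calc |dualChange t| ^ (p - 2) ≤ (δ ^ (p - 2)⁻¹) ^ (p - 2) := by
          gcongr
          · exact (abs_dualChange_le t).trans ht
      _ = δ := Real.rpow_inv_rpow hδ.le (by linarith)
  have h2 : |dualMass t| ≤ |t| := by
    refine (sq_le_sq.1 (sq_dualMass_le t)).trans (abs_dualChange_le t)
  rw [dualPower, abs_mul, abs_of_nonneg (Real.rpow_nonneg (abs_nonneg _) _)]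
  gcongr

theorem IsSubcritical.mul_le {q : ℝ} (hq : 1 < q) {k : ℝ → ℝ} (hk : IsSubcritical q k) {δ : ℝ}
    (hδ : 0 < δ) : ∃ C : ℝ, 0 ≤ C ∧ ∀ a w : ℝ,
      |k a * w| ≤ δ * (a ^ 2 + |a| ^ q + w ^ 2) + C * |w| ^ q := by
  obtain ⟨C, hC, hle⟩ := hk δ hδ
  set η := δ / (C + 1) with hη
  have hη0 : 0 < η := by positivity
  refine ⟨C * (η⁻¹) ^ (q - 1), by positivity, fun a w => ?_⟩
  have h1 := rpow_sub_one_mul_le hq hη0 (abs_nonneg a) (abs_nonneg w)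
  have h2 : C * η ≤ δ := by
    rw [hη, mul_div_assoc', div_le_iff₀ (by positivity)]
    nlinarith
  have h3 : |a| * |w| ≤ a ^ 2 + w ^ 2 := by
    rw [← sq_abs a, ← sq_abs w]
    nlinarith [sq_nonneg (|a| - |w|), sq_nonneg |a|, sq_nonneg |w|]
  have haq : 0 ≤ |a| ^ q := by positivity
  calc |k a * w| = |k a| * |w| := abs_mul _ _
    _ ≤ (δ * |a| + C * |a| ^ (q - 1)) * |w| := by
        gcongr
        exact hle a
    _ = δ * (|a| * |w|) + C * (|a| ^ (q - 1) * |w|) := by ring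
    _ ≤ δ * (a ^ 2 + w ^ 2) + C * (η * |a| ^ q + (η⁻¹) ^ (q - 1) * |w| ^ q) := by gcongr
    _ = δ * (a ^ 2 + w ^ 2) + C * η * |a| ^ q + C * (η⁻¹) ^ (q - 1) * |w| ^ q := by ring
    _ ≤ δ * (a ^ 2 + w ^ 2) + δ * |a| ^ q + C * (η⁻¹) ^ (q - 1) * |w| ^ q := by gcongr
    _ = _ := by ring

/-- By the mean value theorem the difference is `k(c)(a - b)` with `|c|` at most the larger of `|a|`
and `|b|`. -/
theorem IsSubcritical.primitive_sub_le {q : ℝ} (hq : 1 < q) {k K : ℝ → ℝ} (hk : IsSubcritical q k)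
    (hK : ∀ t, HasDerivAt K (k t) t) {δ : ℝ} (hδ : 0 < δ) : ∃ C : ℝ, 0 ≤ C ∧ ∀ a b : ℝ,
      |K a - K b| ≤ δ * (a ^ 2 + b ^ 2 + |a| ^ q + |b| ^ q + (a - b) ^ 2) + C * |a - b| ^ q := by
  obtain ⟨C, hC, hle⟩ := hk.mul_le hq hδ
  have hlt : ∀ a b : ℝ, a < b →
      |K a - K b| ≤ δ * (a ^ 2 + b ^ 2 + |a| ^ q + |b| ^ q + (a - b) ^ 2) + C * |a - b| ^ q := by
    intro a b hab
    obtain ⟨c, hc, hslope⟩ := exists_hasDerivAt_eq_slope K k hab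
      (fun t _ => (hK t).continuousAt.continuousWithinAt) (fun t _ => hK t)
    have h1 : K a - K b = k c * (a - b) := by
      rw [hslope]
      field_simp [(sub_pos.2 hab).ne']
      ring
    have hcabs : |c| ≤ |a| ∨ |c| ≤ |b| := by
      rcases le_total 0 c with h | h
      · right
        rw [abs_of_nonneg h]
        exact hc.2.le.trans (le_abs_self b)
      · left
        rw [abs_of_nonpos h]
        exact (neg_le_neg hc.1.le).trans (neg_le_abs a)
    have h2 : c ^ 2 ≤ a ^ 2 + b ^ 2 := by
      rcases hcabs with h | h
      · have := sq_le_sq.2 h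
        nlinarith [sq_nonneg b]
      · have := sq_le_sq.2 h
        nlinarith [sq_nonneg a]
    have h3 : |c| ^ q ≤ |a| ^ q + |b| ^ q := by
      rcases hcabs with h | h
      · exact (Real.rpow_le_rpow (abs_nonneg _) h (by linarith)).trans
          (le_add_of_nonneg_right (by positivity))
      · exact (Real.rpow_le_rpow (abs_nonneg _) h (by linarith)).trans
          (le_add_of_nonneg_left (by positivity))
    rw [h1]
    refine (hle c (a - b)).trans ?_
    have h4 : c ^ 2 + |c| ^ q + (a - b) ^ 2 ≤
        a ^ 2 + b ^ 2 + |a| ^ q + |b| ^ q + (a - b) ^ 2 := by linarith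
    gcongr
  refine ⟨C, hC, fun a b => ?_⟩
  rcases lt_trichotomy a b with h | rfl | h
  · exact hlt a b h
  · rw [sub_self, abs_zero]
    positivity
  · have h1 := hlt b a h
    rw [abs_sub_comm (K a), abs_sub_comm a, ← neg_sub b a, neg_sq]
    linarith

/-- No smallness at zero is assumed, and the price is the constant `1` in the bracket: it is not
integrable on the whole space, so the bound serves against compactly supported weights. -/
theorem IsGrowth.sub_le {r : ℝ} (hr : 0 < r) {k : ℝ → ℝ} (hk : IsGrowth r k) {δ : ℝ} (hδ : 0 < δ) :
    ∃ C : ℝ, 0 ≤ C ∧ ∀ a b : ℝ, |k a - k b| ≤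
      δ * (1 + |a| ^ (2 + 2 * r) + |b| ^ (2 + 2 * r)) + C * |a - b| ^ (2 + 2 * r) := by
  obtain ⟨C, hC0, hC⟩ := hk.bound
  -- The 9 is one factor 3 from squaring the three-term sum `Z` and another from `(|t|ʳ)² ≤ 1 +
  -- |t|^(2 + 2r)`.
  set η := δ / (9 * (C + 1)) with hη
  have hη0 : 0 < η := by positivity
  have hCη : C * (9 * η) ≤ δ := by
    rw [hη]
    have : C * (9 * (δ / (9 * (C + 1)))) = C * δ / (C + 1) := by field_simp
    rw [this, div_le_iff₀ (by positivity)]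
    nlinarith
  refine ⟨C * (η⁻¹ * (η⁻¹) ^ (2 * r)), by positivity, fun a b => ?_⟩
  have hpow : ∀ t : ℝ, (|t| ^ r) ^ 2 ≤ 1 + |t| ^ (2 + 2 * r) := by
    intro t
    rw [← Real.rpow_natCast, ← Real.rpow_mul (abs_nonneg t)]
    rcases le_total |t| 1 with h | h
    · exact (Real.rpow_le_one (abs_nonneg t) h (by positivity)).trans
        (le_add_of_nonneg_right (by positivity))
    · refine (Real.rpow_le_rpow_of_exponent_le h ?_).trans (le_add_of_nonneg_left zero_le_one)
      push_cast
      linarith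
  set Z := 1 + |a| ^ r + |b| ^ r with hZ
  have hZ1 : 1 ≤ Z := by
    have h1 : 0 ≤ |a| ^ r := by positivity
    have h2 : 0 ≤ |b| ^ r := by positivity
    linarith
  have hZ2 : Z ^ 2 ≤ 9 * (1 + |a| ^ (2 + 2 * r) + |b| ^ (2 + 2 * r)) := by
    have h1 : Z ^ 2 ≤ 3 * (1 + (|a| ^ r) ^ 2 + (|b| ^ r) ^ 2) := by
      rw [hZ]
      nlinarith [sq_nonneg (1 - |a| ^ r), sq_nonneg (1 - |b| ^ r), sq_nonneg (|a| ^ r - |b| ^ r)]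
    have h2 := hpow a
    have h3 := hpow b
    have h4 : 0 ≤ |a| ^ (2 + 2 * r) := by positivity
    have h5 : 0 ≤ |b| ^ (2 + 2 * r) := by positivity
    linarith
  have key : |a - b| * Z ≤ 9 * η * (1 + |a| ^ (2 + 2 * r) + |b| ^ (2 + 2 * r))
      + η⁻¹ * (η⁻¹) ^ (2 * r) * |a - b| ^ (2 + 2 * r) := by
    rcases le_total |a - b| (η * Z) with h | h
    · calc |a - b| * Z ≤ η * Z * Z := by gcongr
        _ = η * Z ^ 2 := by ring
        _ ≤ η * (9 * (1 + |a| ^ (2 + 2 * r) + |b| ^ (2 + 2 * r))) := by gcongr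
        _ = 9 * η * (1 + |a| ^ (2 + 2 * r) + |b| ^ (2 + 2 * r)) := by ring
        _ ≤ _ := le_add_of_nonneg_right (by positivity)
    · have hw : η ≤ |a - b| := le_trans (by nlinarith) h
      have hw0 : 0 < |a - b| := hη0.trans_le hw
      have hZw : Z ≤ η⁻¹ * |a - b| := by rwa [le_inv_mul_iff₀ hη0]
      have hone : 1 ≤ (η⁻¹) ^ (2 * r) * |a - b| ^ (2 * r) := by
        rw [← Real.mul_rpow (by positivity) hw0.le]
        refine Real.one_le_rpow ?_ (by positivity)
        rwa [le_inv_mul_iff₀ hη0, mul_one]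
      calc |a - b| * Z ≤ |a - b| * (η⁻¹ * |a - b|) := by gcongr
        _ = η⁻¹ * |a - b| ^ 2 * 1 := by ring
        _ ≤ η⁻¹ * |a - b| ^ 2 * ((η⁻¹) ^ (2 * r) * |a - b| ^ (2 * r)) := by gcongr
        _ = η⁻¹ * (η⁻¹) ^ (2 * r) * |a - b| ^ (2 + 2 * r) := by
            rw [Real.rpow_add hw0, Real.rpow_two]
            ring
        _ ≤ _ := le_add_of_nonneg_left (by positivity)
  calc |k a - k b| ≤ C * (|a - b| * Z) := hC a b
    _ ≤ C * (9 * η * (1 + |a| ^ (2 + 2 * r) + |b| ^ (2 + 2 * r))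
      + η⁻¹ * (η⁻¹) ^ (2 * r) * |a - b| ^ (2 + 2 * r)) := by gcongr
    _ = C * (9 * η) * (1 + |a| ^ (2 + 2 * r) + |b| ^ (2 + 2 * r))
      + C * (η⁻¹ * (η⁻¹) ^ (2 * r)) * |a - b| ^ (2 + 2 * r) := by ring
    _ ≤ _ := by gcongr

/-- If both arguments are at most 1 in size, the lower bound `φ' ≥ 1/9` suffices. Otherwise `a² + b²
≥ 1`, so a difference below `√δ` is absorbed by the middle term and a larger one by the power. -/
theorem sq_sub_le_dualMass_add {r : ℝ} (hr : 0 < r) {δ : ℝ} (hδ : 0 < δ) :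
    ∃ C : ℝ, 0 ≤ C ∧ ∀ a b : ℝ, (a - b) ^ 2 ≤ 9 * ((dualMass a - dualMass b) * (a - b))
      + δ * (a ^ 2 + b ^ 2) + C * |a - b| ^ (2 + 2 * r) := by
  set η := √δ with hη
  have hη0 : 0 < η := Real.sqrt_pos.2 hδ
  refine ⟨(η⁻¹) ^ (2 * r), by positivity, fun a b => ?_⟩
  have hmono := dualMass_mono_mul_nonneg a b
  have hw : 0 ≤ (η⁻¹) ^ (2 * r) * |a - b| ^ (2 + 2 * r) := by positivity
  by_cases hab : |a| ≤ 1 ∧ |b| ≤ 1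
  · have h1 := sq_sub_le_dualMass hab.1 hab.2
    have h2 : 0 ≤ δ * (a ^ 2 + b ^ 2) := by positivity
    linarith
  · have hone : 1 ≤ a ^ 2 + b ^ 2 := by
      rw [not_and_or, not_le, not_le] at hab
      rcases hab with h | h
      · nlinarith [sq_abs a, sq_nonneg b]
      · nlinarith [sq_abs b, sq_nonneg a]
    rcases le_total |a - b| η with h | h
    · have h1 : (a - b) ^ 2 ≤ δ := by
        rw [← sq_abs, ← Real.sq_sqrt hδ.le]
        gcongr
      nlinarith
    · have hw0 : 0 < |a - b| := hη0.trans_le h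
      have hone : 1 ≤ (η⁻¹) ^ (2 * r) * |a - b| ^ (2 * r) := by
        rw [← Real.mul_rpow (by positivity) hw0.le]
        refine Real.one_le_rpow ?_ (by positivity)
        rwa [le_inv_mul_iff₀ hη0, mul_one]
      have h1 : (a - b) ^ 2 ≤ (η⁻¹) ^ (2 * r) * |a - b| ^ (2 + 2 * r) := by
        rw [Real.rpow_add hw0, Real.rpow_two, sq_abs]
        nlinarith [sq_nonneg (a - b)]
      have h2 : 0 ≤ δ * (a ^ 2 + b ^ 2) := by positivity
      linarith

/-- A power strictly between `2` and `s` is bounded by a small multiple of the power `s` and a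
multiple of the square. -/
theorem exists_rpow_le_add {p s : ℝ} (hp : 2 < p) (hps : p < s) {η : ℝ} (hη : 0 < η) :
    ∃ C : ℝ, 0 ≤ C ∧ ∀ t : ℝ, |t| ^ p ≤ η * |t| ^ s + C * t ^ 2 := by
  -- The threshold at which `η R^(s-p) = 1`.
  set R := (η⁻¹) ^ (s - p)⁻¹ with hR
  have hR0 : 0 < R := by positivity
  refine ⟨R ^ (p - 2), by positivity, fun t => ?_⟩
  rcases eq_or_ne t 0 with rfl | ht
  · rw [abs_zero, Real.zero_rpow (by linarith), Real.zero_rpow (by linarith)]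
    simp
  have ht0 : 0 < |t| := abs_pos.2 ht
  rcases le_total |t| R with h | h
  · calc |t| ^ p = |t| ^ (p - 2) * t ^ 2 := by
          rw [← sq_abs, ← Real.rpow_two, ← Real.rpow_add ht0, sub_add_cancel]
      _ ≤ R ^ (p - 2) * t ^ 2 := by
          gcongr
      _ ≤ _ := le_add_of_nonneg_left (by positivity)
  · have h1 : η⁻¹ ≤ |t| ^ (s - p) := by
      calc η⁻¹ = R ^ (s - p) := (Real.rpow_inv_rpow (by positivity) (by linarith)).symm
        _ ≤ _ := by
          gcongr
    have h2 : 1 ≤ η * |t| ^ (s - p) := by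
      have := mul_le_mul_of_nonneg_left h1 hη.le
      rwa [mul_inv_cancel₀ hη.ne'] at this
    calc |t| ^ p = 1 * |t| ^ p := (one_mul _).symm
      _ ≤ η * |t| ^ (s - p) * |t| ^ p := by gcongr
      _ = η * |t| ^ s := by rw [mul_assoc, ← Real.rpow_add ht0, sub_add_cancel]
      _ ≤ _ := le_add_of_nonneg_right (by positivity)

theorem tendsto_zero_of_forall_le {x y : ℕ → ℝ} {M : ℝ} (hx : ∀ n, 0 ≤ x n)
    (hy : Tendsto y atTop (𝓝 0))
    (h : ∀ δ : ℝ, 0 < δ → ∃ C : ℝ, ∀ n, x n ≤ δ * M + C * y n) : Tendsto x atTop (𝓝 0) := by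
  rw [Metric.tendsto_atTop]
  intro ε hε
  obtain ⟨C, hC⟩ := h (ε / (2 * (|M| + 1))) (by positivity)
  have h1 : ε / (2 * (|M| + 1)) * M < ε / 2 := by
    rw [div_mul_eq_mul_div, div_lt_div_iff₀ (by positivity) (by positivity)]
    nlinarith [le_abs_self M]
  have h2 := hy.const_mul C
  rw [mul_zero] at h2
  obtain ⟨n₀, hn₀⟩ := eventually_atTop.1 (h2.eventually (gt_mem_nhds (half_pos hε)))
  refine ⟨n₀, fun n hn => ?_⟩
  rw [Real.dist_0_eq_abs, abs_of_nonneg (hx n)]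
  linarith [hC n, hn₀ n hn]

/-! ### Convergence of the lower order terms -/

section LowerOrder

variable {E : Type*} [NormedAddCommGroup E] [InnerProductSpace ℝ E] [FiniteDimensional ℝ E]
  [MeasurableSpace E] [BorelSpace E]

theorem one_lt_critExp (hn : 2 < Module.finrank ℝ E) : 1 < critExp E := by
  have := growthExp_pos hn
  unfold critExp
  linarith

/-- The integrand that controls the lower order terms. -/
noncomputable def interpWeight (a b : H1 E) (x : E) : ℝ :=
  fn a x ^ 2 + fn b x ^ 2 + |fn a x| ^ critExp E + |fn b x| ^ critExp E + fn (a - b) x ^ 2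

theorem interpWeight_nonneg (a b : H1 E) (x : E) : 0 ≤ interpWeight a b x := by
  unfold interpWeight
  positivity

theorem integrable_interpWeight (hn : 2 < Module.finrank ℝ E) (a b : H1 E) :
    Integrable (interpWeight a b) volume :=
  ((((integrable_sq_fn a).add (integrable_sq_fn b)).add (integral_critExp_le hn a).1).add
    (integral_critExp_le hn b).1).add (integrable_sq_fn (a - b))

theorem integral_sq_fn_le {v : H1 E} {M : ℝ} (hv : ‖v‖ ≤ M) : ∫ x, fn v x ^ 2 ≤ M ^ 2 := by
  rw [← norm_sq_fnL]
  have := (norm_fnL_le v).trans hv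
  gcongr

theorem integral_critExp_le_of_norm_le (hn : 2 < Module.finrank ℝ E) {v : H1 E} {M : ℝ}
    (hv : ‖v‖ ≤ M) :
    ∫ x, |fn v x| ^ critExp E ≤ sobConst E * (M ^ 2) ^ growthExp E * M ^ 2 := by
  have hr := (growthExp_pos hn).le
  have hS := sobConst_nonneg (E := E)
  have h1 := (norm_fnL_le v).trans hv
  have h2 := (norm_gradL_le v).trans hv
  exact (integral_critExp_le hn v).2.trans (by gcongr)

theorem integral_interpWeight_le (hn : 2 < Module.finrank ℝ E) {a b : H1 E} {M : ℝ}
    (ha : ‖a‖ ≤ M) (hb : ‖b‖ ≤ M) : ∫ x, interpWeight a b x ≤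
      2 * M ^ 2 + 2 * (sobConst E * (M ^ 2) ^ growthExp E * M ^ 2) + (2 * M) ^ 2 := by
  have i1 := integrable_sq_fn a
  have i2 := integrable_sq_fn b
  have i3 := (integral_critExp_le hn a).1
  have i4 := (integral_critExp_le hn b).1
  have i5 := integrable_sq_fn (a - b)
  have i12 : Integrable (fun x => fn a x ^ 2 + fn b x ^ 2) volume := i1.add i2
  have i123 : Integrable (fun x => fn a x ^ 2 + fn b x ^ 2 + |fn a x| ^ critExp E) volume :=
    i12.add i3
  have i1234 : Integrable (fun x => fn a x ^ 2 + fn b x ^ 2 + |fn a x| ^ critExp E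
      + |fn b x| ^ critExp E) volume := i123.add i4
  unfold interpWeight
  rw [integral_add i1234 i5, integral_add i123 i4, integral_add i12 i3, integral_add i1 i2]
  have hab : ‖a - b‖ ≤ 2 * M := (norm_sub_le a b).trans (by linarith)
  linarith [integral_sq_fn_le ha, integral_sq_fn_le hb, integral_sq_fn_le hab,
    integral_critExp_le_of_norm_le hn ha, integral_critExp_le_of_norm_le hn hb]

/-- The common scheme of the limits below: integrals that stay bounded carry an arbitrarily small
coefficient `δ`, and the one that tends to zero may carry a large `C`. The function `G` leaves room
for a weight that does not depend on `n`. -/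
theorem tendsto_integral_of_abs_le
    (hn : 2 < Module.finrank ℝ E) {v : ℕ → H1 E} {w : H1 E} {M : ℝ} (hv : ∀ n, ‖v n‖ ≤ M)
    (hw : ‖w‖ ≤ M) (hvw : Tendsto (fun n => ∫ x, |fn (v n - w) x| ^ critExp E) atTop (𝓝 0))
    {G : E → ℝ} (hG : Integrable G volume) {F : ℕ → E → ℝ}
    (hF : ∀ δ : ℝ, 0 < δ → ∃ C : ℝ, ∀ n, ∀ᵐ x, |F n x| ≤
      δ * (G x + interpWeight (v n) w x) + C * |fn (v n - w) x| ^ critExp E) :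
    Tendsto (fun n => ∫ x, F n x) atTop (𝓝 0) := by
  rw [tendsto_zero_iff_abs_tendsto_zero]
  refine tendsto_zero_of_forall_le (M := (∫ x, G x) + (2 * M ^ 2
      + 2 * (sobConst E * (M ^ 2) ^ growthExp E * M ^ 2) + (2 * M) ^ 2))
    (fun n => abs_nonneg _) hvw fun δ hδ => ?_
  obtain ⟨C, hC⟩ := hF δ hδ
  refine ⟨C, fun n => ?_⟩
  have i1 : Integrable (fun x => G x + interpWeight (v n) w x) volume :=
    hG.add (integrable_interpWeight hn _ _)
  have i2 := (integral_critExp_le hn (v n - w)).1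
  have i3 : Integrable (fun x => δ * (G x + interpWeight (v n) w x)
    + C * |fn (v n - w) x| ^ critExp E) volume := (i1.const_mul δ).add (i2.const_mul C)
  have h1 : ‖∫ x, F n x‖ ≤ _ := norm_integral_le_of_norm_le i3 (hC n)
  rw [integral_add (i1.const_mul δ) (i2.const_mul C), integral_const_mul, integral_const_mul,
    integral_add hG (integrable_interpWeight hn _ _)] at h1
  have h2 := integral_interpWeight_le hn (hv n) hw
  refine h1.trans ?_
  gcongr

/-- The `L²` part carries an arbitrarily small coefficient because `k` is `o(t)` at zero, so no `L²`
convergence of `v n` is required. -/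
theorem tendsto_integral_subcritical_mul_sub
    (hn : 2 < Module.finrank ℝ E) {v : ℕ → H1 E} {w : H1 E} {M : ℝ} (hv : ∀ n, ‖v n‖ ≤ M)
    (hw : ‖w‖ ≤ M) (hvw : Tendsto (fun n => ∫ x, |fn (v n - w) x| ^ critExp E) atTop (𝓝 0))
    {k : ℝ → ℝ} (hk : IsSubcritical (critExp E) k) :
    Tendsto (fun n => ∫ x, k (fn (v n) x) * fn (v n - w) x) atTop (𝓝 0) := by
  refine tendsto_integral_of_abs_le hn hv hw hvw (G := fun _ => (0 : ℝ))
      (integrable_zero E ℝ volume) fun δ hδ => ?_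
  obtain ⟨C, _, hC⟩ := hk.mul_le (one_lt_critExp hn) hδ
  refine ⟨C, fun n => Eventually.of_forall fun x => (hC _ _).trans ?_⟩
  have h1 : fn (v n) x ^ 2 + |fn (v n) x| ^ critExp E + fn (v n - w) x ^ 2
      ≤ 0 + interpWeight (v n) w x := by
    unfold interpWeight
    have : 0 ≤ |fn w x| ^ critExp E := by positivity
    nlinarith [sq_nonneg (fn w x)]
  gcongr

theorem tendsto_integral_primitive_of_subcritical
    (hn : 2 < Module.finrank ℝ E) {v : ℕ → H1 E} {w : H1 E} {M : ℝ} (hv : ∀ n, ‖v n‖ ≤ M)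
    (hw : ‖w‖ ≤ M) (hvw : Tendsto (fun n => ∫ x, |fn (v n - w) x| ^ critExp E) atTop (𝓝 0))
    {k K : ℝ → ℝ} (hk : IsGrowth (growthExp E) k)
    (hks : IsSubcritical (critExp E) k) (hK : ∀ t, HasDerivAt K (k t) t) (hK0 : K 0 = 0) :
    Tendsto (fun n => ∫ x, K (fn (v n) x)) atTop (𝓝 (∫ x, K (fn w x))) := by
  have key : Tendsto (fun n => ∫ x, (K (fn (v n) x) - K (fn w x))) atTop (𝓝 0) := by
    refine tendsto_integral_of_abs_le hn hv hw hvw (G := fun _ => (0 : ℝ))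
      (integrable_zero E ℝ volume) fun δ hδ => ?_
    obtain ⟨C, _, hC⟩ := hks.primitive_sub_le (one_lt_critExp hn) hK hδ
    refine ⟨C, fun n => ?_⟩
    filter_upwards [fn_sub (v n) w] with x hx
    rw [interpWeight, hx, zero_add]
    exact hC _ _
  have h1 := key.add_const (∫ x, K (fn w x))
  rw [zero_add] at h1
  refine h1.congr fun n => ?_
  rw [integral_sub (integrable_primitive hn hk hK hK0 _) (integrable_primitive hn hk hK hK0 _),
    sub_add_cancel]

theorem tendsto_inner_nem_sub_toLp
    (hn : 2 < Module.finrank ℝ E) {v : ℕ → H1 E} {w : H1 E} {M : ℝ} (hv : ∀ n, ‖v n‖ ≤ M)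
    (hw : ‖w‖ ≤ M) (hvw : Tendsto (fun n => ∫ x, |fn (v n - w) x| ^ critExp E) atTop (𝓝 0))
    {k : ℝ → ℝ} (hk : IsGrowth (growthExp E) k) {g : E → ℝ}
    (hgc : Continuous g) (hgs : HasCompactSupport g) (hg : MemLp g 2 volume) :
    Tendsto (fun n => inner ℝ (nem hn hk (v n) - nem hn hk w) (hg.toLp g)) atTop (𝓝 0) := by
  have key : Tendsto (fun n => ∫ x, (k (fn (v n) x) - k (fn w x)) * g x) atTop (𝓝 0) := by
    obtain ⟨R, hR⟩ := hgs.exists_bound_of_continuous hgc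
    have hR0 : 0 ≤ R := (norm_nonneg _).trans (hR 0)
    refine tendsto_integral_of_abs_le hn hv hw hvw
      (hgc.integrable_of_hasCompactSupport hgs).norm fun δ hδ => ?_
    obtain ⟨C, hC0, hC⟩ := hk.sub_le (growthExp_pos hn) (δ := δ / (R + 1)) (by positivity)
    refine ⟨C * R, fun n => ?_⟩
    filter_upwards [fn_sub (v n) w] with x hx
    have h1 : |k (fn (v n) x) - k (fn w x)| ≤ δ / (R + 1) * (1 + |fn (v n) x| ^ critExp E
        + |fn w x| ^ critExp E) + C * |fn (v n) x - fn w x| ^ critExp E := hC _ _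
    have h2 : δ / (R + 1) ≤ δ := div_le_self hδ.le (by linarith)
    have h3 : δ / (R + 1) * R ≤ δ := by
      rw [div_mul_eq_mul_div, div_le_iff₀ (by positivity)]
      nlinarith
    have hgx : |g x| ≤ R := hR x
    have hW : |fn (v n) x| ^ critExp E + |fn w x| ^ critExp E ≤ interpWeight (v n) w x := by
      unfold interpWeight
      nlinarith [sq_nonneg (fn (v n) x), sq_nonneg (fn w x), sq_nonneg (fn (v n - w) x)]
    have hW0 : 0 ≤ |fn (v n) x| ^ critExp E + |fn w x| ^ critExp E := by positivity
    rw [abs_mul, hx, Real.norm_eq_abs]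
    calc |k (fn (v n) x) - k (fn w x)| * |g x|
        ≤ (δ / (R + 1) * (1 + |fn (v n) x| ^ critExp E + |fn w x| ^ critExp E)
          + C * |fn (v n) x - fn w x| ^ critExp E) * |g x| := by gcongr
      _ = δ / (R + 1) * |g x| + δ / (R + 1) * |g x| * (|fn (v n) x| ^ critExp E
          + |fn w x| ^ critExp E) + C * |g x| * |fn (v n) x - fn w x| ^ critExp E := by ring
      _ ≤ δ * |g x| + δ / (R + 1) * R * (|fn (v n) x| ^ critExp E
          + |fn w x| ^ critExp E) + C * R * |fn (v n) x - fn w x| ^ critExp E := by gcongr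
      _ ≤ δ * |g x| + δ * interpWeight (v n) w x
          + C * R * |fn (v n) x - fn w x| ^ critExp E := by gcongr
      _ = _ := by ring
  refine key.congr fun n => ?_
  rw [L2.inner_def]
  apply integral_congr_ae
  filter_upwards [hg.coeFn_toLp, Lp.coeFn_sub (nem hn hk (v n)) (nem hn hk w),
    coe_nem hn hk (v n), coe_nem hn hk w] with x h1 h2 h3 h4
  rw [h1, h2, Pi.sub_apply, h3, h4]
  simp [mul_comm]

/-- The superposition operator is bounded on bounded sets, so it suffices to test with the dense set
of compactly supported continuous functions. -/
theorem tendsto_inner_nem_sub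
    (hn : 2 < Module.finrank ℝ E) {v : ℕ → H1 E} {w : H1 E} {M : ℝ} (hv : ∀ n, ‖v n‖ ≤ M)
    (hw : ‖w‖ ≤ M) (hvw : Tendsto (fun n => ∫ x, |fn (v n - w) x| ^ critExp E) atTop (𝓝 0))
    {k : ℝ → ℝ} (hk : IsGrowth (growthExp E) k)
    (h : Lp ℝ 2 (volume : Measure E)) :
    Tendsto (fun n => inner ℝ (nem hn hk (v n) - nem hn hk w) h) atTop (𝓝 0) := by
  obtain ⟨C, hC0, hC⟩ := hk.bound
  set B := C * √(3 * (1 + sobConst E) * (1 + 2 * (M ^ 2) ^ growthExp E)) * (2 * M) with hB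
  have hM0 : 0 ≤ M := (norm_nonneg w).trans hw
  have hB0 : 0 ≤ B := by positivity
  have hbd : ∀ n, ‖nem hn hk (v n) - nem hn hk w‖ ≤ B := by
    intro n
    have h1 := norm_nem_sub_le hn hk hC0 hC (v n) w
    have h2 := growthConst_le hn (hv n) hw
    have h3 : ‖v n - w‖ ≤ 2 * M := (norm_sub_le _ _).trans (by linarith [hv n])
    refine h1.trans ?_
    rw [hB]
    gcongr
  rw [Metric.tendsto_atTop]
  intro ε hε
  obtain ⟨g, hgs, hgε, hgc, hg⟩ := (Lp.memLp h).exists_hasCompactSupport_eLpNorm_sub_le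
    (by norm_num) (ε := ENNReal.ofReal (ε / (2 * (B + 1))))
    (by rw [Ne, ENNReal.ofReal_eq_zero, not_le]; positivity)
  have hsub : ‖h - hg.toLp g‖ ≤ ε / (2 * (B + 1)) := by
    have h1 : ‖h - hg.toLp g‖ = (eLpNorm ((h : E → ℝ) - g) 2 volume).toReal := by
      rw [Lp.norm_def]
      congr 1
      apply eLpNorm_congr_ae
      filter_upwards [Lp.coeFn_sub h (hg.toLp g), hg.coeFn_toLp] with x h1 h2
      rw [h1, Pi.sub_apply, Pi.sub_apply, h2]
    rw [h1]
    exact ENNReal.toReal_le_of_le_ofReal (by positivity) hgε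
  have h0 := tendsto_inner_nem_sub_toLp hn hv hw hvw hk hgc hgs hg
  obtain ⟨n₀, hn₀⟩ := Metric.tendsto_atTop.1 h0 (ε / 2) (half_pos hε)
  refine ⟨n₀, fun n hnn => ?_⟩
  have h2 := hn₀ n hnn
  rw [Real.dist_0_eq_abs] at h2 ⊢
  have h3 : inner ℝ (nem hn hk (v n) - nem hn hk w) h
      = inner ℝ (nem hn hk (v n) - nem hn hk w) (hg.toLp g)
        + inner ℝ (nem hn hk (v n) - nem hn hk w) (h - hg.toLp g) := by
    rw [← inner_add_right, add_sub_cancel]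
  have h4 : |inner ℝ (nem hn hk (v n) - nem hn hk w) (h - hg.toLp g)| ≤ ε / 2 := by
    refine (abs_real_inner_le_norm _ _).trans ?_
    calc _ ≤ B * (ε / (2 * (B + 1))) := mul_le_mul (hbd n) hsub (norm_nonneg _) hB0
      _ ≤ ε / 2 := by
        rw [mul_div_assoc', div_le_div_iff₀ (by positivity) (by positivity)]
        nlinarith
  rw [h3]
  exact (abs_add_le _ _).trans_lt (by linarith)

theorem tendsto_integral_growth_mul
    (hn : 2 < Module.finrank ℝ E) {v : ℕ → H1 E} {w : H1 E} {M : ℝ} (hv : ∀ n, ‖v n‖ ≤ M)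
    (hw : ‖w‖ ≤ M) (hvw : Tendsto (fun n => ∫ x, |fn (v n - w) x| ^ critExp E) atTop (𝓝 0))
    {k : ℝ → ℝ} (hk : IsGrowth (growthExp E) k) (h : H1 E) :
    Tendsto (fun n => ∫ x, k (fn (v n) x) * fn h x) atTop (𝓝 (∫ x, k (fn w x) * fn h x)) := by
  have h1 := (tendsto_inner_nem_sub hn hv hw hvw hk (fnL h)).add_const
    (inner ℝ (nem hn hk w) (fnL h))
  rw [zero_add] at h1
  simp only [inner_sub_left, sub_add_cancel, inner_nem] at h1
  exact h1

theorem tendsto_fnL_of_dualMass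
    (hn : 2 < Module.finrank ℝ E) {v : ℕ → H1 E} {w : H1 E} {M : ℝ} (hv : ∀ n, ‖v n‖ ≤ M)
    (hw : ‖w‖ ≤ M) (hvw : Tendsto (fun n => ∫ x, |fn (v n - w) x| ^ critExp E) atTop (𝓝 0))
    (hm : Tendsto (fun n => ∫ x,
      (dualMass (fn (v n) x) - dualMass (fn w x)) * fn (v n - w) x) atTop (𝓝 0)) :
    Tendsto (fun n => ‖fnL (v n - w)‖ ^ 2) atTop (𝓝 0) := by
  have hiP : ∀ n, Integrable (fun x =>
      (dualMass (fn (v n) x) - dualMass (fn w x)) * fn (v n - w) x) volume := fun n =>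
    ((memLp_nem hn isGrowth_dualMass (v n)).sub (memLp_nem hn isGrowth_dualMass w)).integrable_mul
      (memLp_fn (v n - w))
  have hi : ∀ n, Integrable (fun x => fn (v n - w) x ^ 2
      - 9 * ((dualMass (fn (v n) x) - dualMass (fn w x)) * fn (v n - w) x)) volume := fun n =>
    (integrable_sq_fn _).sub ((hiP n).const_mul 9)
  -- The pointwise inequality bounds the excess over the monotone term from above only; its positive
  -- part is bounded on both sides.
  have key : Tendsto (fun n => ∫ x, max (fn (v n - w) x ^ 2
      - 9 * ((dualMass (fn (v n) x) - dualMass (fn w x)) * fn (v n - w) x)) 0) atTop (𝓝 0) := by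
    refine tendsto_integral_of_abs_le hn hv hw hvw (G := fun _ => (0 : ℝ))
      (integrable_zero E ℝ volume) fun δ hδ => ?_
    obtain ⟨C, hC0, hC⟩ := sq_sub_le_dualMass_add (growthExp_pos hn) hδ
    refine ⟨C, fun n => ?_⟩
    filter_upwards [fn_sub (v n) w] with x hx
    have h1 : (fn (v n) x - fn w x) ^ 2 ≤ 9 * ((dualMass (fn (v n) x) - dualMass (fn w x)) *
      (fn (v n) x - fn w x)) + δ * (fn (v n) x ^ 2 + fn w x ^ 2)
      + C * |fn (v n) x - fn w x| ^ critExp E := hC _ _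
    have h2 : fn (v n) x ^ 2 + fn w x ^ 2 ≤ 0 + interpWeight (v n) w x := by
      unfold interpWeight
      have e1 : 0 ≤ |fn w x| ^ critExp E := by positivity
      have e2 : 0 ≤ |fn (v n) x| ^ critExp E := by positivity
      nlinarith [sq_nonneg (fn (v n - w) x)]
    have h3 := mul_le_mul_of_nonneg_left h2 hδ.le
    have h4 : 0 ≤ C * |fn (v n) x - fn w x| ^ critExp E := by positivity
    have h5 : 0 ≤ δ * (0 + interpWeight (v n) w x) :=
      mul_nonneg hδ.le (by rw [zero_add]; exact interpWeight_nonneg _ _ _)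
    rw [abs_of_nonneg (le_max_right _ _), hx]
    apply max_le
    · change _ ≤ δ * (0 + interpWeight (v n) w x) + _
      linarith
    · exact add_nonneg h5 h4
  have hsum := key.add (hm.const_mul 9)
  rw [mul_zero, add_zero] at hsum
  refine squeeze_zero (fun n => by positivity) (fun n => ?_) hsum
  rw [norm_sq_fnL, ← integral_const_mul, ← integral_add (hi n).pos_part ((hiP n).const_mul 9)]
  refine integral_mono (integrable_sq_fn _) ((hi n).pos_part.add ((hiP n).const_mul 9)) fun x => ?_
  have := le_max_left (fn (v n - w) x ^ 2
      - 9 * ((dualMass (fn (v n) x) - dualMass (fn w x)) * fn (v n - w) x)) 0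
  show _ ≤ max _ _ + _
  linarith

end LowerOrder

/-! ### The Palais–Smale condition -/

theorem constrainedDerivNorm_ne_top {X : Type*} [NormedAddCommGroup X] [NormedSpace ℝ X]
    (F : X → ℝ) (M : Set X) (v : X) : constrainedDerivNorm F M v ≠ ⊤ := by
  refine ne_top_of_le_ne_top (b := ENNReal.ofReal ‖fderiv ℝ F v‖) ENNReal.ofReal_ne_top ?_
  refine iSup₂_le fun h hh => ?_
  rw [← ofReal_norm]
  apply ENNReal.ofReal_le_ofReal
  exact ((fderiv ℝ F v).le_opNorm h).trans
    (mul_le_of_le_one_right (norm_nonneg _) hh.2)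

section PalaisSmale

variable {E : Type*} [NormedAddCommGroup E] [InnerProductSpace ℝ E] [FiniteDimensional ℝ E]
  [MeasurableSpace E] [BorelSpace E]

theorem one_div_mul_abs_dualChange_zero_rpow {p : ℝ} (hp : 2 < p) :
    1 / p * |dualChange 0| ^ p = 0 := by
  rw [dualChange_zero, abs_zero, Real.zero_rpow (by linarith), mul_zero]

theorem dualEnergy_eq (p : ℝ) (v : H1 E) : dualEnergy p v =
    1 / 2 * ‖gradL v‖ ^ 2 - ∫ x, 1 / p * |dualChange (fn v x)| ^ p := by
  rw [dualEnergy, norm_sq_gradL, integral_const_mul]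

theorem hasFDerivAt_dualEnergy (hn : 2 < Module.finrank ℝ E) {p : ℝ} (hp2 : 2 < p)
    (hk : IsGrowth (growthExp E) (dualPower p)) (v : H1 E) :
    HasFDerivAt (dualEnergy p) ((innerSL ℝ (gradL v)).comp gradL
      - (innerSL ℝ (nem hn hk v)).comp fnL) v := by
  have h1 : HasFDerivAt (fun v : H1 E => 1 / 2 * ‖gradL v‖ ^ 2)
      ((innerSL ℝ (gradL v)).comp gradL) v := by
    refine (((gradL (E := E)).hasFDerivAt (x := v)).norm_sq.const_mul (1 / 2)).congr_fderiv ?_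
    ext h
    simp
  have h2 := h1.sub (hasFDerivAt_integral_primitive hn hk (hasDerivAt_abs_dualChange_rpow hp2)
    (one_div_mul_abs_dualChange_zero_rpow hp2) v)
  have h3 : dualEnergy p = fun v : H1 E =>
      1 / 2 * ‖gradL v‖ ^ 2 - ∫ x, 1 / p * |dualChange (fn v x)| ^ p := funext (dualEnergy_eq p)
  rw [h3]
  exact h2

theorem contDiff_dualEnergy (hn : 2 < Module.finrank ℝ E) {p : ℝ} (hp2 : 2 < p)
    (hk : IsGrowth (growthExp E) (dualPower p)) : ContDiff ℝ 1 (dualEnergy (E := E) p) := by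
  have h1 : dualEnergy p = fun v : H1 E =>
      1 / 2 * ‖gradL v‖ ^ 2 - ∫ x, 1 / p * |dualChange (fn v x)| ^ p := funext (dualEnergy_eq p)
  rw [h1]
  have h2 : ContDiff ℝ 1 fun v : H1 E => ‖gradL v‖ ^ 2 :=
    ContDiff.norm_sq ℝ (ContinuousLinearMap.contDiff (gradL (E := E)))
  have h3 : ContDiff ℝ 1 fun v : H1 E => 1 / 2 * ‖gradL v‖ ^ 2 := contDiff_const.mul h2
  exact h3.sub (contDiff_integral_primitive hn hk (hasDerivAt_abs_dualChange_rpow hp2)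
    (one_div_mul_abs_dualChange_zero_rpow hp2))

theorem fderiv_dualEnergy (hn : 2 < Module.finrank ℝ E) {p : ℝ} (hp2 : 2 < p)
    (hk : IsGrowth (growthExp E) (dualPower p)) (v h : H1 E) :
    fderiv ℝ (dualEnergy p) v h =
      inner ℝ (gradL v) (gradL h) - ∫ x, dualPower p (fn v x) * fn h x := by
  rw [(hasFDerivAt_dualEnergy hn hp2 hk v).fderiv, ← inner_nem hn hk]
  rfl

/-- The functional `v ↦ ∫ |f(v)|²` that defines the constraint. -/
noncomputable def massFunctional (v : H1 E) : ℝ := ∫ x, dualChange (fn v x) ^ 2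

theorem massConstraint_eq (lam : ℝ) :
    massConstraint lam = {v : H1 E | massFunctional v = lam} := by
  ext v
  simp only [massConstraint, massFunctional, sq_abs, mem_ofPred_eq]

/-- The derivative is written as a sum to match the form that `IsGrowth.add_smul` produces in
`isGrowth_two_dualMass`. -/
theorem hasDerivAt_sq_dualChange_add (t : ℝ) :
    HasDerivAt (fun t => dualChange t ^ 2) (dualMass t + 1 * dualMass t) t :=
  (hasDerivAt_sq_dualChange t).congr_deriv (by ring)

theorem isGrowth_two_dualMass {r : ℝ} : IsGrowth r fun t => dualMass t + 1 * dualMass t :=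
  isGrowth_dualMass.add_smul isGrowth_dualMass 1

theorem sq_dualChange_zero : dualChange 0 ^ 2 = 0 := by
  rw [dualChange_zero, zero_pow two_ne_zero]

theorem contDiff_massFunctional (hn : 2 < Module.finrank ℝ E) :
    ContDiff ℝ 1 (massFunctional (E := E)) :=
  contDiff_integral_primitive hn isGrowth_two_dualMass hasDerivAt_sq_dualChange_add
    sq_dualChange_zero

theorem integrable_sq_dualChange (hn : 2 < Module.finrank ℝ E) (v : H1 E) :
    Integrable (fun x => dualChange (fn v x) ^ 2) volume :=
  integrable_primitive hn isGrowth_two_dualMass hasDerivAt_sq_dualChange_add sq_dualChange_zero v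

theorem integrable_dualMass_mul (hn : 2 < Module.finrank ℝ E) (v h : H1 E) :
    Integrable (fun x => dualMass (fn v x) * fn h x) volume :=
  (memLp_nem hn isGrowth_dualMass v).integrable_mul (memLp_fn h)

theorem fderiv_massFunctional_eq_inner (hn : 2 < Module.finrank ℝ E) (v h : H1 E) :
    fderiv ℝ massFunctional v h = inner ℝ (nem hn isGrowth_two_dualMass v) (fnL h) := by
  have h1 : HasFDerivAt massFunctional _ v := hasFDerivAt_integral_primitive hn
    isGrowth_two_dualMass hasDerivAt_sq_dualChange_add sq_dualChange_zero v
  rw [h1.fderiv]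
  rfl

theorem fderiv_massFunctional (hn : 2 < Module.finrank ℝ E) (v h : H1 E) :
    fderiv ℝ massFunctional v h = 2 * ∫ x, dualMass (fn v x) * fn h x := by
  rw [fderiv_massFunctional_eq_inner hn, inner_nem, ← integral_const_mul]
  congr 1
  funext x
  ring

/-- On the constraint the radial direction `v` is transversal, with derivative at least `λ`. This
bounds the Lagrange multipliers uniformly. -/
theorem massFunctional_le_fderiv (hn : 2 < Module.finrank ℝ E) (v : H1 E) :
    massFunctional v ≤ fderiv ℝ massFunctional v v := by
  rw [fderiv_massFunctional hn, ← integral_const_mul]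
  exact integral_mono (integrable_sq_dualChange hn v) ((integrable_dualMass_mul hn v v).const_mul 2)
    fun x => half_sq_dualChange_le _

theorem exists_norm_nem_le (hn : 2 < Module.finrank ℝ E) {k : ℝ → ℝ}
    (hk : IsGrowth (growthExp E) k) {M : ℝ} (hM : 0 ≤ M) :
    ∃ B : ℝ, 0 ≤ B ∧ ∀ v : H1 E, ‖v‖ ≤ M → ‖nem hn hk v‖ ≤ B := by
  obtain ⟨C, hC0, hC⟩ := hk.bound
  refine ⟨‖nem hn hk 0‖ + C * √(3 * (1 + sobConst E) * (1 + 2 * (M ^ 2) ^ growthExp E)) * M,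
    by positivity, fun v hv => ?_⟩
  have h1 := norm_nem_sub_le hn hk hC0 hC v 0
  have h2 := growthConst_le hn hv (b := 0) (by simpa using hM)
  rw [sub_zero] at h1
  have h3 := norm_le_norm_add_norm_sub' (nem hn hk v) (nem hn hk 0)
  refine h3.trans ?_
  gcongr
  exact h1.trans (by gcongr)

/-- The interpolation inequality with `a = f(v)²`, after `|f|^(4 + 2r) = (f²)ʳ f⁴ ≤ 2 (f²)ʳ v²`. The
bound involves the prescribed mass and not the unknown `L²` norm of `v`. -/
theorem integral_dualChange_rpow_le (hn : 2 < Module.finrank ℝ E) (v : H1 E) :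
    Integrable (fun x => |dualChange (fn v x)| ^ (4 + 2 * growthExp E)) volume ∧
      ∫ x, |dualChange (fn v x)| ^ (4 + 2 * growthExp E) ≤
        2 * (sobConst E * massFunctional v ^ growthExp E * ‖gradL v‖ ^ 2) := by
  have hr := growthExp_pos hn
  obtain ⟨h1, h2⟩ := integral_rpow_mul_sq_le hn v (fun x => sq_nonneg (dualChange (fn v x)))
    (integrable_sq_dualChange hn v)
  have hle : ∀ x, |dualChange (fn v x)| ^ (4 + 2 * growthExp E) ≤
      2 * ((dualChange (fn v x) ^ 2) ^ growthExp E * fn v x ^ 2) := by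
    intro x
    have e1 : |dualChange (fn v x)| ^ (4 + 2 * growthExp E)
        = (dualChange (fn v x) ^ 2) ^ growthExp E * dualChange (fn v x) ^ 4 := by
      rw [Real.rpow_add_of_nonneg (abs_nonneg _) (by norm_num) (by positivity),
        Real.rpow_mul (abs_nonneg _), Real.rpow_two, sq_abs, mul_comm]
      norm_cast
      rw [Even.pow_abs (by decide)]
    rw [e1]
    have e2 := dualChange_pow_four_le (fn v x)
    have e3 : 0 ≤ (dualChange (fn v x) ^ 2) ^ growthExp E := by positivity
    nlinarith
  have hcont : Continuous fun t => |dualChange t| ^ (4 + 2 * growthExp E) :=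
    continuous_dualChange.abs.rpow_const fun _ => Or.inr (by positivity)
  have hi : Integrable (fun x => |dualChange (fn v x)| ^ (4 + 2 * growthExp E)) volume := by
    refine (h1.const_mul 2).mono' (hcont.comp_aestronglyMeasurable (memLp_fn v).1)
      (Eventually.of_forall fun x => ?_)
    rw [Real.norm_of_nonneg (by positivity)]
    exact hle x
  refine ⟨hi, (integral_mono hi (h1.const_mul 2) hle).trans ?_⟩
  rw [integral_const_mul]
  exact mul_le_mul_of_nonneg_left h2 zero_le_two

/-- Sublevel sets of the energy are bounded on the constraint, in the mass subcritical range. -/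
theorem exists_norm_le_of_dualEnergy_le (hn : 2 < Module.finrank ℝ E) {p : ℝ} (hp2 : 2 < p)
    (hp : p < 4 + 2 * growthExp E) (lam B : ℝ) (hlam : 0 ≤ lam) :
    ∃ M : ℝ, 0 ≤ M ∧ ∀ v : H1 E, massFunctional v = lam → dualEnergy p v ≤ B → ‖v‖ ≤ M := by
  have hr := growthExp_pos hn
  have hS := sobConst_nonneg (E := E)
  set A := 2 * (sobConst E * lam ^ growthExp E) with hA
  have hA0 : 0 ≤ A := by positivity
  -- This `η` makes the power term at most `¼ ‖∇v‖²` plus a constant, leaving a quarter of the `½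
  -- ‖∇v‖²` in the energy.
  obtain ⟨C, hC0, hC⟩ := exists_rpow_le_add hp2 hp (η := 1 / (4 * (A + 1))) (by positivity)
  refine ⟨√(3 * lam + 2 * A * (4 * (|B| + C * lam))) + √(4 * (|B| + C * lam)), by positivity,
    fun v hvl hvB => ?_⟩
  obtain ⟨i4, h4⟩ := integral_dualChange_rpow_le hn v
  rw [hvl] at h4
  have h4' : ∫ x, |dualChange (fn v x)| ^ (4 + 2 * growthExp E) ≤ A * ‖gradL v‖ ^ 2 := by
    rw [hA]
    linarith
  have i2 := integrable_sq_dualChange hn v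
  have hm : ∫ x, dualChange (fn v x) ^ 2 = lam := hvl
  have hpow : ∫ x, |dualChange (fn v x)| ^ p ≤ 1 / 4 * ‖gradL v‖ ^ 2 + C * lam := by
    have h1 : ∫ x, |dualChange (fn v x)| ^ p ≤ ∫ x, (1 / (4 * (A + 1)) *
        |dualChange (fn v x)| ^ (4 + 2 * growthExp E) + C * dualChange (fn v x) ^ 2) :=
      integral_mono_of_nonneg (Eventually.of_forall fun x => by positivity)
        ((i4.const_mul _).add (i2.const_mul C)) (Eventually.of_forall fun x => hC _)
    rw [integral_add (i4.const_mul _) (i2.const_mul C), integral_const_mul, integral_const_mul,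
      hm] at h1
    have h2 : 1 / (4 * (A + 1)) * ∫ x, |dualChange (fn v x)| ^ (4 + 2 * growthExp E)
        ≤ 1 / 4 * ‖gradL v‖ ^ 2 := by
      calc _ ≤ 1 / (4 * (A + 1)) * (A * ‖gradL v‖ ^ 2) := by gcongr
        _ = A / (A + 1) * (1 / 4 * ‖gradL v‖ ^ 2) := by field_simp
        _ ≤ 1 * (1 / 4 * ‖gradL v‖ ^ 2) := by
            gcongr
            rw [div_le_one (by positivity)]
            linarith
        _ = _ := one_mul _
    linarith
  have hgrad : ‖gradL v‖ ^ 2 ≤ 4 * (|B| + C * lam) := by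
    rw [dualEnergy_eq, integral_const_mul] at hvB
    have h1 : 0 ≤ ∫ x, |dualChange (fn v x)| ^ p := integral_nonneg fun x => by positivity
    have h2 : 1 / p * ∫ x, |dualChange (fn v x)| ^ p ≤ ∫ x, |dualChange (fn v x)| ^ p := by
      apply mul_le_of_le_one_left h1
      rw [div_le_one (by linarith)]
      linarith
    have h3 := le_abs_self B
    linarith
  -- From `t² ≤ f² + 2f⁴` and `f⁴ ≤ f² + |f|^(4 + 2r)`; the mass does not bound the `L²` norm
  -- without the gradient.
  have hfn : ‖fnL v‖ ^ 2 ≤ 3 * lam + 2 * A * (4 * (|B| + C * lam)) := by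
    have hle : ∀ x, fn v x ^ 2 ≤
        3 * dualChange (fn v x) ^ 2 + 2 * |dualChange (fn v x)| ^ (4 + 2 * growthExp E) := by
      intro x
      have h1 := sq_le_dualChange (fn v x)
      have h2 : dualChange (fn v x) ^ 4 ≤
          dualChange (fn v x) ^ 2 + |dualChange (fn v x)| ^ (4 + 2 * growthExp E) := by
        rcases le_total |dualChange (fn v x)| 1 with h | h
        · have h3 : dualChange (fn v x) ^ 2 ≤ 1 := (sq_le_one_iff_abs_le_one _).2 h
          have h4 : 0 ≤ |dualChange (fn v x)| ^ (4 + 2 * growthExp E) := by positivity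
          nlinarith [sq_nonneg (dualChange (fn v x))]
        · have h3 : |dualChange (fn v x)| ^ (4 : ℝ) ≤
              |dualChange (fn v x)| ^ (4 + 2 * growthExp E) :=
            Real.rpow_le_rpow_of_exponent_le h (by linarith)
          have h4 : |dualChange (fn v x)| ^ (4 : ℝ) = dualChange (fn v x) ^ 4 := by
            norm_cast
            rw [Even.pow_abs (by decide)]
          rw [h4] at h3
          nlinarith [sq_nonneg (dualChange (fn v x))]
      linarith
    have h1 := integral_mono (integrable_sq_fn v) ((i2.const_mul 3).add (i4.const_mul 2)) hle
    have h2 : ∫ x, (3 * dualChange (fn v x) ^ 2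
        + 2 * |dualChange (fn v x)| ^ (4 + 2 * growthExp E)) =
        3 * lam + 2 * ∫ x, |dualChange (fn v x)| ^ (4 + 2 * growthExp E) := by
      rw [integral_add (i2.const_mul 3) (i4.const_mul 2), integral_const_mul, integral_const_mul,
        hm]
    rw [norm_sq_fnL]
    refine h1.trans (h2.le.trans ?_)
    have h5 : A * ‖gradL v‖ ^ 2 ≤ A * (4 * (|B| + C * lam)) := by gcongr
    linarith
  exact (norm_H1_le v).trans (add_le_add (Real.le_sqrt_of_sq_le hfn)
    (Real.le_sqrt_of_sq_le hgrad))

/-- On bounded subsets of the constraint, almost critical points solve the Lagrange equation up to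
a small error, with a bounded multiplier. -/
theorem exists_multiplier (hn : 2 < Module.finrank ℝ E) (S : Submodule ℝ (H1 E)) {p : ℝ}
    (hp2 : 2 < p) (hk : IsGrowth (growthExp E) (dualPower p)) {lam M : ℝ} (hlam : 0 < lam)
    (hM : 0 ≤ M) : ∃ B : ℝ, ∀ v ∈ S, massFunctional v = lam → ‖v‖ ≤ M → ∃ μ : ℝ, |μ| ≤ B ∧
      ∀ h ∈ S, |inner ℝ (gradL v) (gradL h) - (∫ x, dualPower p (fn v x) * fn h x)
        - μ * (2 * ∫ x, dualMass (fn v x) * fn h x)| ≤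
        (constrainedDerivNorm (dualEnergy p) ((S : Set (H1 E)) ∩ massConstraint lam) v).toReal
          * (B * ‖h‖) := by
  obtain ⟨B₁, hB₁, hg⟩ := exists_norm_nem_le hn hk hM
  obtain ⟨B₂, hB₂, hφ⟩ := exists_norm_nem_le hn (isGrowth_two_dualMass (r := growthExp E)) hM
  refine ⟨max ((M * M + B₁ * M) / lam) (1 + B₂ / lam * M), fun v hvS hvl hvM => ?_⟩
  have hD : lam ≤ fderiv ℝ massFunctional v v := hvl ▸ massFunctional_le_fderiv hn v
  have hD0 : 0 < fderiv ℝ massFunctional v v := hlam.trans_le hD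
  -- The multiplier is fixed by testing in the direction `v`, where `Ψ'(v)v ≥ λ`.
  refine ⟨fderiv ℝ (dualEnergy p) v v / fderiv ℝ massFunctional v v, ?_, fun h hh => ?_⟩
  · refine le_trans ?_ (le_max_left _ _)
    rw [abs_div, abs_of_pos hD0]
    have h1 : |fderiv ℝ (dualEnergy p) v v| ≤ M * M + B₁ * M := by
      rw [fderiv_dualEnergy hn hp2 hk, ← inner_nem hn hk]
      refine (abs_sub _ _).trans (add_le_add ?_ ?_)
      · have := (norm_gradL_le v).trans hvM
        exact (abs_real_inner_le_norm _ _).trans (by gcongr)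
      · have := (norm_fnL_le v).trans hvM
        exact (abs_real_inner_le_norm _ _).trans (by gcongr; exact hg v hvM)
    gcongr
  · have h1 := abs_fderiv_sub_multiplier_le (F := dualEnergy p) (contDiff_massFunctional hn) S hvS
      hvl hD0.ne' (constrainedDerivNorm_ne_top _ _ _) hh
    rw [fderiv_dualEnergy hn hp2 hk v h, fderiv_massFunctional hn v h, ← massConstraint_eq] at h1
    refine h1.trans ?_
    apply mul_le_mul_of_nonneg_left _ ENNReal.toReal_nonneg
    have h2 : |fderiv ℝ massFunctional v h / fderiv ℝ massFunctional v v| ≤ B₂ / lam * ‖h‖ := by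
      rw [abs_div, abs_of_pos hD0, div_mul_eq_mul_div]
      have h3 : |fderiv ℝ massFunctional v h| ≤ B₂ * ‖h‖ := by
        rw [fderiv_massFunctional_eq_inner hn]
        refine (abs_real_inner_le_norm _ _).trans ?_
        exact mul_le_mul (hφ v hvM) (norm_fnL_le h) (norm_nonneg _) hB₂
      gcongr
    rw [← fderiv_massFunctional hn v h]
    calc ‖h - (fderiv ℝ massFunctional v h / fderiv ℝ massFunctional v v) • v‖
        ≤ ‖h‖ + |fderiv ℝ massFunctional v h / fderiv ℝ massFunctional v v| * ‖v‖ := by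
          refine (norm_sub_le _ _).trans ?_
          rw [norm_smul, Real.norm_eq_abs]
      _ ≤ ‖h‖ + B₂ / lam * ‖h‖ * M := by gcongr
      _ = (1 + B₂ / lam * M) * ‖h‖ := by ring
      _ ≤ _ := by
          gcongr
          exact le_max_right _ _

end PalaisSmale

/-! ### Passage to the limit at negative energy -/

section PalaisSmale

variable {E : Type*} [NormedAddCommGroup E] [InnerProductSpace ℝ E] [FiniteDimensional ℝ E]
  [MeasurableSpace E] [BorelSpace E]

instance : TopologicalSpace.SeparableSpace (H1 E) := by
  have h0 : Fact ((2 : ℝ≥0∞) ≠ ⊤) := ⟨ENNReal.ofNat_ne_top⟩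
  have h : SecondCountableTopology E := secondCountable_of_proper
  have h1 : SecondCountableTopology (Lp ℝ 2 (volume : Measure E)) := inferInstance
  have h2 : SecondCountableTopology (Lp E 2 (volume : Measure E)) := inferInstance
  have h3 : SecondCountableTopology
      (WithLp 2 (Lp ℝ 2 (volume : Measure E) × Lp E 2 (volume : Measure E))) :=
    (WithLp.homeomorphProd 2 _ _).secondCountableTopology
  have h4 : SecondCountableTopology (H1 E) := Topology.IsInducing.subtypeVal.secondCountableTopology
  exact TopologicalSpace.SecondCountableTopology.to_separableSpace

/-- A solution of the Lagrange equation with negative energy has a negative multiplier. -/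
theorem multiplier_neg (hn : 2 < Module.finrank ℝ E) {p : ℝ} (hp2 : 2 < p)
    (hk : IsGrowth (growthExp E) (dualPower p)) {μ : ℝ} {w : H1 E}
    (heq : ∀ h : H1 E, inner ℝ (gradL w) (gradL h) =
      ∫ x, (dualPower p (fn w x) + 2 * μ * dualMass (fn w x)) * fn h x)
    (hI : dualEnergy p w < 0) : μ < 0 := by
  have hK : ∀ t, HasDerivAt (fun t => 1 / p * |dualChange t| ^ p + μ * dualChange t ^ 2)
      (dualPower p t + 2 * μ * dualMass t) t := fun t =>
    ((hasDerivAt_abs_dualChange_rpow hp2 t).add ((hasDerivAt_sq_dualChange t).const_mul μ)).congr_deriv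
      (by ring)
  have hpoh := pohozaev hn (hk.add_smul isGrowth_dualMass (2 * μ)) hK
    (by rw [one_div_mul_abs_dualChange_zero_rpow hp2, sq_dualChange_zero, mul_zero, add_zero]) heq
  rw [integral_add (integrable_primitive hn hk (hasDerivAt_abs_dualChange_rpow hp2)
    (one_div_mul_abs_dualChange_zero_rpow hp2) w) ((integrable_sq_dualChange hn w).const_mul μ),
    integral_const_mul μ] at hpoh
  rw [dualEnergy_eq] at hI
  have hm : 0 ≤ ∫ x, dualChange (fn w x) ^ 2 := integral_nonneg fun x => sq_nonneg _
  have hN : (0 : ℝ) < Module.finrank ℝ E := by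
    have : 0 < Module.finrank ℝ E := by omega
    exact_mod_cast this
  -- The Pohozaev identity amounts to `N μ ∫ f(w)² = N I(w) - ‖∇w‖²`, and the right side is
  -- negative.
  by_contra hμ
  rw [not_lt] at hμ
  have h1 : 0 ≤ (Module.finrank ℝ E : ℝ) * (μ * ∫ x, dualChange (fn w x) ^ 2) := by positivity
  have h2 := mul_neg_of_pos_of_neg hN hI
  nlinarith [sq_nonneg ‖gradL w‖]

/-- Bounded symmetric sequences that solve the Lagrange equation approximately, at a negative
energy level, converge strongly as soon as they converge weakly. -/
theorem tendsto_of_weak_of_almost_critical (hn : 2 < Module.finrank ℝ E)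
    {𝒢 : Set ((E ≃ₗᵢ[ℝ] E) × ℝ)} (h𝒢 : ∀ g ∈ 𝒢, g.2 ^ 2 = 1) (hs : HasSpreadOrbits 𝒢) {p : ℝ}
    (hp2 : 2 < p) (hp : p < 4 + 2 * growthExp E) {c M μ : ℝ} (hc : c < 0) {v : ℕ → H1 E} {w : H1 E}
    (hvS : ∀ n, v n ∈ symSub 𝒢) (hvM : ∀ n, ‖v n‖ ≤ M) (hwM : ‖w‖ ≤ M)
    (hweak : ∀ ℓ : H1 E →L[ℝ] ℝ, Tendsto (fun n => ℓ (v n)) atTop (𝓝 (ℓ w)))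
    (hI : Tendsto (fun n => dualEnergy p (v n)) atTop (𝓝 c))
    {ε ν : ℕ → ℝ} (hε : Tendsto ε atTop (𝓝 0)) (hν : Tendsto ν atTop (𝓝 μ))
    (hcrit : ∀ n, ∀ h ∈ symSub 𝒢, |inner ℝ (gradL (v n)) (gradL h)
      - (∫ x, dualPower p (fn (v n) x) * fn h x)
      - ν n * (2 * ∫ x, dualMass (fn (v n) x) * fn h x)| ≤ ε n * ‖h‖) :
    Tendsto v atTop (𝓝 w) := by
  have hr := growthExp_pos hn
  have hk : IsGrowth (growthExp E) (dualPower p) := isGrowth_dualPower hp2 hr.le hp.le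
  have hks : IsSubcritical (critExp E) (dualPower p) := isSubcritical_dualPower hp2 hr hp.le
  have hφ : IsGrowth (growthExp E) dualMass := isGrowth_dualMass
  have hwS : w ∈ symSub 𝒢 := mem_of_weak_tendsto (isClosed_symSub 𝒢) hvS hweak
  have hdS : ∀ n, v n - w ∈ symSub 𝒢 := fun n => Submodule.sub_mem _ (hvS n) hwS
  have hdM : ∀ n, ‖v n - w‖ ≤ 2 * M := fun n =>
    (norm_sub_le _ _).trans (by linarith [hvM n])
  have hdweak : ∀ ℓ : H1 E →L[ℝ] ℝ, Tendsto (fun n => ℓ (v n - w)) atTop (𝓝 0) := by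
    intro ℓ
    have h := (hweak ℓ).sub_const (ℓ w)
    rw [sub_self] at h
    exact h.congr fun n => (map_sub ℓ _ _).symm
  have hq := tendsto_integral_critExp hn hs hdS hdM hdweak
  have hgradw : Tendsto (fun n => inner ℝ (gradL w) (gradL (v n - w))) atTop (𝓝 0) :=
    hdweak ((innerSL ℝ (gradL w)).comp gradL)
  -- the limit solves the Lagrange equation
  have heqS : ∀ h ∈ symSub 𝒢, inner ℝ (gradL w) (gradL h) =
      ∫ x, (dualPower p (fn w x) + 2 * μ * dualMass (fn w x)) * fn h x := by
    intro h hh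
    have h1 : Tendsto (fun n => inner ℝ (gradL (v n)) (gradL h)) atTop
        (𝓝 (inner ℝ (gradL w) (gradL h))) := by
      have := hweak ((innerSL ℝ (gradL h)).comp gradL)
      simp only [ContinuousLinearMap.comp_apply, innerSL_apply_apply] at this
      simpa only [real_inner_comm (gradL h)] using this
    have h2 := tendsto_integral_growth_mul hn hvM hwM hq hk h
    have h3 := tendsto_integral_growth_mul hn hvM hwM hq hφ h
    have h4 := (h1.sub h2).sub (hν.mul (h3.const_mul 2))
    have h5 : Tendsto (fun n => inner ℝ (gradL (v n)) (gradL h)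
      - (∫ x, dualPower p (fn (v n) x) * fn h x)
      - ν n * (2 * ∫ x, dualMass (fn (v n) x) * fn h x)) atTop (𝓝 0) := by
      refine squeeze_zero_norm (fun n => hcrit n h hh) ?_
      simpa using hε.mul_const ‖h‖
    have h6 := tendsto_nhds_unique h4 h5
    have i1 : Integrable (fun x => dualPower p (fn w x) * fn h x) volume :=
      (memLp_nem hn hk w).integrable_mul (memLp_fn h)
    have h7 : ∫ x, (dualPower p (fn w x) + 2 * μ * dualMass (fn w x)) * fn h x
        = (∫ x, dualPower p (fn w x) * fn h x)
          + 2 * μ * ∫ x, dualMass (fn w x) * fn h x := by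
      rw [← integral_const_mul, ← integral_add i1 ((integrable_dualMass_mul hn w h).const_mul _)]
      congr 1
      funext x
      ring
    rw [h7]
    linarith
  -- The Pohozaev identity needs arbitrary test functions; oddness of the nonlinearity handles the
  -- symmetry of sign `-1`.
  have heq := symmetric_criticality hn h𝒢 (hk.add_smul hφ (2 * μ))
    (fun t => by rw [dualPower_neg, dualMass_neg]; ring) hwS heqS
  have hsplit : ∀ n, inner ℝ (gradL (v n)) (gradL (v n - w)) =
      ‖gradL (v n - w)‖ ^ 2 + inner ℝ (gradL w) (gradL (v n - w)) := by
    intro n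
    rw [← real_inner_self_eq_norm_sq, ← inner_add_left, ← map_add, sub_add_cancel]
  -- The power term converges, being subcritical, so energy can be lost only in the gradient. The
  -- mass of `w` is not known at this point.
  have hIw : dualEnergy p w ≤ c := by
    have h1 := tendsto_integral_primitive_of_subcritical hn hvM hwM hq hk hks
      (hasDerivAt_abs_dualChange_rpow hp2) (one_div_mul_abs_dualChange_zero_rpow hp2)
    have h2 : Tendsto (fun n => 1 / 2 * ‖gradL w‖ ^ 2 + inner ℝ (gradL w) (gradL (v n - w))
        - ∫ x, 1 / p * |dualChange (fn (v n) x)| ^ p) atTop (𝓝 (dualEnergy p w)) := by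
      rw [dualEnergy_eq]
      have := (hgradw.const_add (1 / 2 * ‖gradL w‖ ^ 2)).sub h1
      rwa [add_zero] at this
    refine le_of_tendsto_of_tendsto' h2 hI fun n => ?_
    rw [dualEnergy_eq]
    have h3 : ‖gradL (v n)‖ ^ 2 = ‖gradL w‖ ^ 2
        + 2 * inner ℝ (gradL w) (gradL (v n - w)) + ‖gradL (v n - w)‖ ^ 2 := by
      rw [← norm_add_sq_real, ← map_add, add_sub_cancel]
    nlinarith [sq_nonneg ‖gradL (v n - w)‖]
  have hμ : μ < 0 := multiplier_neg hn hp2 hk heq (hIw.trans_lt hc)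
  -- test the equation with the difference
  set D : ℕ → ℝ := fun n => ∫ x, (dualMass (fn (v n) x) - dualMass (fn w x)) * fn (v n - w) x
    with hD
  have hD0 : ∀ n, 0 ≤ D n := by
    intro n
    apply integral_nonneg_of_ae
    filter_upwards [fn_sub (v n) w] with x hx
    rw [hx]
    exact dualMass_mono_mul_nonneg _ _
  have hφw : Tendsto (fun n => ∫ x, dualMass (fn w x) * fn (v n - w) x) atTop (𝓝 0) := by
    have h := hdweak ((innerSL ℝ (nem hn hφ w)).comp fnL)
    simp only [ContinuousLinearMap.comp_apply, innerSL_apply_apply, inner_nem] at h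
    exact h
  have hDeq : ∀ n, ∫ x, dualMass (fn (v n) x) * fn (v n - w) x =
      D n + ∫ x, dualMass (fn w x) * fn (v n - w) x := by
    intro n
    rw [← sub_eq_iff_eq_add, ← integral_sub (integrable_dualMass_mul hn _ _)
      (integrable_dualMass_mul hn _ _)]
    congr 1
    funext x
    ring
  -- The power term and all pairings of `v n - w` with fixed elements vanish in the limit.
  have hsum : Tendsto (fun n => ‖gradL (v n - w)‖ ^ 2 + -(2 * ν n) * D n) atTop (𝓝 0) := by
    have h1 : Tendsto (fun n => inner ℝ (gradL (v n)) (gradL (v n - w))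
        - (∫ x, dualPower p (fn (v n) x) * fn (v n - w) x)
        - ν n * (2 * ∫ x, dualMass (fn (v n) x) * fn (v n - w) x)) atTop (𝓝 0) := by
      refine squeeze_zero_norm (a := fun n => |ε n| * (2 * M)) (fun n => ?_) ?_
      · refine (hcrit n _ (hdS n)).trans ?_
        have := le_abs_self (ε n)
        gcongr
        exact hdM n
      · simpa using hε.abs.mul_const (2 * M)
    have h2 := tendsto_integral_subcritical_mul_sub hn hvM hwM hq hks
    have h3 := ((h1.add h2).sub hgradw).add (hν.mul (hφw.const_mul 2))
    simp only [mul_zero, add_zero, sub_zero] at h3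
    refine h3.congr fun n => ?_
    rw [hsplit, hDeq]
    ring
  -- The coefficient of `D n` tends to `-2μ > -μ > 0`, so both terms of `hsum` are eventually
  -- nonnegative and each tends to zero.
  have hν2 : ∀ᶠ n in atTop, -μ ≤ -(2 * ν n) := by
    have h1 : 2 * μ < μ := by linarith
    filter_upwards [(hν.const_mul 2).eventually (gt_mem_nhds h1)] with n hn1
    linarith
  have hgrad0 : Tendsto (fun n => ‖gradL (v n - w)‖ ^ 2) atTop (𝓝 0) := by
    refine squeeze_zero' (Eventually.of_forall fun n => sq_nonneg _) ?_ hsum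
    filter_upwards [hν2] with n hn1
    have : 0 ≤ -(2 * ν n) * D n := mul_nonneg (by linarith) (hD0 n)
    linarith
  have hDlim : Tendsto D atTop (𝓝 0) := by
    have h1 := hsum.const_mul (-μ)⁻¹
    rw [mul_zero] at h1
    refine squeeze_zero' (Eventually.of_forall hD0) ?_ h1
    filter_upwards [hν2] with n hn1
    rw [le_inv_mul_iff₀ (by linarith)]
    have := mul_le_mul_of_nonneg_right hn1 (hD0 n)
    nlinarith [sq_nonneg ‖gradL (v n - w)‖]
  have hfn0 := tendsto_fnL_of_dualMass hn hvM hwM hq hDlim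
  rw [tendsto_iff_norm_sub_tendsto_zero]
  have h1 := (hfn0.add hgrad0).sqrt
  rw [add_zero, Real.sqrt_zero] at h1
  refine h1.congr fun n => ?_
  rw [← norm_sq_H1, Real.sqrt_sq (norm_nonneg _)]

theorem palaisSmaleOn_dualEnergy (hn : 2 < Module.finrank ℝ E) {𝒢 : Set ((E ≃ₗᵢ[ℝ] E) × ℝ)}
    (h𝒢 : ∀ g ∈ 𝒢, g.2 ^ 2 = 1) (hs : HasSpreadOrbits 𝒢) {p : ℝ} (hp2 : 2 < p)
    (hp : p < 4 + 2 * growthExp E) {lam c : ℝ} (hlam : 0 < lam) (hc : c < 0) :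
    PalaisSmaleOn (dualEnergy p) ((symSub 𝒢 : Set (H1 E)) ∩ massConstraint lam) c := by
  intro v hv hI hd
  have hk : IsGrowth (growthExp E) (dualPower p) :=
    isGrowth_dualPower hp2 (growthExp_pos hn).le hp.le
  have hvl : ∀ n, massFunctional (v n) = lam := fun n => by
    have := (hv n).2
    rw [massConstraint_eq] at this
    exact this
  obtain ⟨B, hB⟩ := hI.bddAbove_range
  obtain ⟨M, hM0, hM⟩ := exists_norm_le_of_dualEnergy_le hn hp2 hp lam B hlam.le
  have hvM : ∀ n, ‖v n‖ ≤ M := fun n => hM _ (hvl n) (hB (mem_range_self n))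
  obtain ⟨B', hB'⟩ := exists_multiplier hn (symSub 𝒢) hp2 hk hlam hM0
  choose ν hνB hν using fun n => hB' (v n) (hv n).1 (hvl n) (hvM n)
  obtain ⟨w, k₁, hk₁, hweak⟩ := exists_weak_subseq hvM
  -- A second extraction makes the multipliers converge.
  obtain ⟨μ, _, k₂, hk₂, hμ⟩ := tendsto_subseq_of_bounded
    (Metric.isBounded_closedBall (x := (0 : ℝ)) (r := B')) (x := ν ∘ k₁)
    fun n => by rw [mem_closedBall_zero_iff]; exact hνB _
  have hk := hk₁.comp hk₂
  have hwM : ‖w‖ ≤ M := by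
    have h1 := hweak (innerSL ℝ w)
    simp only [innerSL_apply_apply, real_inner_self_eq_norm_sq] at h1
    have h2 : ‖w‖ ^ 2 ≤ ‖w‖ * M := le_of_tendsto' h1 fun n =>
      (real_inner_le_norm _ _).trans (by gcongr; exact hvM _)
    rcases (norm_nonneg w).eq_or_lt with h | h
    · rw [← h]
      exact hM0
    · rw [sq] at h2
      exact le_of_mul_le_mul_left h2 h
  have hε : Tendsto (fun n => (constrainedDerivNorm (dualEnergy p)
      ((symSub 𝒢 : Set (H1 E)) ∩ massConstraint lam) (v n)).toReal * B') atTop (𝓝 0) := by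
    have h1 := (ENNReal.tendsto_toReal ENNReal.zero_ne_top).comp hd
    simpa using h1.mul_const B'
  have hlim : Tendsto (fun n => v (k₁ (k₂ n))) atTop (𝓝 w) :=
    tendsto_of_weak_of_almost_critical hn h𝒢 hs hp2 hp hc (fun n => (hv _).1) (fun n => hvM _) hwM
      (fun ℓ => (hweak ℓ).comp hk₂.tendsto_atTop) (hI.comp hk.tendsto_atTop)
      (hε.comp hk.tendsto_atTop) hμ fun n h hh => (hν (k₁ (k₂ n)) h hh).trans_eq
        (mul_assoc _ _ _).symm
  refine ⟨w, ⟨?_, ?_⟩, k₁ ∘ k₂, hk, hlim⟩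
  · exact (isClosed_symSub 𝒢).mem_of_tendsto hlim (Eventually.of_forall fun n => (hv _).1)
  -- The mass is continuous for strong convergence, so the limit stays on the constraint.
  · rw [massConstraint_eq]
    have h1 := ((contDiff_massFunctional hn).continuous.tendsto w).comp hlim
    refine tendsto_nhds_unique h1 (tendsto_const_nhds.congr fun n => ?_)
    exact (hvl _).symm

end PalaisSmale

end QuasilinearDual

theorem lemma3p2 (N m : ℕ) (hN : 4 ≤ N) (hm : 2 ≤ m) (hmN : 2 * m ≤ N) (hNm : N - 2 * m ≠ 1)
    (p : ℝ) (hp2 : 2 < p) (hp : p < 4 + 4 / (N : ℝ)) (lam : ℝ) (hlam : 0 < lam) :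
    ContDiff ℝ 1 (QuasilinearDual.dualEnergy (E := QuasilinearDual.Space N m) p) ∧
      ∀ c : ℝ, c < 0 →
        QuasilinearDual.PalaisSmaleOn
          (QuasilinearDual.dualEnergy (E := QuasilinearDual.Space N m) p)
          (QuasilinearDual.symmetricConstraint N m lam) c := by
  have hrank := QuasilinearDual.finrank_space hmN
  have hn : 2 < Module.finrank ℝ (QuasilinearDual.Space N m) := by omega
  -- The space has dimension `N`, so twice its growth exponent is `4 / N`.
  have hp' : p < 4 + 2 * QuasilinearDual.growthExp (QuasilinearDual.Space N m) := by
    rw [QuasilinearDual.growthExp, hrank]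
    refine hp.trans_eq ?_
    ring
  refine ⟨QuasilinearDual.contDiff_dualEnergy hn hp2 (QuasilinearDual.isGrowth_dualPower hp2
    (QuasilinearDual.growthExp_pos hn).le hp'.le), fun c hc => ?_⟩
  rw [QuasilinearDual.symmetricConstraint, QuasilinearDual.symmetricSpace_eq]
  exact QuasilinearDual.palaisSmaleOn_dualEnergy hn
    (fun g hg => QuasilinearDual.sq_snd_blockSymmetries hg)
    (QuasilinearDual.hasSpreadOrbits_blockSymmetries hm hNm) hp2 hp' hlam hc
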